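/- Let $\Sigma$ be a finite alphabet with $\sigma=|\Sigma|$. An indeterminate string $T$ of length $n$ is a sequence $T[1]\dots T[n]$ of nonempty subsets of $\Sigma$; a symbol $T[i]$ is solid if $|T[i]|=1$ and non-solid otherwise, a solid string is one all of whose symbols are solid, and $k$ denotes the number of non-solid symbols of $T$. Assume $2\le\sigma\le n$, that $\Sigma=\{0,\dots,\sigma-1\}$, and that each non-solid symbol is given by a bit vector of size $\sigma$. An indeterminate string $U$ of length $m$ occurs in $T$ at position $i$ if $i+m-1\le n$ and $U[t]\cap T[i+t-1]\neq\emptyset$ for $t=1,\dots,m$; then $U\odot i$ is the indeterminate string $U[1]\cap T[i],\dots,U[m]\cap T[i+m-1]$. A $\odot$-prefix of $T$ is a solid string $S$ of the form $S=T[1..m]\odot i$, where $T[1..m]=T[1]\dots T[m]$ and $i$ is a position at which $T[1..m]$ occurs in $T$. A cover of $T$ is a solid string $S$ such that every position of $T$ lies in some occurrence of $S$ in $T$. Theorem. There is an algorithm on the word RAM (words of $\Theta(\log n)$ bits, unit-cost arithmetic, comparisons and memory access) which, for every such $T$, computes in $\mathcal{O}\bigl(n\cdot\max(1,k)^4\bigr)$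 time a shortest cover among all $\odot$-prefixes of $T$: it outputs a pair $(m,i)$ such that $S=T[1..m]\odot i$ is a $\odot$-prefix of $T$ that is a cover of $T$, with $m$ smallest possible, or reports that no $\odot$-prefix of $T$ is a cover of $T$. -/

import Mathlib

namespace IndetString

/-! ### Indeterminate strings (positions are numbered from `0`) -/

/-- An indeterminate string of length `n` over the alphabet `α`: a sequence of `n` nonempty subsets
of `α`. -/
structure IString (α : Type) (n : ℕ) where
  sym : Fin n → Finset α
  nonempty : ∀ i, (sym i).Nonempty

namespace IString

variable {α : Type} {m n : ℕ}

/-- The symbol at position `i` is solid. -/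
def SolidAt (T : IString α n) (i : Fin n) : Prop := (T.sym i).card = 1

instance (T : IString α n) : DecidablePred T.SolidAt :=
  fun i => inferInstanceAs (Decidable ((T.sym i).card = 1))

/-- A solid string is an i-string all of whose symbols are solid. -/
def IsSolid (T : IString α n) : Prop := ∀ i, T.SolidAt i

/-- The positions of the non-solid symbols, in increasing order. -/
def nonSolidPositions (T : IString α n) : List (Fin n) :=
  (List.finRange n).filter (fun i => ¬ T.SolidAt i)

/-- The number `k` of non-solid symbols. -/
def numNonSolid (T : IString α n) : ℕ := T.nonSolidPositions.length

/-- The factor of length `m` starting at position `j`. -/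
def factor (T : IString α n) (j m : ℕ) (h : j + m ≤ n) : IString α m where
  sym t := T.sym ⟨j + t, by omega⟩
  nonempty _ := T.nonempty _

/-- The prefix of length `m`. -/
def pre (T : IString α n) (m : ℕ) (h : m ≤ n) : IString α m := T.factor 0 m (by omega)

variable [DecidableEq α]

/-- `U ≈ V`: at each position the two symbols intersect. -/
def Matches (U V : IString α n) : Prop := ∀ i, (U.sym i ∩ V.sym i).Nonempty

/-- `S` occurs in `T` at position `j`. -/
def OccursAt (S : IString α m) (T : IString α n) (j : ℕ) : Prop :=
  ∃ h : j + m ≤ n, S.Matches (T.factor j m h)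

/-- `S` is a cover of `T`: a solid string such that each position of `T` lies in an occurrence
of `S`. -/
def IsCover (S : IString α m) (T : IString α n) : Prop :=
  S.IsSolid ∧ ∀ i : Fin n, ∃ j : ℕ, S.OccursAt T j ∧ j ≤ i ∧ (i : ℕ) < j + m

/-- `U ⊙ j`, for an occurrence `j` of `U` in `T`: the symbolwise intersection of `U` with the
factor of `T` starting at `j`. -/
def odot (U : IString α m) (T : IString α n) (j : ℕ) (h : U.OccursAt T j) : IString α m where
  sym t := U.sym t ∩ (T.factor j m h.1).sym t
  nonempty t := h.2 t

/-- `S` is a `⊙`-prefix of `T`: it is solid and equal to `(prefix of T of length |S|) ⊙ j` for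
some position `j`. -/
def IsOdotPrefix (S : IString α m) (T : IString α n) : Prop :=
  S.IsSolid ∧ ∃ (hm : m ≤ n) (j : ℕ) (h : (T.pre m hm).OccursAt T j),
    S = (T.pre m hm).odot T j h

/-- The pair `(m, j)` answers the query for a shortest cover of `T` among the `⊙`-prefixes:
either it denotes the `⊙`-prefix `(prefix of T of length m) ⊙ j`, which is a cover, and no cover
that is a `⊙`-prefix is shorter; or no `⊙`-prefix is a cover, which is reported by `m = 0`. -/
def IsAnswer (T : IString α n) (m j : ℕ) : Prop :=
  (∃ (hm : m ≤ n) (h : (T.pre m hm).OccursAt T j),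
      ((T.pre m hm).odot T j h).IsOdotPrefix T ∧ ((T.pre m hm).odot T j h).IsCover T ∧
      ∀ (m' : ℕ) (S : IString α m'), S.IsOdotPrefix T → S.IsCover T → m ≤ m') ∨
  (m = 0 ∧ ∀ (m' : ℕ) (S : IString α m'), S.IsOdotPrefix T → ¬ S.IsCover T)

end IString

/-! ### A word RAM with structured programs

Registers and memory cells hold words of `w` bits, i.e. natural numbers below `2 ^ w`; memory
addresses are words. The program is a fixed finite object that does not depend on the input or
on `w`. Every node of an evaluated expression, every assignment, every write to memory and every
evaluated branch or loop test costs one step. -/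

inductive Op where
  | add | sub | mul | div | mod | lt | eq

/-- Unit-cost operations on `w`-bit words: addition and multiplication modulo `2 ^ w`, truncated
subtraction, quotient and remainder, and comparisons with result `0` or `1`. -/
def Op.apply (w : ℕ) : Op → ℕ → ℕ → ℕ
  | .add, a, b => (a + b) % 2 ^ w
  | .sub, a, b => a - b
  | .mul, a, b => (a * b) % 2 ^ w
  | .div, a, b => a / b
  | .mod, a, b => a % b
  | .lt, a, b => if a < b then 1 else 0
  | .eq, a, b => if a = b then 1 else 0

inductive Expr where
  /-- a constant -/
  | lit (c : ℕ)
  /-- the contents of a register -/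
  | reg (r : ℕ)
  /-- the contents of the memory cell whose address is the value of `e` -/
  | load (e : Expr)
  | bin (o : Op) (e₁ e₂ : Expr)

structure State where
  reg : ℕ → ℕ
  mem : ℕ → ℕ

def Expr.eval (w : ℕ) (s : State) : Expr → ℕ
  | .lit c => c % 2 ^ w
  | .reg r => s.reg r
  | .load e => s.mem (e.eval w s)
  | .bin o e₁ e₂ => o.apply w (e₁.eval w s) (e₂.eval w s)

def Expr.cost : Expr → ℕ
  | .lit _ => 1
  | .reg _ => 1
  | .load e => e.cost + 1
  | .bin _ e₁ e₂ => e₁.cost + e₂.cost + 1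

inductive Prog where
  | skip
  /-- register `r` receives the value of `e` -/
  | assign (r : ℕ) (e : Expr)
  /-- the memory cell with address `a` receives the value of `e` -/
  | store (a e : Expr)
  | seq (p q : Prog)
  /-- if `e` is nonzero then `p` else `q` -/
  | branch (e : Expr) (p q : Prog)
  /-- as long as `e` is nonzero, do `p` -/
  | loop (e : Expr) (p : Prog)

/-- `Runs w p s t s'`: on `w`-bit words, the program `p` started in the state `s` halts in the
state `s'` after exactly `t` steps. -/
inductive Runs (w : ℕ) : Prog → State → ℕ → State → Prop
  | skip (s : State) : Runs w .skip s 1 s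
  | assign (s : State) (r : ℕ) (e : Expr) :
      Runs w (.assign r e) s (e.cost + 1) { s with reg := Function.update s.reg r (e.eval w s) }
  | store (s : State) (a e : Expr) :
      Runs w (.store a e) s (a.cost + e.cost + 1)
        { s with mem := Function.update s.mem (a.eval w s) (e.eval w s) }
  | seq {p q : Prog} {s s' s'' : State} {t t' : ℕ} :
      Runs w p s t s' → Runs w q s' t' s'' → Runs w (.seq p q) s (t + t') s''
  | branch_true {e : Expr} {p q : Prog} {s s' : State} {t : ℕ} :
      e.eval w s ≠ 0 → Runs w p s t s' → Runs w (.branch e p q) s (e.cost + 1 + t) s'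
  | branch_false {e : Expr} {p q : Prog} {s s' : State} {t : ℕ} :
      e.eval w s = 0 → Runs w q s t s' → Runs w (.branch e p q) s (e.cost + 1 + t) s'
  | loop_stop {e : Expr} {p : Prog} {s : State} :
      e.eval w s = 0 → Runs w (.loop e p) s (e.cost + 1) s
  | loop_step {e : Expr} {p : Prog} {s s' s'' : State} {t t' : ℕ} :
      e.eval w s ≠ 0 → Runs w p s t s' → Runs w (.loop e p) s' t' s'' →
      Runs w (.loop e p) s (e.cost + 1 + t + t') s''

/-! ### The input -/

/-- The word that stands for position `i` of `T`: the symbol itself if it is solid, and `σ + r` if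
it is the `r`-th non-solid symbol (counting from `0`). -/
def IString.code {σ n : ℕ} (T : IString (Fin σ) n) (i : Fin n) : ℕ :=
  if T.SolidAt i then ((T.sym i).min' (T.nonempty i) : Fin σ)
  else σ + T.nonSolidPositions.idxOf i

/-- The input: the numbers `n`, `k`, `σ`, the `n` words for the positions of `T`, and for each
non-solid symbol, in order, its bit vector of size `σ`, one bit per word. -/
def IString.input {σ n : ℕ} (T : IString (Fin σ) n) : List ℕ :=
  [n, T.numNonSolid, σ] ++ List.ofFn T.code ++
    T.nonSolidPositions.flatMap (fun i => List.ofFn fun c : Fin σ => if c ∈ T.sym i then 1 else 0)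

/-- The initial state: the input is in memory from address `0` on, and everything else is `0`. -/
def IString.initState {σ n : ℕ} (T : IString (Fin σ) n) : State where
  reg _ := 0
  mem a := T.input.getD a 0

end IndetString

/-! Call `T[1..m] ⊙ i`, when it is solid, the candidate of the position `i`, and let `Z i` be the
length of the longest prefix of `T` that matches at `i`. Positions with equal candidates form a
class. The candidate of a class is a cover of `T` exactly when the list of its occurrences, closed
by the sentinel `n`, has no gap larger than `m` (`Linked.le_iff_cover`). So it is enough to maintain
these lists, with their largest gaps, for growing `m`.

The lists are short in total. Call `j` wide if some `t` has both `t` and `j + t` non-solid. If `j`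
is not wide and `m ≤ Z j`, each intersection of the symbols at `t` and `j + t` is a singleton, so
`j` has a candidate, and a candidate of another position can occur at `j > 0` only if it equals that
of `j`. Hence such a `j` lies in the list of one class only. A wide `j` is a difference of two
non-solid positions, so there are at most `k ^ 2` of them (`Coded.card_wide_le`), each in at most
`n` lists. This bounds the entries other than the sentinels `0` and `n` by `n * (k ^ 2 + 1)`
(`Coded.width_sum_le`); `Coded.Classes.member_iff` is the correctness of the lists.

When the prefix grows by a solid symbol, no class splits and no incompatibility arises: the only
change is that the positions `j` with `Z j` equal to the old length leave their lists. Deletion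
merges two neighbouring gaps, so a doubly linked list with a running maximum suffices
(`Linked.delete`), and each position is treated in this way for one length only. When the prefix
grows by a non-solid symbol, which happens at most `k` times, the classes are split by the symbol
chosen there and all lists are rebuilt. Finally, a cover of length `m` has to occur at `n - m`, so
for length `m` only the classes that may contain `n - m` are tested; as `n - m` takes each value
once, all tests together cost no more than one rebuilding. The sum is of order `n * (k + 1) ^ 3`,
which is within the claimed bound.

The numbers `Z i` come from jumps over longest common extensions of the string of codes. Distinct
non-solid positions have distinct codes, so every jump that does not end the match passes a
non-solid position on one of the two sides, and at most `2 * k + 1` jumps are needed. The extensions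
required start at position `0` or right after a non-solid position; a Z-algorithm computes each of
these `k + 1` tables in linear time.

The programs are written over unbounded numbers with arrays, and only loop iterations are counted.
`ARuns.simulate` transfers correctness and cost to the word RAM once and for all. The arrays are far
larger than the running time, but memory outside the input is initially zero, so they need no
initialisation. -/

namespace IndetString

/-! ### An intermediate language

Programs over unbounded natural numbers, with registers and three-dimensional arrays that are
initially zero. The input is read-only. The field `tk` of a state counts the executed loop
iterations. -/

/-- The operation of `Op` on unbounded natural numbers. -/
def Op.val : Op → ℕ → ℕ → ℕ
  | .add, a, b => a + b
  | .sub, a, b => a - b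
  | .mul, a, b => a * b
  | .div, a, b => a / b
  | .mod, a, b => a % b
  | .lt, a, b => if a < b then 1 else 0
  | .eq, a, b => if a = b then 1 else 0

/-- The input, and a bound for the contents of registers and array cells. -/
structure Env where
  inp : ℕ → ℕ
  X : ℕ

inductive AExpr where
  | lit (c : ℕ)
  | reg (r : ℕ)
  /-- the cell of array `α` with index `(x, y, z)` -/
  | get (α : ℕ) (x y z : AExpr)
  | inp (e : AExpr)
  | bin (o : Op) (e₁ e₂ : AExpr)

instance (c : ℕ) : OfNat AExpr c := ⟨.lit c⟩
instance : Add AExpr := ⟨.bin .add⟩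
instance : Sub AExpr := ⟨.bin .sub⟩
instance : Mul AExpr := ⟨.bin .mul⟩

structure AState where
  r : ℕ → ℕ
  a : ℕ → ℕ → ℕ → ℕ → ℕ
  tk : ℕ

namespace AState

def setReg (s : AState) (r v : ℕ) : AState := { s with r := fun x => if x = r then v else s.r x }

def put (s : AState) (α x y z v : ℕ) : AState :=
  { s with a := fun β x' y' z' =>
      if β = α ∧ x' = x ∧ y' = y ∧ z' = z then v else s.a β x' y' z' }

def tick (s : AState) : AState := { s with tk := s.tk + 1 }

@[simp] theorem setReg_r (s : AState) (r v x : ℕ) :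
    (s.setReg r v).r x = if x = r then v else s.r x := rfl
@[simp] theorem setReg_a (s : AState) (r v : ℕ) : (s.setReg r v).a = s.a := rfl
@[simp] theorem setReg_tk (s : AState) (r v : ℕ) : (s.setReg r v).tk = s.tk := rfl
@[simp] theorem put_r (s : AState) (α x y z v : ℕ) : (s.put α x y z v).r = s.r := rfl
@[simp] theorem put_a (s : AState) (α x y z v β x' y' z' : ℕ) : (s.put α x y z v).a β x' y' z' =
    if β = α ∧ x' = x ∧ y' = y ∧ z' = z then v else s.a β x' y' z' := rfl
@[simp] theorem put_tk (s : AState) (α x y z v : ℕ) : (s.put α x y z v).tk = s.tk := rfl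
@[simp] theorem tick_r (s : AState) : s.tick.r = s.r := rfl
@[simp] theorem tick_a (s : AState) : s.tick.a = s.a := rfl
@[simp] theorem tick_tk (s : AState) : s.tick.tk = s.tk + 1 := rfl

end AState

namespace AExpr

def val (E : Env) (s : AState) : AExpr → ℕ
  | lit c => c
  | reg r => s.r r
  | get α x y z => s.a α (x.val E s) (y.val E s) (z.val E s)
  | inp e => E.inp (e.val E s)
  | bin o e₁ e₂ => o.val (e₁.val E s) (e₂.val E s)

section
variable (E : Env) (s : AState)
@[simp] theorem val_lit (c : ℕ) : (lit c).val E s = c := rfl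
@[simp] theorem val_zero : AExpr.val E s 0 = 0 := rfl
@[simp] theorem val_one : AExpr.val E s 1 = 1 := rfl
@[simp] theorem val_two : AExpr.val E s 2 = 2 := rfl
@[simp] theorem val_three : AExpr.val E s 3 = 3 := rfl
@[simp] theorem val_reg (r : ℕ) : (reg r).val E s = s.r r := rfl
@[simp] theorem val_get (α : ℕ) (x y z : AExpr) :
    (get α x y z).val E s = s.a α (x.val E s) (y.val E s) (z.val E s) := rfl
@[simp] theorem val_inp (e : AExpr) : (inp e).val E s = E.inp (e.val E s) := rfl
@[simp] theorem val_add (e f : AExpr) : (e + f).val E s = e.val E s + f.val E s := rfl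
@[simp] theorem val_sub (e f : AExpr) : (e - f).val E s = e.val E s - f.val E s := rfl
@[simp] theorem val_mul (e f : AExpr) : (e * f).val E s = e.val E s * f.val E s := rfl
@[simp] theorem val_lt (e f : AExpr) :
    (bin .lt e f).val E s = if e.val E s < f.val E s then 1 else 0 := rfl
@[simp] theorem val_eq (e f : AExpr) :
    (bin .eq e f).val E s = if e.val E s = f.val E s then 1 else 0 := rfl
end

/-- Expressions whose value is automatically at most `E.X`. -/
def simple : AExpr → Bool
  | lit c => decide (c ≤ 12)
  | reg _ => true
  | get _ _ _ _ => true
  | inp _ => true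
  | bin .sub e _ => e.simple
  | bin .lt _ _ => true
  | bin .eq _ _ => true
  | bin _ _ _ => false

/-- The value of `e` is at most `E.X ^ e.deg`. -/
def deg : AExpr → ℕ
  | lit c => c
  | reg _ => 1
  | get _ _ _ _ => 1
  | inp _ => 1
  | bin .add e f => max e.deg f.deg + 1
  | bin .mul e f => e.deg + f.deg
  | bin .lt _ _ => 0
  | bin .eq _ _ => 0
  | bin _ e _ => e.deg

/-- The bounds guarantee a faithful translation: constants up to `12` are at most `E.X`, registers
`62` and `63` are reserved for the layout, degree `18` keeps every intermediate value below `2 ^ w`,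
and degree `6` keeps input addresses below the region of the arrays. -/
def wf : AExpr → Bool
  | lit c => decide (c ≤ 12)
  | reg r => decide (r < 62)
  | get α x y z => decide (α < 32) && x.wf && y.wf && z.wf && x.simple && y.simple && z.simple
  | inp e => e.wf && decide (e.deg ≤ 6)
  | bin o e f => e.wf && f.wf && decide ((bin o e f).deg ≤ 18)

/-- The memory address of an array cell; register `63` holds the side length of the arrays and
register `62` an offset that keeps the input apart. -/
def address (α : ℕ) (x y z : Expr) : Expr :=
  .bin .add (.lit α) (.bin .mul (.lit 32) (.bin .add z (.bin .mul (.reg 63)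
    (.bin .add y (.bin .mul (.reg 63) (.bin .add x (.reg 62)))))))

def compile : AExpr → Expr
  | lit c => .lit c
  | reg r => .reg r
  | get α x y z => .load (address α x.compile y.compile z.compile)
  | inp e => .load e.compile
  | bin o e f => .bin o e.compile f.compile

end AExpr

inductive AProg where
  | skip
  | assign (r : ℕ) (e : AExpr)
  | store (α : ℕ) (x y z e : AExpr)
  | seq (p q : AProg)
  | branch (e : AExpr) (p q : AProg)
  | loop (e : AExpr) (p : AProg)

namespace AProg

def wf : AProg → Bool
  | skip => true
  | assign r e => decide (r < 62) && e.wf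
  | store α x y z e => decide (α < 32) && x.wf && y.wf && z.wf && x.simple && y.simple && z.simple
      && e.wf
  | seq p q => p.wf && q.wf
  | branch e p q => e.wf && p.wf && q.wf
  | loop e p => e.wf && p.wf

def compile : AProg → Prog
  | skip => .skip
  | assign r e => .assign r e.compile
  | store α x y z e => .store (AExpr.address α x.compile y.compile z.compile) e.compile
  | seq p q => .seq p.compile q.compile
  | branch e p q => .branch e.compile p.compile q.compile
  | loop e p => .loop e.compile p.compile

/-- The number of steps between loop iterations. -/
def size : AProg → ℕ
  | skip => 1
  | assign _ e => e.compile.cost + 1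
  | store α x y z e =>
      (AExpr.address α x.compile y.compile z.compile).cost + e.compile.cost + 1
  | seq p q => p.size + q.size
  | branch e p q => e.compile.cost + 1 + (p.size + q.size)
  | loop e p => e.compile.cost + 1 + p.size

def writesReg : AProg → ℕ → Bool
  | skip, _ => false
  | assign r _, x => decide (x = r)
  | store _ _ _ _ _, _ => false
  | seq p q, x => p.writesReg x || q.writesReg x
  | branch _ p q, x => p.writesReg x || q.writesReg x
  | loop _ p, x => p.writesReg x

def writesArr : AProg → ℕ → Bool
  | skip, _ => false
  | assign _ _, _ => false
  | store α _ _ _ _, x => decide (x = α)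
  | seq p q, x => p.writesArr x || q.writesArr x
  | branch _ p q, x => p.writesArr x || q.writesArr x
  | loop _ p, x => p.writesArr x

end AProg

/-- The side conditions on writes keep all stored values at most `E.X`; they are what makes array
indices and products fit into words later on. -/
inductive ARuns (E : Env) : AProg → AState → AState → Prop
  | skip (s : AState) : ARuns E .skip s s
  | assign (s : AState) (r : ℕ) (e : AExpr) : (e.simple = true ∨ e.val E s ≤ E.X) →
      ARuns E (.assign r e) s (s.setReg r (e.val E s))
  | store (s : AState) (α : ℕ) (x y z e : AExpr) : (e.simple = true ∨ e.val E s ≤ E.X) →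
      ARuns E (.store α x y z e) s (s.put α (x.val E s) (y.val E s) (z.val E s) (e.val E s))
  | seq {p q : AProg} {s s' s'' : AState} :
      ARuns E p s s' → ARuns E q s' s'' → ARuns E (.seq p q) s s''
  | branch_true {e : AExpr} {p q : AProg} {s s' : AState} :
      e.val E s ≠ 0 → ARuns E p s s' → ARuns E (.branch e p q) s s'
  | branch_false {e : AExpr} {p q : AProg} {s s' : AState} :
      e.val E s = 0 → ARuns E q s s' → ARuns E (.branch e p q) s s'
  | loop_done {e : AExpr} {p : AProg} {s : AState} : e.val E s = 0 → ARuns E (.loop e p) s s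
  | loop_step {e : AExpr} {p : AProg} {s s' s'' : AState} :
      e.val E s ≠ 0 → ARuns E p s s' → ARuns E (.loop e p) s'.tick s'' → ARuns E (.loop e p) s s''

/-! ### Simulation on the word RAM -/

/-- A mixed radix numeral with digits `α`, `z`, `y` and leading part `x + O`. Uniqueness of digits
makes it injective, and putting the offset into the leading part makes every address at least `O`.
-/
def cell (Y O α x y z : ℕ) : ℕ := α + 32 * (z + Y * (y + Y * (x + O)))

theorem eq_of_add_mul_eq {B a a' q q' : ℕ} (h : a < B) (h' : a' < B)
    (e : a + B * q = a' + B * q') : a = a' ∧ q = q' := by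
  have h1 : a = a' := by
    have := congrArg (· % B) e
    simpa [Nat.add_mul_mod_self_left, Nat.mod_eq_of_lt h, Nat.mod_eq_of_lt h'] using this
  subst h1
  exact ⟨rfl, Nat.eq_of_mul_eq_mul_left (by omega) (Nat.add_left_cancel e)⟩

theorem cell_inj {Y O α x y z α' x' y' z' : ℕ} (hα : α < 32) (hα' : α' < 32)
    (hz : z < Y) (hz' : z' < Y) (hy : y < Y) (hy' : y' < Y)
    (e : cell Y O α x y z = cell Y O α' x' y' z') : α = α' ∧ x = x' ∧ y = y' ∧ z = z' := by
  obtain ⟨h1, e⟩ := eq_of_add_mul_eq hα hα' e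
  obtain ⟨h2, e⟩ := eq_of_add_mul_eq hz hz' e
  obtain ⟨h3, e⟩ := eq_of_add_mul_eq hy hy' e
  exact ⟨h1, by omega, h3, h2⟩

theorem le_cell {Y O α x y z : ℕ} (hY : 1 ≤ Y) : O ≤ cell Y O α x y z := by
  have h1 : x + O ≤ Y * (x + O) := Nat.le_mul_of_pos_left _ hY
  have h2 : y + Y * (x + O) ≤ Y * (y + Y * (x + O)) := Nat.le_mul_of_pos_left _ hY
  unfold cell
  omega

/-- Size relations between the word length and the parameters of the memory layout. -/
structure Layout (E : Env) (w : ℕ) : Prop where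
  hX : 12 ≤ E.X
  hw : (E.X + 1) ^ 20 ≤ 2 ^ w

/-- `cs` represents `s`. -/
structure Sim (E : Env) (cs : State) (s : AState) : Prop where
  reg : ∀ r < 62, cs.reg r = s.r r
  regY : cs.reg 63 = E.X + 1
  regO : cs.reg 62 = (E.X + 1) ^ 7
  arr : ∀ α < 32, ∀ x ≤ E.X, ∀ y ≤ E.X, ∀ z ≤ E.X,
    cs.mem (cell (E.X + 1) ((E.X + 1) ^ 7) α x y z) = s.a α x y z
  inp : ∀ a < (E.X + 1) ^ 7, cs.mem a = E.inp a
  r_le : ∀ r, s.r r ≤ E.X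
  a_le : ∀ α x y z, s.a α x y z ≤ E.X
  inp_le : ∀ a, E.inp a ≤ E.X

variable {E : Env} {w : ℕ} {cs : State} {s : AState}

theorem AExpr.val_le_of_simple (hX : 12 ≤ E.X) (hs : Sim E cs s) :
    ∀ e : AExpr, e.simple = true → e.val E s ≤ E.X
  | lit c, h => by simp [simple] at h; simp; omega
  | reg r, _ => hs.r_le r
  | get _ _ _ _, _ => hs.a_le _ _ _ _
  | inp _, _ => hs.inp_le _
  | bin .sub e f, h => (Nat.sub_le _ _).trans (val_le_of_simple hX hs e h)
  | bin .lt e f, _ => by simp only [val_lt]; split <;> omega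
  | bin .eq e f, _ => by simp only [val_eq]; split <;> omega

theorem AExpr.val_le_pow (hX : 12 ≤ E.X) (hs : Sim E cs s) :
    ∀ e : AExpr, e.val E s ≤ E.X ^ e.deg
  -- A constant `c` is below `2 ^ c`, which explains its degree.
  | lit c => (Nat.lt_two_pow_self.le).trans (Nat.pow_le_pow_left (by omega) c)
  | reg r => by simpa [deg] using hs.r_le r
  | get _ _ _ _ => by simpa [deg] using hs.a_le _ _ _ _
  | inp _ => by simpa [deg] using hs.inp_le _
  | bin o e f => by
    have h1 := val_le_pow hX hs e
    have h2 := val_le_pow hX hs f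
    cases o with
    | add =>
      have h3 : E.X ^ e.deg ≤ E.X ^ max e.deg f.deg := Nat.pow_le_pow_right (by omega) (by omega)
      have h4 : E.X ^ f.deg ≤ E.X ^ max e.deg f.deg := Nat.pow_le_pow_right (by omega) (by omega)
      simp only [val, Op.val, deg, pow_succ]
      nlinarith
    | sub => exact (Nat.sub_le _ _).trans h1
    | mul => simpa only [val, Op.val, deg, pow_add] using Nat.mul_le_mul h1 h2
    | div => exact (Nat.div_le_self _ _).trans h1
    | mod => exact (Nat.mod_le _ _).trans h1
    | lt => simp only [val, Op.val, deg]; split <;> simp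
    | eq => simp only [val, Op.val, deg]; split <;> simp

theorem pow_le_of_layout (hl : Layout E w) {d : ℕ} (hd : d ≤ 18) : E.X ^ d < 2 ^ w :=
  calc E.X ^ d ≤ E.X ^ 18 := Nat.pow_le_pow_right (by have := hl.hX; omega) hd
    _ ≤ (E.X + 1) ^ 18 := Nat.pow_le_pow_left (by omega) _
    _ < (E.X + 1) ^ 20 := Nat.pow_lt_pow_right (by have := hl.hX; omega) (by omega)
    _ ≤ 2 ^ w := hl.hw

theorem cell_lt (hl : Layout E w) {α x y z : ℕ} (hα : α < 32) (hx : x ≤ E.X) (hy : y ≤ E.X)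
    (hz : z ≤ E.X) : cell (E.X + 1) ((E.X + 1) ^ 7) α x y z < 2 ^ w := by
  refine lt_of_lt_of_le ?_ hl.hw
  have hX := hl.hX
  set Y := E.X + 1 with hY
  have h1 : x + Y ^ 7 < Y ^ 8 := by
    have : 1 ≤ Y ^ 6 := Nat.one_le_pow _ _ (by omega)
    have e : Y ^ 8 = Y * (Y * Y ^ 6) := by ring
    have e' : Y ^ 7 = Y * Y ^ 6 := by ring
    have h2 : Y ≤ Y * Y ^ 6 := Nat.le_mul_of_pos_right _ this
    have h3 : 2 * (Y * Y ^ 6) ≤ Y * (Y * Y ^ 6) := Nat.mul_le_mul_right _ (by omega)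
    omega
  have h2 : y + Y * (x + Y ^ 7) < Y ^ 9 := by
    have e : Y ^ 9 = Y * Y ^ 8 := by ring
    rw [e]; nlinarith
  have h3 : z + Y * (y + Y * (x + Y ^ 7)) < Y ^ 10 := by
    have e : Y ^ 10 = Y * Y ^ 9 := by ring
    rw [e]; nlinarith
  have h4 : cell Y (Y ^ 7) α x y z < 32 * Y ^ 10 := by unfold cell; omega
  have h5 : 32 ≤ Y ^ 2 := by nlinarith
  calc _ < 32 * Y ^ 10 := h4
    _ ≤ Y ^ 2 * Y ^ 10 := Nat.mul_le_mul_right _ h5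
    _ = Y ^ 12 := by ring
    _ ≤ Y ^ 20 := Nat.pow_le_pow_right (by omega) (by omega)

theorem AExpr.eval_address (hl : Layout E w) (hs : Sim E cs s) {α x y z : ℕ} {ex ey ez : Expr}
    (hα : α < 32) (hx : x ≤ E.X) (hy : y ≤ E.X) (hz : z ≤ E.X) (h1 : ex.eval w cs = x)
    (h2 : ey.eval w cs = y) (h3 : ez.eval w cs = z) :
    (address α ex ey ez).eval w cs = cell (E.X + 1) ((E.X + 1) ^ 7) α x y z := by
  have h := cell_lt hl hα hx hy hz
  have hX := hl.hX
  set Y := E.X + 1 with hY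
  simp only [address, Expr.eval, Op.apply, h1, h2, h3, hs.regY, hs.regO, ← hY]
  have e0 : cell Y (Y ^ 7) α x y z = α + 32 * (z + Y * (y + Y * (x + Y ^ 7))) := rfl
  have b1 : x + Y ^ 7 ≤ Y * (x + Y ^ 7) := Nat.le_mul_of_pos_left _ (by omega)
  have b2 : y + Y * (x + Y ^ 7) ≤ Y * (y + Y * (x + Y ^ 7)) := Nat.le_mul_of_pos_left _ (by omega)
  have b3 : 32 < 2 ^ w := lt_of_lt_of_le (by
    calc 32 < 13 ^ 20 := by norm_num
      _ ≤ Y ^ 20 := Nat.pow_le_pow_left (by omega) _) hl.hw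
  rw [Nat.mod_eq_of_lt (show x + Y ^ 7 < 2 ^ w by omega),
    Nat.mod_eq_of_lt (show Y * (x + Y ^ 7) < 2 ^ w by omega),
    Nat.mod_eq_of_lt (show y + Y * (x + Y ^ 7) < 2 ^ w by omega),
    Nat.mod_eq_of_lt (show Y * (y + Y * (x + Y ^ 7)) < 2 ^ w by omega),
    Nat.mod_eq_of_lt (show z + Y * (y + Y * (x + Y ^ 7)) < 2 ^ w by omega),
    Nat.mod_eq_of_lt (show 32 < 2 ^ w by omega),
    Nat.mod_eq_of_lt (show α < 2 ^ w by omega),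
    Nat.mod_eq_of_lt (show 32 * (z + Y * (y + Y * (x + Y ^ 7))) < 2 ^ w by omega),
    Nat.mod_eq_of_lt (by omega), e0]

/-- The degree bounds show that no operation overflows, so the reductions modulo `2 ^ w` have no
effect. -/
theorem AExpr.eval_compile (hl : Layout E w) (hs : Sim E cs s) :
    ∀ e : AExpr, e.wf = true → e.compile.eval w cs = e.val E s
  | lit c, h => by
    simp only [wf, decide_eq_true_eq] at h
    have : 13 ≤ 2 ^ w := calc
      13 ≤ (E.X + 1) := by have := hl.hX; omega
      _ ≤ (E.X + 1) ^ 20 := Nat.le_self_pow (by omega) _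
      _ ≤ 2 ^ w := hl.hw
    exact Nat.mod_eq_of_lt (by omega)
  | reg r, h => hs.reg r (by simpa [wf] using h)
  | get α x y z, h => by
    simp only [wf, Bool.and_eq_true, decide_eq_true_eq] at h
    obtain ⟨⟨⟨⟨⟨⟨hα, wx⟩, wy⟩, wz⟩, sx⟩, sy⟩, sz⟩ := h
    have hx := val_le_of_simple hl.hX hs x sx
    have hy := val_le_of_simple hl.hX hs y sy
    have hz := val_le_of_simple hl.hX hs z sz
    simp only [compile, Expr.eval]
    rw [eval_address hl hs hα hx hy hz (eval_compile hl hs x wx) (eval_compile hl hs y wy)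
      (eval_compile hl hs z wz), hs.arr α hα _ hx _ hy _ hz, val_get]
  | inp e, h => by
    simp only [wf, Bool.and_eq_true, decide_eq_true_eq] at h
    simp only [compile, Expr.eval, eval_compile hl hs e h.1, val_inp]
    have hX := hl.hX
    refine hs.inp _ (lt_of_le_of_lt (val_le_pow hl.hX hs e) ?_)
    calc E.X ^ e.deg ≤ E.X ^ 6 := Nat.pow_le_pow_right (by omega) h.2
      _ ≤ (E.X + 1) ^ 6 := Nat.pow_le_pow_left (by omega) _
      _ < _ := Nat.pow_lt_pow_right (by omega) (by omega)
  | bin o e f, h => by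
    simp only [wf, Bool.and_eq_true, decide_eq_true_eq] at h
    have hv := (val_le_pow hl.hX hs (bin o e f)).trans_lt (pow_le_of_layout hl h.2)
    simp only [compile, Expr.eval, eval_compile hl hs e h.1.1, eval_compile hl hs f h.1.2]
    cases o with
    | add => exact Nat.mod_eq_of_lt hv
    | mul => exact Nat.mod_eq_of_lt hv
    | _ => rfl

theorem AExpr.val_le (hl : Layout E w) (hs : Sim E cs s) {e : AExpr}
    (h : e.simple = true ∨ e.val E s ≤ E.X) : e.val E s ≤ E.X :=
  h.elim (val_le_of_simple hl.hX hs e) id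

theorem Sim.tick (hs : Sim E cs s) : Sim E cs s.tick := ⟨hs.1, hs.2, hs.3, hs.4, hs.5, hs.6, hs.7, hs.8⟩

/-- Between two consecutive loop iterations every node of the program is executed at most once,
which costs at most `p.size`. Hence the running time is bounded by the number of iterations, up to a
factor that depends on the program only. -/
theorem ARuns.simulate (hl : Layout E w) {p : AProg} {s s' : AState} (h : ARuns E p s s') :
    p.wf = true → ∀ cs, Sim E cs s → ∃ t cs', Runs w p.compile cs t cs' ∧ Sim E cs' s' ∧
      s.tk ≤ s'.tk ∧ t ≤ p.size * (1 + (s'.tk - s.tk)) := by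
  induction h with
  | skip s => exact fun _ cs hs => ⟨1, cs, .skip _, hs, le_rfl, by simp [AProg.size]⟩
  | assign s r e he =>
    intro hp cs hs
    simp only [AProg.wf, Bool.and_eq_true, decide_eq_true_eq] at hp
    have hle := AExpr.val_le hl hs he
    refine ⟨_, _, .assign _ _ _, ?_, le_rfl, by simp [AProg.size]⟩
    rw [AExpr.eval_compile hl hs e hp.2]
    exact { reg := fun x hx => by
              simp only [Function.update_apply, AState.setReg_r, hs.reg x hx]
            regY := by simp [hs.regY, show ¬ 63 = r by omega]
            regO := by simp [hs.regO, show ¬ 62 = r by omega]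
            arr := hs.arr
            inp := hs.inp
            r_le := fun x => by
              rw [AState.setReg_r]; split
              exacts [hle, hs.r_le x]
            a_le := hs.a_le
            inp_le := hs.inp_le }
  | store s α x y z e he =>
    intro hp cs hs
    simp only [AProg.wf, Bool.and_eq_true, decide_eq_true_eq] at hp
    obtain ⟨⟨⟨⟨⟨⟨⟨hα, wx⟩, wy⟩, wz⟩, sx⟩, sy⟩, sz⟩, we⟩ := hp
    have hle := AExpr.val_le hl hs he
    have hx := AExpr.val_le_of_simple hl.hX hs x sx
    have hy := AExpr.val_le_of_simple hl.hX hs y sy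
    have hz := AExpr.val_le_of_simple hl.hX hs z sz
    refine ⟨_, _, .store _ _ _, ?_, le_rfl, by simp [AProg.size]⟩
    rw [AExpr.eval_compile hl hs e we, AExpr.eval_address hl hs hα hx hy hz
      (AExpr.eval_compile hl hs x wx) (AExpr.eval_compile hl hs y wy)
      (AExpr.eval_compile hl hs z wz)]
    exact { reg := hs.reg
            regY := hs.regY
            regO := hs.regO
            arr := fun β hβ x' hx' y' hy' z' hz' => by
              simp only [Function.update_apply, AState.put_a]
              have := hs.arr β hβ x' hx' y' hy' z' hz'
              split
              · rename_i h
                rw [if_pos (cell_inj hβ hα (by omega) (by omega) (by omega) (by omega) h)]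
              · rename_i h
                rw [if_neg, this]
                rintro ⟨rfl, rfl, rfl, rfl⟩
                exact h rfl
            inp := fun a ha => by
              refine (Function.update_of_ne ?_ _ _).trans (hs.inp a ha)
              rintro rfl
              exact absurd (le_cell (by omega)) ha.not_ge
            r_le := hs.r_le
            a_le := fun β x' y' z' => by
              rw [AState.put_a]; split
              exacts [hle, hs.a_le _ _ _ _]
            inp_le := hs.inp_le }
  | @seq p q _ _ _ _ _ ih1 ih2 =>
    intro hp cs hs
    simp only [AProg.wf, Bool.and_eq_true] at hp
    obtain ⟨t, cs', h1, h2, h3, h4⟩ := ih1 hp.1 cs hs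
    obtain ⟨t', cs'', h1', h2', h3', h4'⟩ := ih2 hp.2 cs' h2
    refine ⟨_, _, .seq h1 h1', h2', by omega, ?_⟩
    simp only [AProg.size]
    calc _ ≤ _ := Nat.add_le_add h4 h4'
      _ ≤ _ := Nat.add_le_add (Nat.mul_le_mul_left p.size (by omega))
        (Nat.mul_le_mul_left q.size (by omega))
      _ = _ := (add_mul _ _ _).symm
  | @branch_true e p q s s' he _ ih =>
    intro hp cs hs
    simp only [AProg.wf, Bool.and_eq_true] at hp
    obtain ⟨t, cs', h1, h2, h3, h4⟩ := ih hp.1.2 cs hs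
    refine ⟨_, _, .branch_true (by rwa [AExpr.eval_compile hl hs e hp.1.1]) h1, h2, h3, ?_⟩
    simp only [AProg.size]
    nlinarith [Nat.zero_le (q.size * (1 + (s'.tk - s.tk))),
      Nat.zero_le (e.compile.cost * (s'.tk - s.tk))]
  | @branch_false e p q s s' he _ ih =>
    intro hp cs hs
    simp only [AProg.wf, Bool.and_eq_true] at hp
    obtain ⟨t, cs', h1, h2, h3, h4⟩ := ih hp.2 cs hs
    refine ⟨_, _, .branch_false (by rwa [AExpr.eval_compile hl hs e hp.1.1]) h1, h2, h3, ?_⟩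
    simp only [AProg.size]
    nlinarith [Nat.zero_le (p.size * (1 + (s'.tk - s.tk))),
      Nat.zero_le (e.compile.cost * (s'.tk - s.tk))]
  | loop_done he =>
    intro hp cs hs
    simp only [AProg.wf, Bool.and_eq_true] at hp
    exact ⟨_, _, Runs.loop_stop (by rwa [AExpr.eval_compile hl hs _ hp.1]), hs, le_rfl,
      by simp [AProg.size]⟩
  | @loop_step e p s s' s'' he _ _ ih1 ih2 =>
    intro hp cs hs
    have hp' := hp
    simp only [AProg.wf, Bool.and_eq_true] at hp
    obtain ⟨t, cs', h1, h2, h3, h4⟩ := ih1 hp.2 cs hs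
    obtain ⟨t', cs'', h1', h2', h3', h4'⟩ := ih2 hp' cs' h2.tick
    simp only [AState.tick_tk] at h3' h4'
    refine ⟨_, _, .loop_step (by rwa [AExpr.eval_compile hl hs e hp.1]) h1 h1', h2', by omega, ?_⟩
    simp only [AProg.size] at h4' ⊢
    obtain ⟨a, ha⟩ := Nat.exists_eq_add_of_le h3
    obtain ⟨b, hb⟩ := Nat.exists_eq_add_of_le h3'
    rw [show s'.tk - s.tk = a by omega] at h4
    rw [show s''.tk - (s'.tk + 1) = b by omega] at h4'
    rw [show s''.tk - s.tk = a + 1 + b by omega]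
    nlinarith [Nat.zero_le (e.compile.cost * a)]

/-! ### Total correctness rules -/

/-- `p` started in `s` halts in a state that satisfies `Q`. -/
def Total (E : Env) (p : AProg) (s : AState) (Q : AState → Prop) : Prop :=
  ∃ s', ARuns E p s s' ∧ Q s'

/-- `s` and `s'` agree on everything that `p` does not write. -/
structure Frame (p : AProg) (s s' : AState) : Prop where
  reg : ∀ r, p.writesReg r = false → s'.r r = s.r r
  arr : ∀ α, p.writesArr α = false → s'.a α = s.a α

section
variable {E : Env} {p q : AProg} {s s' s'' : AState} {Q R : AState → Prop}

theorem ARuns.frame (h : ARuns E p s s') : Frame p s s' := by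
  induction h with
  | skip s => exact ⟨fun _ _ => rfl, fun _ _ => rfl⟩
  | assign s r e _ =>
    refine ⟨fun x hx => ?_, fun _ _ => rfl⟩
    simp only [AProg.writesReg, decide_eq_false_iff_not] at hx
    simp [hx]
  | store s α x y z e _ =>
    refine ⟨fun _ _ => rfl, fun β hβ => ?_⟩
    simp only [AProg.writesArr, decide_eq_false_iff_not] at hβ
    funext x y z
    simp [hβ]
  | seq _ _ ih1 ih2 =>
    refine ⟨fun x hx => ?_, fun x hx => ?_⟩
    · simp only [AProg.writesReg, Bool.or_eq_false_iff] at hx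
      rw [ih2.reg x hx.2, ih1.reg x hx.1]
    · simp only [AProg.writesArr, Bool.or_eq_false_iff] at hx
      rw [ih2.arr x hx.2, ih1.arr x hx.1]
  | branch_true _ _ ih =>
    refine ⟨fun x hx => ?_, fun x hx => ?_⟩
    · simp only [AProg.writesReg, Bool.or_eq_false_iff] at hx
      exact ih.reg x hx.1
    · simp only [AProg.writesArr, Bool.or_eq_false_iff] at hx
      exact ih.arr x hx.1
  | branch_false _ _ ih =>
    refine ⟨fun x hx => ?_, fun x hx => ?_⟩
    · simp only [AProg.writesReg, Bool.or_eq_false_iff] at hx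
      exact ih.reg x hx.2
    · simp only [AProg.writesArr, Bool.or_eq_false_iff] at hx
      exact ih.arr x hx.2
  | loop_done _ => exact ⟨fun _ _ => rfl, fun _ _ => rfl⟩
  | loop_step _ _ _ ih1 ih2 =>
    refine ⟨fun x hx => ?_, fun x hx => ?_⟩
    · rw [ih2.reg x hx, AState.tick_r, ih1.reg x hx]
    · rw [ih2.arr x hx, AState.tick_a, ih1.arr x hx]

theorem Frame.refl (p : AProg) (s : AState) : Frame p s s := ⟨fun _ _ => rfl, fun _ _ => rfl⟩

theorem Frame.trans (h : Frame p s s') (h' : Frame p s' s'') : Frame p s s'' :=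
  ⟨fun r hr => (h'.reg r hr).trans (h.reg r hr), fun α hα => (h'.arr α hα).trans (h.arr α hα)⟩

theorem Total.mono (h : Total E p s Q) (hQ : ∀ s', Q s' → R s') : Total E p s R :=
  let ⟨s', h1, h2⟩ := h; ⟨s', h1, hQ s' h2⟩

theorem Total.frame (h : Total E p s Q) : Total E p s (fun s' => Frame p s s' ∧ Q s') :=
  let ⟨s', h1, h2⟩ := h; ⟨s', h1, h1.frame, h2⟩

/-- Use a specification together with the frame. -/
theorem Total.use (h : Total E p s Q) (hQ : ∀ s', Frame p s s' → Q s' → R s') : Total E p s R :=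
  h.frame.mono fun s' h => hQ s' h.1 h.2

@[simp] theorem total_skip : Total E .skip s Q ↔ Q s :=
  ⟨fun ⟨_, h, hQ⟩ => by cases h; exact hQ, fun h => ⟨s, .skip s, h⟩⟩

@[simp] theorem total_assign {r : ℕ} {e : AExpr} : Total E (.assign r e) s Q ↔
    (e.simple = true ∨ e.val E s ≤ E.X) ∧ Q (s.setReg r (e.val E s)) :=
  ⟨fun ⟨_, h, hQ⟩ => by cases h with | assign _ _ _ h => exact ⟨h, hQ⟩,
    fun h => ⟨_, .assign s r e h.1, h.2⟩⟩

@[simp] theorem total_store {α : ℕ} {x y z e : AExpr} : Total E (.store α x y z e) s Q ↔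
    (e.simple = true ∨ e.val E s ≤ E.X) ∧
      Q (s.put α (x.val E s) (y.val E s) (z.val E s) (e.val E s)) :=
  ⟨fun ⟨_, h, hQ⟩ => by cases h with | store _ _ _ _ _ _ h => exact ⟨h, hQ⟩,
    fun h => ⟨_, .store s α x y z e h.1, h.2⟩⟩

@[simp] theorem total_seq : Total E (.seq p q) s Q ↔ Total E p s (fun s' => Total E q s' Q) :=
  ⟨fun ⟨s'', h, hQ⟩ => by cases h with | seq h1 h2 => exact ⟨_, h1, _, h2, hQ⟩,
    fun ⟨_, h1, _, h2, h3⟩ => ⟨_, .seq h1 h2, h3⟩⟩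

@[simp] theorem total_branch {e : AExpr} : Total E (.branch e p q) s Q ↔
    (e.val E s ≠ 0 → Total E p s Q) ∧ (e.val E s = 0 → Total E q s Q) := by
  constructor
  · rintro ⟨s', h, hQ⟩
    cases h with
    | branch_true h1 h2 => exact ⟨fun _ => ⟨_, h2, hQ⟩, fun h => absurd h h1⟩
    | branch_false h1 h2 => exact ⟨fun h => absurd h1 h, fun _ => ⟨_, h2, hQ⟩⟩
  · rintro ⟨h1, h2⟩
    by_cases h : e.val E s = 0
    · obtain ⟨s', h3, h4⟩ := h2 h
      exact ⟨s', .branch_false h h3, h4⟩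
    · obtain ⟨s', h3, h4⟩ := h1 h
      exact ⟨s', .branch_true h h3, h4⟩

theorem total_loop {e : AExpr} (I : AState → Prop) (μ : AState → ℕ) (h0 : I s)
    (hstep : ∀ s', Frame p s s' → I s' → e.val E s' ≠ 0 →
      Total E p s' (fun s'' => I s''.tick ∧ μ s''.tick < μ s'))
    (hQ : ∀ s', Frame p s s' → I s' → e.val E s' = 0 → Q s') : Total E (.loop e p) s Q := by
  suffices H : ∀ m s', μ s' = m → Frame p s s' → I s' → Total E (.loop e p) s' Q from
    H _ s rfl (.refl _ _) h0
  intro m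
  induction m using Nat.strong_induction_on with
  | _ m ih =>
    intro s' hm hF hI
    by_cases he : e.val E s' = 0
    · exact ⟨s', .loop_done he, hQ s' hF hI he⟩
    · obtain ⟨s1, h1, h2, h3⟩ := hstep s' hF hI he
      have hF1 : Frame p s' s1.tick := ⟨h1.frame.1, h1.frame.2⟩
      obtain ⟨s2, h4, h5⟩ := ih _ (hm ▸ h3) s1.tick rfl (hF.trans hF1) h2
      exact ⟨s2, .loop_step he h1 h4, h5⟩

@[simp] theorem simple_zero : AExpr.simple 0 = true := rfl
@[simp] theorem simple_one : AExpr.simple 1 = true := rfl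
@[simp] theorem simple_reg (r : ℕ) : (AExpr.reg r).simple = true := rfl
@[simp] theorem simple_get (α : ℕ) (x y z : AExpr) : (AExpr.get α x y z).simple = true := rfl
@[simp] theorem simple_inp (e : AExpr) : (AExpr.inp e).simple = true := rfl
@[simp] theorem simple_add (e f : AExpr) : (e + f).simple = false := rfl
@[simp] theorem simple_mul (e f : AExpr) : (e * f).simple = false := rfl
@[simp] theorem simple_sub (e f : AExpr) : (e - f).simple = e.simple := rfl
@[simp] theorem simple_lt (e f : AExpr) : (AExpr.bin .lt e f).simple = true := rfl
@[simp] theorem simple_eq (e f : AExpr) : (AExpr.bin .eq e f).simple = true := rfl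

/-- Register `r` runs from the value of `lo` up to, but not including, the value of register
`h`. -/
def AProg.forUp (r : ℕ) (lo : AExpr) (h : ℕ) (p : AProg) : AProg :=
  .seq (.assign r lo) (.loop (.bin .lt (.reg r) (.reg h)) (.seq p (.assign r (.reg r + 1))))

/-- The invariant `I i` refers to the state in which the counter already equals `i`; this is why the
body has to establish it after the counter update and the tick. Each round costs its own `c i` and
one iteration. -/
theorem total_for {r h : ℕ} {lo : AExpr} (L N : ℕ) (c : ℕ → ℕ) (I : ℕ → AState → Prop)
    (hlo : lo.simple = true) (hL : lo.val E s = L) (hN : s.r h = N) (hNX : N ≤ E.X) (hLN : L ≤ N)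
    (hr : p.writesReg r = false) (hh : p.writesReg h = false) (hrh : h ≠ r)
    (h0 : I L (s.setReg r L))
    (hstep : ∀ i s', L ≤ i → i < N → s'.r r = i → Frame (.forUp r lo h p) s s' → I i s' →
      Total E p s' (fun s'' => I (i + 1) (s''.setReg r (i + 1)).tick ∧ s''.tk ≤ s'.tk + c i))
    (hQ : ∀ s', Frame (.forUp r lo h p) s s' → s'.r r = N → I N s' →
      s'.tk ≤ s.tk + ∑ i ∈ Finset.Ico L N, (c i + 1) → Q s') :
    Total E (.forUp r lo h p) s Q := by
  have hwr : AProg.writesReg (.forUp r lo h p) = fun x => (decide (x = r)) || (p.writesReg x || decide (x = r)) := rfl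
  have hwa : AProg.writesArr (.forUp r lo h p) = fun x => false || (p.writesArr x || false) := rfl
  have hFset : ∀ s' v, Frame (.forUp r lo h p) s s' → Frame (.forUp r lo h p) s (s'.setReg r v) := by
    intro s' v hF
    refine ⟨fun x hx => ?_, hF.arr⟩
    rw [← hF.reg x hx, AState.setReg_r, if_neg]
    simp [hwr] at hx
    exact hx.1
  rw [AProg.forUp, total_seq, total_assign, hL]
  refine ⟨.inl hlo, ?_⟩
  have hF0 : Frame (.forUp r lo h p) s (s.setReg r L) := hFset s L (.refl _ _)
  refine total_loop (fun s' => Frame (.forUp r lo h p) s s' ∧ ∃ i, L ≤ i ∧ i ≤ N ∧ s'.r r = i ∧ I i s' ∧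
    s'.tk ≤ s.tk + ∑ i ∈ Finset.Ico L i, (c i + 1)) (fun s' => N - s'.r r)
    ⟨hF0, L, le_rfl, hLN, by simp, h0, by simp⟩ ?_ ?_
  · rintro s' - ⟨hF, i, hLi, hiN, hri, hI, ht⟩ he
    have hsh : s'.r h = N := by
      rw [← hN]; exact hF.reg h (by simp [hwr, hh, hrh])
    have hlt : i < N := by
      by_contra hc
      simp [hri, hsh, hc] at he
    rw [total_seq]
    refine (hstep i s' hLi hlt hri hF hI).use fun s1 hF1 ⟨h1, h2⟩ => ?_
    have h3 : s1.r r = i := (hF1.reg r hr).trans hri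
    rw [total_assign]
    simp only [AExpr.val_add, AExpr.val_reg, AExpr.val_one, h3]
    refine ⟨.inr (by omega), ⟨?_, i + 1, by omega, hlt, by simp, h1, ?_⟩, ?_⟩
    · have hF2 : Frame (.forUp r lo h p) s s1 := by
        refine ⟨fun x hx => ?_, fun x hx => ?_⟩
        · rw [hF1.reg x (by simp [hwr] at hx; exact hx.2.1), hF.reg x hx]
        · rw [hF1.arr x (by simpa [hwa] using hx), hF.arr x hx]
      exact ⟨(hFset s1 (i + 1) hF2).reg, (hFset s1 (i + 1) hF2).arr⟩
    · rw [Finset.sum_Ico_succ_top hLi]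
      simp only [AState.tick_tk, AState.setReg_tk]
      omega
    · simp only [AState.tick_r, AState.setReg_r, if_true, hri]
      omega
  · rintro s' - ⟨hF, i, hLi, hiN, hri, hI, ht⟩ he
    have hsh : s'.r h = N := by
      rw [← hN]; exact hF.reg h (by simp [hwr, hh, hrh])
    have : i = N := by
      by_contra hc
      have : i < N := by omega
      simp [hri, hsh, this] at he
    subst this
    exact hQ s' hF hri hI ht

end

/-- Sequential composition. -/
infixr:30 " ;; " => AProg.seq

/-! ### Indeterminate strings indexed by natural numbers -/

/-- An indeterminate string given by codes: `u < σ` stands for the solid symbol `u`, and `σ + j`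
for the `j`-th non-solid symbol, which is at position `pos j`. -/
structure Coded where
  n : ℕ
  k : ℕ
  σ : ℕ
  code : ℕ → ℕ
  pos : ℕ → ℕ
  sets : ℕ → Finset ℕ
  two_le : 2 ≤ σ
  σ_le : σ ≤ n
  k_le : k ≤ n
  code_lt : ∀ i < n, code i < σ + k
  pos_lt : ∀ j < k, pos j < n
  code_pos : ∀ j < k, code (pos j) = σ + j
  pos_code : ∀ i < n, σ ≤ code i → pos (code i - σ) = i
  sets_solid : ∀ u < σ, sets u = {u}
  sets_sub : ∀ u < σ + k, sets u ⊆ Finset.range σ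
  sets_card : ∀ j < k, 2 ≤ (sets (σ + j)).card

namespace Coded

variable (G : Coded)

/-- The empty set past the end makes every match stop there, so that range conditions follow from
nonempty intersections. -/
def S (i : ℕ) : Finset ℕ := if i < G.n then G.sets (G.code i) else ∅

/-- `(m, i)` denotes a `⊙`-prefix that is a cover. -/
def Good (m i : ℕ) : Prop :=
  i + m ≤ G.n ∧ (∀ t < m, (G.S t ∩ G.S (i + t)).card = 1) ∧
    ∀ x < G.n, ∃ j ≤ x, x < j + m ∧ j + m ≤ G.n ∧
      ∀ t < m, (G.S t ∩ G.S (i + t) ∩ G.S (j + t)).Nonempty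

def Answer (m i : ℕ) : Prop :=
  (G.Good m i ∧ ∀ m' i', G.Good m' i' → m ≤ m') ∨ (m = 0 ∧ ∀ m' i', ¬ G.Good m' i')

end Coded

/-! ### Translation of indeterminate strings into coded strings. -/

namespace IString

variable {σ n : ℕ} (T : IString (Fin σ) n)

theorem mem_nonSolidPositions {i : Fin n} : i ∈ T.nonSolidPositions ↔ ¬ T.SolidAt i := by
  simp [nonSolidPositions]

theorem nodup_nonSolidPositions : T.nonSolidPositions.Nodup :=
  (List.nodup_finRange n).filter _

theorem numNonSolid_le : T.numNonSolid ≤ n := by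
  exact (List.length_filter_le _ _).trans (by simp)

/-- The set that a code stands for. -/
def codeSet (u : ℕ) : Finset ℕ :=
  if u < σ then {u} else
    if h : u - σ < T.nonSolidPositions.length then (T.sym T.nonSolidPositions[u - σ]).map Fin.valEmbedding
    else ∅

theorem code_of_not_solid {i : Fin n} (h : ¬ T.SolidAt i) :
    T.code i = σ + T.nonSolidPositions.idxOf i ∧
      T.nonSolidPositions.idxOf i < T.nonSolidPositions.length :=
  ⟨if_neg h, List.idxOf_lt_length_iff.2 (T.mem_nonSolidPositions.2 h)⟩

theorem code_of_solid {i : Fin n} (h : T.SolidAt i) :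
    T.code i < σ ∧ (T.sym i).map Fin.valEmbedding = {T.code i} := by
  rw [code, if_pos h]
  refine ⟨Fin.is_lt _, ?_⟩
  obtain ⟨a, ha⟩ := Finset.card_eq_one.1 h
  simp [ha]

theorem codeSet_code (i : Fin n) : T.codeSet (T.code i) = (T.sym i).map Fin.valEmbedding := by
  by_cases h : T.SolidAt i
  · obtain ⟨h1, h2⟩ := T.code_of_solid h
    rw [codeSet, if_pos h1, h2]
  · obtain ⟨h1, h2⟩ := T.code_of_not_solid h
    rw [codeSet, h1, if_neg (by omega), Nat.add_sub_cancel_left, dif_pos h2, List.getElem_idxOf]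

theorem not_solid_getElem {j : ℕ} (h : j < T.nonSolidPositions.length) :
    ¬ T.SolidAt T.nonSolidPositions[j] :=
  T.mem_nonSolidPositions.1 (List.getElem_mem _)

/-- The string as a coded string. -/
def coded (h2 : 2 ≤ σ) (hσ : σ ≤ n) : Coded where
  n := n
  k := T.nonSolidPositions.length
  σ := σ
  code i := if h : i < n then T.code ⟨i, h⟩ else 0
  pos j := if h : j < T.nonSolidPositions.length then T.nonSolidPositions[j] else 0
  sets := T.codeSet
  two_le := h2
  σ_le := hσ
  k_le := T.numNonSolid_le
  code_lt i hi := by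
    rw [dif_pos hi]
    by_cases h : T.SolidAt ⟨i, hi⟩
    · have := (T.code_of_solid h).1
      omega
    · have := T.code_of_not_solid h
      omega
  pos_lt j hj := by rw [dif_pos hj]; exact Fin.is_lt _
  code_pos j hj := by
    rw [dif_pos hj, dif_pos (Fin.is_lt _), Fin.eta, (T.code_of_not_solid (T.not_solid_getElem hj)).1,
      T.nodup_nonSolidPositions.idxOf_getElem]
  pos_code i hi hc := by
    rw [dif_pos hi] at hc ⊢
    have h : ¬ T.SolidAt ⟨i, hi⟩ := fun h => absurd (T.code_of_solid h).1 (by omega)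
    obtain ⟨h1, h2⟩ := T.code_of_not_solid h
    rw [h1, Nat.add_sub_cancel_left, dif_pos h2, List.getElem_idxOf]
  sets_solid u hu := if_pos hu
  sets_sub u hu := by
    intro x hx
    rw [codeSet] at hx
    split at hx
    · rw [Finset.mem_singleton] at hx
      subst hx
      simpa
    · rw [dif_pos (by omega)] at hx
      simp only [Finset.mem_map, Fin.valEmbedding_apply] at hx
      obtain ⟨a, -, rfl⟩ := hx
      simp
  sets_card j hj := by
    rw [codeSet, if_neg (by omega), dif_pos (by omega), Finset.card_map]
    simp only [Nat.add_sub_cancel_left]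
    have h1 := T.not_solid_getElem hj
    have h2 := Finset.card_pos.2 (T.nonempty T.nonSolidPositions[j])
    unfold SolidAt at h1
    omega

variable {T} {h2 : 2 ≤ σ} {hσ : σ ≤ n}

theorem coded_S {i : ℕ} (hi : i < n) :
    (T.coded h2 hσ).S i = (T.sym ⟨i, hi⟩).map Fin.valEmbedding := by
  have : (T.coded h2 hσ).S i = T.codeSet (T.code ⟨i, hi⟩) := by
    simp only [Coded.S, coded, dif_pos hi, if_pos hi]
  rw [this, codeSet_code]

theorem exists_good {m : ℕ} {S : IString (Fin σ) m} (h : S.IsOdotPrefix T) (hc : S.IsCover T) :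
    ∃ i, (T.coded h2 hσ).Good m i := by
  obtain ⟨hs, hm, i, ho, rfl⟩ := h
  have hin := ho.1
  refine ⟨i, hin, fun t ht => ?_, fun x hx => ?_⟩
  · rw [coded_S (by omega), coded_S (by omega), ← Finset.map_inter, Finset.card_map]
    have := hs ⟨t, ht⟩
    simpa [SolidAt, odot, pre, factor] using this
  · obtain ⟨j, ⟨h1, h3⟩, h4, h5⟩ := hc.2 ⟨x, hx⟩
    refine ⟨j, h4, h5, h1, fun t ht => ?_⟩
    rw [coded_S (by omega), coded_S (by omega), coded_S (by omega), ← Finset.map_inter,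
      ← Finset.map_inter, Finset.map_nonempty]
    simpa [odot, pre, factor] using h3 ⟨t, ht⟩

theorem isAnswer_of_answer {m i : ℕ} (h : (T.coded h2 hσ).Answer m i) : T.IsAnswer m i := by
  rcases h with ⟨⟨h1, h3, h4⟩, h5⟩ | ⟨rfl, h⟩
  · left
    replace h1 : i + m ≤ n := h1
    have hm : m ≤ n := by omega
    have hcard : ∀ t (ht : t < m), (T.sym ⟨t, by omega⟩ ∩ T.sym ⟨i + t, by omega⟩).card = 1 := by
      intro t ht
      have := h3 t ht
      rwa [coded_S (by omega), coded_S (by omega), ← Finset.map_inter, Finset.card_map] at this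
    have ho : (T.pre m hm).OccursAt T i := by
      refine ⟨h1, fun t => Finset.card_pos.1 ?_⟩
      have := hcard t t.2
      simp only [pre, factor, zero_add]
      omega
    have hs : ((T.pre m hm).odot T i ho).IsSolid := fun t => by
      simpa [SolidAt, odot, pre, factor] using hcard t t.2
    refine ⟨hm, ho, ⟨hs, hm, i, ho, rfl⟩, ⟨hs, fun x => ?_⟩, fun m' S hS hc => ?_⟩
    · obtain ⟨j, hj, hx, hjm, hne⟩ := h4 x x.2
      refine ⟨j, ⟨hjm, fun t => ?_⟩, hj, hx⟩
      replace hjm : j + m ≤ n := hjm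
      have := hne t t.2
      rw [coded_S (by omega), coded_S (by omega), coded_S (by omega), ← Finset.map_inter,
        ← Finset.map_inter, Finset.map_nonempty] at this
      simpa [odot, pre, factor] using this
    · obtain ⟨i', hi'⟩ := exists_good (h2 := h2) (hσ := hσ) hS hc
      exact h5 _ _ hi'
  · refine .inr ⟨rfl, fun m' S hS hc => ?_⟩
    obtain ⟨i', hi'⟩ := exists_good (h2 := h2) (hσ := hσ) hS hc
    exact h _ _ hi'

/-! ### The input in memory -/

theorem length_bits (l : List (Fin n)) : (l.flatMap (fun i => List.ofFn fun c : Fin σ =>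
    if c ∈ T.sym i then 1 else 0)).length = l.length * σ := by
  induction l with
  | nil => simp
  | cons a l ih => simp [ih, add_mul, add_comm]

theorem getD_bits (l : List (Fin n)) {j c : ℕ} (hj : j < l.length) (hc : c < σ) :
    (l.flatMap (fun i => List.ofFn fun c : Fin σ => if c ∈ T.sym i then 1 else 0)).getD
      (j * σ + c) 0 = if ⟨c, hc⟩ ∈ T.sym l[j] then 1 else 0 := by
  induction l generalizing j with
  | nil => simp at hj
  | cons a l ih =>
    rw [List.flatMap_cons]
    cases j with
    | zero =>
      rw [List.getD_append _ _ _ _ (by simpa using hc)]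
      simp [List.getD, hc]
    | succ j =>
      rw [List.getD_append_right _ _ _ _ (by simp [add_mul]; omega)]
      rw [show (j + 1) * σ + c - (List.ofFn fun c : Fin σ =>
        if c ∈ T.sym a then 1 else 0).length = j * σ + c by simp [add_mul]; omega]
      rw [ih (by simpa using hj)]
      simp

theorem getD_input_head : T.input.getD 0 0 = n ∧ T.input.getD 1 0 = T.numNonSolid ∧
    T.input.getD 2 0 = σ := by
  simp [input]

theorem getD_input_code {i : ℕ} (hi : i < n) : T.input.getD (3 + i) 0 = T.code ⟨i, hi⟩ := by
  rw [input, List.append_assoc, List.getD_append_right _ _ _ _ (by simp),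
    List.getD_append _ _ _ _ (by simpa using hi)]
  simp [List.getD, hi]

theorem getD_input_bits {j c : ℕ} (hj : j < T.nonSolidPositions.length) (hc : c < σ) :
    T.input.getD (3 + n + (j * σ + c)) 0 =
      if c ∈ (T.coded h2 hσ).sets (σ + j) then 1 else 0 := by
  rw [input, List.getD_append_right _ _ _ _ (by simp; omega),
    show 3 + n + (j * σ + c) - ([n, T.numNonSolid, σ] ++ List.ofFn T.code).length = j * σ + c by
      simp; omega, getD_bits _ hj hc]
  congr 1
  simp only [coded, codeSet, if_neg (show ¬ σ + j < σ by omega), Nat.add_sub_cancel_left, dif_pos hj]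
  simp only [Finset.mem_map, Fin.valEmbedding_apply, eq_iff_iff]
  exact ⟨fun h => ⟨_, h, rfl⟩, fun ⟨a, h, e⟩ => by subst e; exact h⟩

theorem length_input : T.input.length = 3 + n + T.numNonSolid * σ := by
  simp only [input, List.length_append, length_bits, List.length_ofFn, List.length_cons,
    List.length_nil]
  rfl

theorem getD_input_le (h2 : 2 ≤ σ) (hσ : σ ≤ n) (a : ℕ) : T.input.getD a 0 ≤ 2 * n := by
  have hk := T.numNonSolid_le
  by_cases ha : a < T.input.length
  · rw [List.getD_eq_getElem _ _ ha]
    have := List.getElem_mem ha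
    generalize T.input[a] = v at this
    simp only [input, List.mem_append, List.mem_flatMap, List.mem_ofFn] at this
    rcases this with (h | ⟨i, rfl⟩) | ⟨i, -, c, rfl⟩
    · simp at h
      omega
    · have := (T.coded h2 hσ).code_lt i i.2
      simp only [coded, dif_pos i.2, Fin.eta] at this
      change _ < σ + T.numNonSolid at this
      omega
    · split <;> omega
  · rw [List.getD_eq_default _ _ (by omega)]
    omega

end IString

/-! ### Linked lists with maximal gaps -/

/-- `prv` and `nxt` link the elements of `A ⊆ {0, …, n}`, and `M` is at least every gap of `A` and
is attained by an interval whose interior avoids `A`. -/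
structure Linked (n : ℕ) (A : ℕ → Prop) (prv nxt : ℕ → ℕ) (M : ℕ) : Prop where
  nxt_spec : ∀ j < n, A j → j < nxt j ∧ nxt j ≤ n ∧ A (nxt j) ∧ ∀ x, j < x → x < nxt j → ¬ A x
  prv_spec : ∀ j ≤ n, 0 < j → A j → prv j < j ∧ A (prv j) ∧ ∀ x, prv j < x → x < j → ¬ A x
  gap : ∀ x y, x < y → y ≤ n → A x → A y → (∀ z, x < z → z < y → ¬ A z) → y - x ≤ M
  attained : ∃ x y, x ≤ y ∧ y ≤ n ∧ M = y - x ∧ ∀ z, x < z → z < y → ¬ A z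

/-- The list of the elements of `A` below `b`, with last element `l`. -/
structure Linking (n : ℕ) (A : ℕ → Prop) (prv nxt : ℕ → ℕ) (M l b : ℕ) : Prop where
  last_lt : l < b
  last : A l
  last_max : ∀ x, l < x → x < b → ¬ A x
  nxt_spec : ∀ j < l, A j → j < nxt j ∧ nxt j ≤ l ∧ A (nxt j) ∧ ∀ x, j < x → x < nxt j → ¬ A x
  prv_spec : ∀ j < b, 0 < j → A j → prv j < j ∧ A (prv j) ∧ ∀ x, prv j < x → x < j → ¬ A x
  gap : ∀ x y, x < y → y < b → A x → A y → (∀ z, x < z → z < y → ¬ A z) → y - x ≤ M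
  attained : ∃ x y, x ≤ y ∧ y ≤ n ∧ M = y - x ∧ ∀ z, x < z → z < y → ¬ A z

section
variable {n : ℕ} {A A' : ℕ → Prop} {prv nxt prv' nxt' : ℕ → ℕ} {M M' l b : ℕ}

theorem Linked.congr (h : Linked n A prv nxt M) (hA : ∀ j, A j ↔ A' j) : Linked n A' prv nxt M := by
  obtain rfl : A = A' := funext fun j => propext (hA j)
  exact h

theorem Linking.start (h0 : A 0) : Linking n A prv nxt 0 0 1 where
  last_lt := by omega
  last := h0
  last_max x _ _ := by omega
  nxt_spec j _ := by omega
  prv_spec j _ _ := by omega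
  gap x y _ _ := by omega
  attained := ⟨0, 0, le_rfl, Nat.zero_le _, rfl, fun z _ _ => by omega⟩

theorem Linking.pass (h : Linking n A prv nxt M l b) (hb : ¬ A b) :
    Linking n A prv nxt M l (b + 1) where
  last_lt := by have := h.last_lt; omega
  last := h.last
  last_max x h1 h2 := by
    rcases Nat.lt_succ_iff_lt_or_eq.1 h2 with h3 | rfl
    exacts [h.last_max x h1 h3, hb]
  nxt_spec := h.nxt_spec
  prv_spec j h1 h2 h3 := by
    rcases Nat.lt_succ_iff_lt_or_eq.1 h1 with h4 | rfl
    exacts [h.prv_spec j h4 h2 h3, absurd h3 hb]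
  gap x y h1 h2 h3 h4 := by
    rcases Nat.lt_succ_iff_lt_or_eq.1 h2 with h5 | rfl
    exacts [h.gap x y h1 h5 h3 h4, absurd h4 hb]
  attained := h.attained

theorem Linking.append (h : Linking n A prv nxt M l b) (hb : A b) (hbn : b ≤ n)
    (hn : ∀ j, j ≠ l → nxt' j = nxt j) (hnl : nxt' l = b)
    (hp : ∀ j, j ≠ b → prv' j = prv j) (hpb : prv' b = l) (hM : M' = max M (b - l)) :
    Linking n A prv' nxt' M' b (b + 1) where
  last_lt := by omega
  last := hb
  last_max x _ _ := by omega
  nxt_spec j h1 h2 := by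
    by_cases hj : j = l
    · subst hj
      rw [hnl]
      exact ⟨h1, le_rfl, hb, h.last_max⟩
    · rw [hn j hj]
      have hjl : j < l := by
        by_contra hc
        exact h.last_max j (by omega) h1 h2
      obtain ⟨h3, h4, h5⟩ := h.nxt_spec j hjl h2
      exact ⟨h3, by have := h.last_lt; omega, h5⟩
  prv_spec j h1 h2 h3 := by
    by_cases hj : j = b
    · subst hj
      rw [hpb]
      exact ⟨h.last_lt, h.last, h.last_max⟩
    · rw [hp j hj]
      exact h.prv_spec j (by omega) h2 h3
  gap x y h1 h2 h3 h4 h5 := by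
    by_cases hy : y = b
    · subst hy
      have : l ≤ x := by
        by_contra hc
        exact h5 l (by omega) h.last_lt h.last
      omega
    · have := h.gap x y h1 (by omega) h3 h4 h5
      omega
  attained := by
    rcases le_total M (b - l) with h1 | h1
    · exact ⟨l, b, h.last_lt.le, hbn, by omega, h.last_max⟩
    · rw [hM, max_eq_left h1]
      exact h.attained

theorem Linking.linked (h : Linking n A prv nxt M n (n + 1)) : Linked n A prv nxt M where
  nxt_spec := h.nxt_spec
  prv_spec j hj := h.prv_spec j (by omega)
  gap x y h1 h2 := h.gap x y h1 (by omega)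
  attained := h.attained

/-- The only new gap is the union of the two gaps next to `d`. Gaps never shrink, so the running
maximum remains exact: an interval that attains `M` still has no element of the list in its
interior. That is why `attained` does not ask for its ends to be in the list. -/
theorem Linked.delete (h : Linked n A prv nxt M) {d : ℕ} (h0 : 0 < d) (hdn : d < n) (hd : A d)
    (hA : ∀ j, A' j ↔ A j ∧ j ≠ d)
    (hn : ∀ j, j ≠ prv d → nxt' j = nxt j) (hnl : nxt' (prv d) = nxt d)
    (hp : ∀ j, j ≠ nxt d → prv' j = prv j) (hpb : prv' (nxt d) = prv d)
    (hM : M' = max M (nxt d - prv d)) : Linked n A' prv' nxt' M' := by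
  obtain ⟨n1, n2, n3, n4⟩ := h.nxt_spec d hdn hd
  obtain ⟨p1, p2, p3⟩ := h.prv_spec d hdn.le h0 hd
  have hno : ∀ x, prv d < x → x < nxt d → ¬ A' x := by
    intro x h1 h2 h3
    rw [hA] at h3
    rcases lt_trichotomy x d with h4 | h4 | h4
    exacts [p3 x h1 h4 h3.1, h3.2 h4, n4 x h4 h2 h3.1]
  refine ⟨fun j hj hAj => ?_, fun j hj hj0 hAj => ?_, fun x y hxy hy hx hAy hbt => ?_, ?_⟩
  · rw [hA] at hAj
    by_cases hjp : j = prv d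
    · subst hjp
      rw [hnl]
      exact ⟨by omega, n2, (hA _).2 ⟨n3, by omega⟩, hno⟩
    · rw [hn j hjp]
      obtain ⟨h1, h2, h3, h4⟩ := h.nxt_spec j hj hAj.1
      refine ⟨h1, h2, (hA _).2 ⟨h3, fun h5 => ?_⟩, fun x hx hx' hAx => h4 x hx hx' ((hA x).1 hAx).1⟩
      rcases lt_or_gt_of_ne hjp with h6 | h6
      · exact h4 _ h6 (by omega) p2
      · exact p3 j h6 (by omega) hAj.1
  · rw [hA] at hAj
    by_cases hjp : j = nxt d
    · subst hjp
      rw [hpb]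
      exact ⟨by omega, (hA _).2 ⟨p2, by omega⟩, hno⟩
    · rw [hp j hjp]
      obtain ⟨h1, h2, h3⟩ := h.prv_spec j hj hj0 hAj.1
      refine ⟨h1, (hA _).2 ⟨h2, fun h5 => ?_⟩, fun x hx hx' hAx => h3 x hx hx' ((hA x).1 hAx).1⟩
      rcases lt_or_gt_of_ne hjp with h6 | h6
      · exact n4 j (by omega) h6 hAj.1
      · exact h3 _ (by omega) h6 n3
  · rw [hA] at hx hAy
    by_cases hdm : x < d ∧ d < y
    · have h1 : prv d ≤ x := by
        by_contra hc
        exact hbt (prv d) (by omega) (by omega) ((hA _).2 ⟨p2, by omega⟩)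
      have h2 : y ≤ nxt d := by
        by_contra hc
        exact hbt (nxt d) (by omega) (by omega) ((hA _).2 ⟨n3, by omega⟩)
      omega
    · have := h.gap x y hxy hy hx.1 hAy.1 fun z hz hz' hAz =>
        hbt z hz hz' ((hA z).2 ⟨hAz, fun e => hdm (by omega)⟩)
      omega
  · rcases le_total M (nxt d - prv d) with h1 | h1
    · exact ⟨prv d, nxt d, by omega, n2, by omega, hno⟩
    · obtain ⟨x, y, h2, h3, h4, h5⟩ := h.attained
      exact ⟨x, y, h2, h3, by omega, fun z hz hz' hAz => h5 z hz hz' ((hA z).1 hAz).1⟩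

/-- The position `x` is best covered from the last list element `j ≤ x`, and the next list element
lies beyond `x`, at distance at most `M` from `j`. -/
theorem Linked.le_iff_cover (h : Linked n A prv nxt M) (h0 : A 0) {m : ℕ} (hm : 0 < m) :
    M ≤ m ↔ ∀ x < n, ∃ j ≤ x, A j ∧ x < j + m := by
  classical
  constructor
  · intro hM x hx
    obtain ⟨j, hj⟩ : ∃ j, j = Nat.findGreatest A x := ⟨_, rfl⟩
    have h1 : j ≤ x := hj ▸ Nat.findGreatest_le x
    have h2 : A j := hj ▸ Nat.findGreatest_spec (Nat.zero_le x) h0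
    refine ⟨j, h1, h2, ?_⟩
    by_contra hc
    obtain ⟨h3, h4, h5, h6⟩ := h.nxt_spec j (by omega) h2
    have h7 := h.gap j (nxt j) h3 h4 h2 h5 h6
    have h8 := Nat.le_findGreatest (P := A) (show nxt j ≤ x by omega) h5
    omega
  · intro hc
    obtain ⟨x, y, h1, h2, h3, h4⟩ := h.attained
    by_contra hM
    -- If `M > m`, then the position `x + m` could be covered only from strictly inside the free
    -- interval.
    obtain ⟨j, h5, h6, h7⟩ := hc (x + m) (by omega)
    exact h4 j (by omega) (by omega) h6

end

/-! ### Classes of `⊙`-prefixes -/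

namespace Coded

variable (G : Coded)

/-- Position `t` is non-solid. -/
def NS (t : ℕ) : Prop := t < G.n ∧ G.σ ≤ G.code t

theorem S_of_lt {i : ℕ} (h : i < G.n) : G.S i = G.sets (G.code i) := if_pos h

theorem S_of_le {i : ℕ} (h : G.n ≤ i) : G.S i = ∅ := if_neg (by omega)

theorem lt_of_mem_S {i x : ℕ} (h : x ∈ G.S i) : i < G.n := by
  by_contra hc
  rw [G.S_of_le (by omega)] at h
  simp at h

theorem card_S_of_solid {t : ℕ} (ht : t < G.n) (h : ¬ G.NS t) : (G.S t).card = 1 := by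
  have h1 : G.code t < G.σ := by
    by_contra hc
    exact h ⟨ht, by omega⟩
  rw [G.S_of_lt ht, G.sets_solid _ h1, Finset.card_singleton]

theorem two_le_card_S {t : ℕ} (h : G.NS t) : 2 ≤ (G.S t).card := by
  have h1 := G.code_lt t h.1
  have h2 := G.sets_card (G.code t - G.σ) (by have := h.2; omega)
  rwa [Nat.add_sub_cancel' h.2, ← G.S_of_lt h.1] at h2

theorem S_nonempty {t : ℕ} (ht : t < G.n) : (G.S t).Nonempty := by
  rw [← Finset.card_pos]
  by_cases h : G.NS t
  · have := G.two_le_card_S h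
    omega
  · rw [G.card_S_of_solid ht h]
    omega

open Classical in
theorem exists_mismatch (i : ℕ) : ∃ t, ¬ (G.S t ∩ G.S (i + t)).Nonempty :=
  ⟨G.n, by simp [G.S_of_le le_rfl]⟩

open Classical in
/-- The length of the longest prefix that matches at position `i`. -/
noncomputable def Z (i : ℕ) : ℕ := Nat.find (G.exists_mismatch i)

theorem le_Z {i m : ℕ} : m ≤ G.Z i ↔ ∀ t < m, (G.S t ∩ G.S (i + t)).Nonempty := by
  simp [Z, Nat.le_find_iff, Finset.nonempty_iff_ne_empty]

theorem Z_eq {i z : ℕ} (h : ∀ t < z, (G.S t ∩ G.S (i + t)).Nonempty)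
    (h' : ¬ (G.S z ∩ G.S (i + z)).Nonempty) : G.Z i = z := by
  refine le_antisymm ?_ (G.le_Z.2 h)
  by_contra hc
  exact h' (G.le_Z.1 (show z + 1 ≤ G.Z i by omega) z (by omega))

theorem Z_zero : G.Z 0 = G.n :=
  G.Z_eq (fun t ht => by simpa using G.S_nonempty ht) (by simp [G.S_of_le le_rfl])

theorem add_Z_le {i : ℕ} (hi : i ≤ G.n) : i + G.Z i ≤ G.n := by
  by_contra hc
  obtain ⟨x, hx⟩ := G.le_Z.1 (le_refl (G.Z i)) (G.n - i) (by omega)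
  rw [Finset.mem_inter] at hx
  have := G.lt_of_mem_S hx.2
  omega

/-- The candidate `⊙`-prefix for position `i` is determined up to length `m`. -/
def Active (m i : ℕ) : Prop := m ≤ G.Z i ∧ ∀ t < m, (G.S t ∩ G.S (i + t)).card = 1

/-- The shifts that align two non-solid positions. Only at these can a matching prefix fail to
determine a solid string. -/
def Wide (j : ℕ) : Prop := ∃ t, G.NS t ∧ G.NS (j + t)

/-- The classes `κ` whose lists may contain `j`: all of them for a wide `j`, only its own class
otherwise. -/
def InRange (cls : ℕ → ℕ) (j κ : ℕ) : Prop := (G.Wide j → κ < G.n) ∧ (¬ G.Wide j → κ = cls j)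

/-- The state of the classification of the positions by their candidates of length `m`. -/
structure Classes (m : ℕ) (ng cls : ℕ → ℕ) (bad : ℕ → ℕ → ℕ) : Prop where
  ng_iff : ∀ i < G.n, m ≤ G.Z i → (ng i = 0 ↔ G.Active m i)
  cls_lt : ∀ i < G.n, cls i < G.n
  cls_spec : ∀ i < G.n, G.Active m i → G.Active m (cls i) ∧
    ∀ t < m, G.S t ∩ G.S (cls i + t) = G.S t ∩ G.S (i + t)
  cls_eq : ∀ i < G.n, ∀ i' < G.n, G.Active m i → G.Active m i' →
    (∀ t < m, G.S t ∩ G.S (i + t) = G.S t ∩ G.S (i' + t)) → cls i = cls i'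
  bad_iff : ∀ κ < G.n, G.Active m κ → ∀ j < G.n, G.Wide j → m ≤ G.Z j →
    (bad κ j = 0 ↔ ∀ t < m, (G.S t ∩ G.S (κ + t) ∩ G.S (j + t)).Nonempty)
  bad_zero : ∀ κ j, ¬ G.Wide j → bad κ j = 0

/-- The list of a class. -/
def Member (cls : ℕ → ℕ) (bad : ℕ → ℕ → ℕ) (m κ j : ℕ) : Prop :=
  j = 0 ∨ j = G.n ∨ (0 < j ∧ j < G.n ∧ G.InRange cls j κ ∧ bad κ j = 0 ∧ m ≤ G.Z j)

/-- For each class, a member for which the longest prefix matches. -/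
structure Best (m : ℕ) (cls bz best : ℕ → ℕ) : Prop where
  le : ∀ i < G.n, G.Active m i → G.Z i ≤ bz (cls i)
  spec : ∀ κ < G.n, 0 < bz κ → best κ < G.n ∧ G.Z (best κ) = bz κ ∧ G.Active m (best κ) ∧
    cls (best κ) = κ

variable {G} {m m' : ℕ} {ng cls ng' cls' bz best : ℕ → ℕ} {bad bad' : ℕ → ℕ → ℕ}

theorem n_pos : 0 < G.n := by have := G.two_le; have := G.σ_le; omega

theorem Active.mono {i : ℕ} (h : G.Active m' i) (hm : m ≤ m') : G.Active m i :=
  ⟨hm.trans h.1, fun t ht => h.2 t (by omega)⟩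

theorem inter_eq_of_solid {t i : ℕ} (hs : ¬ G.NS t) (h : (G.S t ∩ G.S (i + t)).Nonempty) :
    G.S t ∩ G.S (i + t) = G.S t := by
  obtain ⟨x, hx⟩ := h
  rw [Finset.mem_inter] at hx
  obtain ⟨a, ha⟩ := Finset.card_eq_one.1 (G.card_S_of_solid (G.lt_of_mem_S hx.1) hs)
  rw [ha, Finset.mem_singleton] at hx
  rw [ha, Finset.inter_eq_left, Finset.singleton_subset_iff]
  exact hx.1 ▸ hx.2

/-- At a solid offset of the prefix a nonempty intersection is the prefix symbol itself. So a
stretch of solid offsets neither destroys nor distinguishes candidates; the next two lemmas say the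
same for equality and for occurrences. -/
theorem Active.extend {i : ℕ} (h : G.Active m i) (hs : ∀ t, m ≤ t → t < m' → ¬ G.NS t)
    (hz : m' ≤ G.Z i) : G.Active m' i := by
  refine ⟨hz, fun t ht => ?_⟩
  by_cases htm : t < m
  · exact h.2 t htm
  · have h1 := G.le_Z.1 hz t ht
    have h2 := hs t (by omega) ht
    rw [inter_eq_of_solid h2 h1]
    obtain ⟨x, hx⟩ := h1
    exact G.card_S_of_solid (G.lt_of_mem_S (Finset.mem_inter.1 hx).1) h2

theorem inter_eq_extend {i i' : ℕ} (hs : ∀ t, m ≤ t → t < m' → ¬ G.NS t)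
    (hz : m' ≤ G.Z i) (hz' : m' ≤ G.Z i')
    (h : ∀ t < m, G.S t ∩ G.S (i + t) = G.S t ∩ G.S (i' + t)) :
    ∀ t < m', G.S t ∩ G.S (i + t) = G.S t ∩ G.S (i' + t) := by
  intro t ht
  by_cases htm : t < m
  · exact h t htm
  · have h2 := hs t (by omega) ht
    rw [inter_eq_of_solid h2 (G.le_Z.1 hz t ht), inter_eq_of_solid h2 (G.le_Z.1 hz' t ht)]

theorem compat_extend {κ j : ℕ} (hs : ∀ t, m ≤ t → t < m' → ¬ G.NS t)
    (hz : m' ≤ G.Z κ) (hz' : m' ≤ G.Z j)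
    (h : ∀ t < m, (G.S t ∩ G.S (κ + t) ∩ G.S (j + t)).Nonempty) :
    ∀ t < m', (G.S t ∩ G.S (κ + t) ∩ G.S (j + t)).Nonempty := by
  intro t ht
  by_cases htm : t < m
  · exact h t htm
  · have h2 := hs t (by omega) ht
    rw [inter_eq_of_solid h2 (G.le_Z.1 hz t ht)]
    exact G.le_Z.1 hz' t ht

theorem Classes.zero : G.Classes 0 (fun _ => 0) (fun _ => 0) (fun _ _ => 0) where
  ng_iff i _ _ := by simp [Active]
  cls_lt _ _ := n_pos
  cls_spec i _ _ := by simp [Active]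
  cls_eq _ _ _ _ _ _ _ := rfl
  bad_iff κ _ _ j _ _ _ := by simp
  bad_zero _ _ _ := rfl

/-- The data for length `m` remain valid through the solid offsets up to `m'`, so the step to `m' +
1` has to take only the single offset `m'` into account. -/
theorem Classes.refine (h : G.Classes m ng cls bad) (hmm : m ≤ m')
    (hs : ∀ t, m ≤ t → t < m' → ¬ G.NS t)
    (hng : ∀ i < G.n, m' + 1 ≤ G.Z i →
      (ng' i = 0 ↔ ng i = 0 ∧ (G.S m' ∩ G.S (i + m')).card = 1))
    (hlt : ∀ i < G.n, cls' i < G.n)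
    (hspec : ∀ i < G.n, G.Active (m' + 1) i → G.Active (m' + 1) (cls' i) ∧ cls (cls' i) = cls i ∧
      G.S m' ∩ G.S (cls' i + m') = G.S m' ∩ G.S (i + m'))
    (heq : ∀ i < G.n, ∀ i' < G.n, G.Active (m' + 1) i → G.Active (m' + 1) i' →
      cls i = cls i' → G.S m' ∩ G.S (i + m') = G.S m' ∩ G.S (i' + m') → cls' i = cls' i')
    (hbad : ∀ κ < G.n, G.Active (m' + 1) κ → ∀ j < G.n, G.Wide j → m' + 1 ≤ G.Z j →
      (bad' κ j = 0 ↔ bad κ j = 0 ∧ (G.S m' ∩ G.S (κ + m') ∩ G.S (j + m')).Nonempty))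
    (hbz : ∀ κ j, ¬ G.Wide j → bad' κ j = 0) :
    G.Classes (m' + 1) ng' cls' bad' where
  ng_iff i hi hz := by
    rw [hng i hi hz, h.ng_iff i hi (by omega)]
    constructor
    · rintro ⟨h1, h2⟩
      refine ⟨hz, fun t ht => ?_⟩
      rcases Nat.lt_succ_iff_lt_or_eq.1 ht with h3 | rfl
      · exact (h1.extend hs (by omega)).2 t h3
      · exact h2
    · exact fun h1 => ⟨h1.mono (by omega), h1.2 _ (by omega)⟩
  cls_lt := hlt
  cls_spec i hi ha := by
    obtain ⟨h1, h2, h3⟩ := hspec i hi ha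
    refine ⟨h1, fun t ht => ?_⟩
    rcases Nat.lt_succ_iff_lt_or_eq.1 ht with h4 | rfl
    · refine inter_eq_extend hs (by have := h1.1; omega) (by have := ha.1; omega) (fun t ht => ?_) t h4
      rw [← (h.cls_spec _ (hlt i hi) (h1.mono (by omega))).2 t ht, h2,
        (h.cls_spec _ hi (ha.mono (by omega))).2 t ht]
    · exact h3
  cls_eq i hi i' hi' ha ha' he :=
    heq i hi i' hi' ha ha' (h.cls_eq i hi i' hi' (ha.mono (by omega)) (ha'.mono (by omega))
      fun t ht => he t (by omega)) (he m' (by omega))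
  bad_iff κ hκ ha j hj hw hz := by
    rw [hbad κ hκ ha j hj hw hz, h.bad_iff κ hκ (ha.mono (by omega)) j hj hw (by omega)]
    constructor
    · rintro ⟨h1, h2⟩ t ht
      rcases Nat.lt_succ_iff_lt_or_eq.1 ht with h3 | rfl
      · exact compat_extend hs (by have := ha.1; omega) (by omega) h1 t h3
      · exact h2
    · exact fun h1 => ⟨fun t ht => h1 t (by omega), h1 _ (by omega)⟩
  bad_zero := hbz

/-- For a wide `j` the table `bad` decides whether the candidate occurs. For any other `j > 0` an
occurrence forces the candidate to coincide with that of `j`, hence the classes to be equal. -/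
theorem Classes.member_iff (h : G.Classes m ng cls bad) (hmm : m ≤ m')
    (hs : ∀ t, m ≤ t → t < m' → ¬ G.NS t) {i : ℕ} (hi : i < G.n) (ha : G.Active m' i) {j : ℕ}
    (hj : j < G.n) : G.Member cls bad m' (cls i) j ↔
      j + m' ≤ G.n ∧ ∀ t < m', (G.S t ∩ G.S (i + t) ∩ G.S (j + t)).Nonempty := by
  have ha0 := ha.mono hmm
  obtain ⟨k1, k2⟩ := h.cls_spec i hi ha0
  have hκ := h.cls_lt i hi
  constructor
  -- Position `0` belongs to every list rightly, since a candidate consists of symbols chosen from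
  -- the prefix.
  · rintro (rfl | h1 | ⟨-, -, h1, h2, h3⟩)
    · have := G.add_Z_le hi.le
      refine ⟨by have := ha.1; omega, fun t ht => ?_⟩
      obtain ⟨x, hx⟩ := G.le_Z.1 ha.1 t ht
      rw [Finset.mem_inter] at hx
      exact ⟨x, by simp [hx.1, hx.2]⟩
    · omega
    · refine ⟨by have := G.add_Z_le hj.le; omega, ?_⟩
      refine compat_extend hs ha.1 h3 fun t ht => ?_
      by_cases hw : G.Wide j
      · rw [← k2 t ht]
        exact (h.bad_iff _ hκ k1 j hj hw (by omega)).1 h2 t ht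
      · have hjm := G.le_Z.1 h3 t (by omega)
        have hcls := h1.2 hw
        -- For a `j` that is not wide, one of the two symbols is solid at each offset, so a nonempty
        -- intersection is a singleton.
        have hact : G.Active m j := by
          refine ⟨by omega, fun t ht => ?_⟩
          have hn := G.le_Z.1 h3 t (by omega)
          have h4 : (G.S t ∩ G.S (j + t)).card ≤ 1 := by
            by_cases ht1 : G.NS t
            · obtain ⟨x, hx⟩ := hn
              have h5 := G.lt_of_mem_S (Finset.mem_inter.1 hx).2
              rw [← G.card_S_of_solid h5 fun h6 => hw ⟨t, ht1, h6⟩]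
              exact Finset.card_le_card Finset.inter_subset_right
            · obtain ⟨x, hx⟩ := hn
              rw [← G.card_S_of_solid (G.lt_of_mem_S (Finset.mem_inter.1 hx).1) ht1]
              exact Finset.card_le_card Finset.inter_subset_left
          have := Finset.card_pos.2 hn
          omega
        have e := (h.cls_spec j hj hact).2 t ht
        rw [← hcls, k2 t ht] at e
        rw [e, Finset.inter_assoc, Finset.inter_self]
        exact hjm
  · rintro ⟨h1, h2⟩
    have hz : m' ≤ G.Z j := G.le_Z.2 fun t ht => by
      obtain ⟨x, hx⟩ := h2 t ht
      simp only [Finset.mem_inter] at hx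
      exact ⟨x, by simp [hx.1.1, hx.2]⟩
    rcases Nat.eq_zero_or_pos j with rfl | hj0
    · exact .inl rfl
    refine .inr (.inr ⟨hj0, hj, ?_, ?_, hz⟩)
    · refine ⟨fun _ => hκ, fun hw => ?_⟩
      -- Both intersections are singletons and share the symbol `x`.
      have he : ∀ t < m', G.S t ∩ G.S (i + t) = G.S t ∩ G.S (j + t) ∧
          (G.S t ∩ G.S (j + t)).card = 1 := by
        intro t ht
        obtain ⟨x, hx⟩ := h2 t ht
        simp only [Finset.mem_inter] at hx
        obtain ⟨⟨x1, x2⟩, x3⟩ := hx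
        have hc1 : (G.S t ∩ G.S (j + t)).card ≤ 1 := by
          by_cases ht1 : G.NS t
          · rw [← G.card_S_of_solid (G.lt_of_mem_S x3) fun h6 => hw ⟨t, ht1, h6⟩]
            exact Finset.card_le_card Finset.inter_subset_right
          · rw [← G.card_S_of_solid (G.lt_of_mem_S x1) ht1]
            exact Finset.card_le_card Finset.inter_subset_left
        obtain ⟨a, ha1⟩ := Finset.card_eq_one.1 (ha.2 t ht)
        have e1 : x ∈ G.S t ∩ G.S (i + t) := by simp [x1, x2]
        have e2 : x ∈ G.S t ∩ G.S (j + t) := by simp [x1, x3]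
        have hc2 : (G.S t ∩ G.S (j + t)).card = 1 := le_antisymm hc1 (Finset.card_pos.2 ⟨x, e2⟩)
        obtain ⟨b, hb⟩ := Finset.card_eq_one.1 hc2
        refine ⟨?_, hc2⟩
        rw [ha1, Finset.mem_singleton] at e1
        rw [hb, Finset.mem_singleton] at e2
        rw [ha1, hb, ← e1, ← e2]
      exact h.cls_eq i hi j hj ha0 ⟨by omega, fun t ht => (he t (by omega)).2⟩
        fun t ht => (he t (by omega)).1
    · by_cases hw : G.Wide j
      · rw [h.bad_iff _ hκ k1 j hj hw (by omega)]
        intro t ht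
        rw [k2 t ht]
        exact h2 t (by omega)
      · exact h.bad_zero _ _ hw

theorem Classes.good_iff (h : G.Classes m ng cls bad) (hmm : m ≤ m') (hm' : 0 < m')
    (hs : ∀ t, m ≤ t → t < m' → ¬ G.NS t) {i : ℕ} (hi : i < G.n) (ha : G.Active m' i)
    {prv nxt : ℕ → ℕ} {M : ℕ} (hL : Linked G.n (G.Member cls bad m' (cls i)) prv nxt M) :
    G.Good m' i ↔ M ≤ m' := by
  rw [hL.le_iff_cover (.inl rfl) hm']
  constructor
  · rintro ⟨-, -, h1⟩ x hx
    obtain ⟨j, h2, h3, h4, h5⟩ := h1 x hx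
    exact ⟨j, h2, (h.member_iff hmm hs hi ha (by omega)).2 ⟨h4, h5⟩, h3⟩
  · intro h1
    refine ⟨by have := G.add_Z_le hi.le; have := ha.1; omega, ha.2, fun x hx => ?_⟩
    obtain ⟨j, h2, h3, h4⟩ := h1 x hx
    exact ⟨j, h2, h4, (h.member_iff hmm hs hi ha (by omega)).1 h3⟩

theorem Good.active {i : ℕ} (h : G.Good m i) : G.Active m i :=
  ⟨G.le_Z.2 fun t ht => Finset.card_pos.1 (by rw [h.2.1 t ht]; omega), h.2.1⟩

theorem Good.pos {i : ℕ} (h : G.Good m i) : 0 < m := by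
  obtain ⟨j, h1, h2, -⟩ := h.2.2 0 n_pos
  omega

theorem Good.le {i : ℕ} (h : G.Good m i) : m ≤ G.n := by have := h.1; omega

/-- The class of a `⊙`-prefix that is a cover contains the last possible position. -/
theorem Classes.inRange_of_good (h : G.Classes m ng cls bad) (hmm : m ≤ m')
    (hs : ∀ t, m ≤ t → t < m' → ¬ G.NS t) {i : ℕ} (hg : G.Good m' i) :
    G.InRange cls (G.n - m') (cls i) := by
  have hp := hg.pos
  have hi : i < G.n := by have := hg.1; omega
  obtain ⟨j, h1, h2, h3, h4⟩ := hg.2.2 (G.n - 1) (by omega)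
  obtain rfl : j = G.n - m' := by omega
  rcases (h.member_iff hmm hs hi hg.active (by omega)).2 ⟨h3, h4⟩ with h5 | h5 | h5
  · obtain rfl : i = 0 := by have := hg.1; omega
    rw [h5]
    exact ⟨fun _ => h.cls_lt _ hi, fun _ => rfl⟩
  · omega
  · exact h5.2.2.1

end Coded

open AExpr (reg get inp)
open AProg (assign store branch loop forUp skip)

/-- The environment holds the input for `G`. -/
structure Coded.Input (G : Coded) (E : Env) : Prop where
  X_eq : E.X = 4 * G.n + 40
  inp_n : E.inp 0 = G.n
  inp_k : E.inp 1 = G.k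
  inp_σ : E.inp 2 = G.σ
  inp_code : ∀ i < G.n, E.inp (3 + i) = G.code i
  inp_bits : ∀ j < G.k, ∀ c < G.σ,
    E.inp (3 + G.n + (j * G.σ + c)) = if c ∈ G.sets (G.σ + j) then 1 else 0

/-! ### Reading the input

Registers `2`, `3`, `4` hold `n`, `k`, `σ`. Array `0` holds the codes, array `1` the membership table
of the sets that codes stand for, and array `2` the positions of the non-solid symbols. -/

def readCodes : AProg :=
  forUp 6 0 2
    (assign 7 (inp (3 + reg 6)) ;;
     store 0 (reg 6) 0 0 (reg 7) ;;
     branch (.bin .lt (reg 7) (reg 4)) skip (store 2 (reg 7 - reg 4) 0 0 (reg 6)))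

def readBits : AProg :=
  forUp 6 0 4 (store 1 (reg 6) (reg 6) 0 1) ;;
  forUp 6 0 3
    (assign 7 (reg 4 + reg 6) ;;
     forUp 8 0 4
      (branch (inp ((3 + reg 2) + (reg 6 * reg 4 + reg 8))) (store 1 (reg 7) (reg 8) 0 1) skip))

def readInput : AProg :=
  assign 2 (inp 0) ;; assign 3 (inp 1) ;; assign 4 (inp 2) ;; readCodes ;; readBits

structure Coded.Sizes (G : Coded) (s : AState) : Prop where
  n : s.r 2 = G.n
  k : s.r 3 = G.k
  σ : s.r 4 = G.σ

structure Coded.Base (G : Coded) (s : AState) : Prop extends G.Sizes s where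
  code : ∀ i < G.n, s.a 0 i 0 0 = G.code i
  mem : ∀ u < G.σ + G.k, ∀ c < G.σ, s.a 1 u c 0 = if c ∈ G.sets u then 1 else 0
  pos : ∀ j < G.k, s.a 2 j 0 0 = G.pos j

variable {E : Env} {G : Coded} {s s' : AState} {p : AProg}

theorem Coded.Sizes.of_frame (h : G.Sizes s) (hF : Frame p s s') (h2 : p.writesReg 2 = false)
    (h3 : p.writesReg 3 = false) (h4 : p.writesReg 4 = false) : G.Sizes s' :=
  ⟨(hF.reg 2 h2).trans h.n, (hF.reg 3 h3).trans h.k, (hF.reg 4 h4).trans h.σ⟩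

theorem Coded.Base.of_frame (h : G.Base s) (hF : Frame p s s') (h2 : p.writesReg 2 = false)
    (h3 : p.writesReg 3 = false) (h4 : p.writesReg 4 = false) (a0 : p.writesArr 0 = false)
    (a1 : p.writesArr 1 = false) (a2 : p.writesArr 2 = false) : G.Base s' where
  toSizes := h.toSizes.of_frame hF h2 h3 h4
  code := by rw [hF.arr 0 a0]; exact h.code
  mem := by rw [hF.arr 1 a1]; exact h.mem
  pos := by rw [hF.arr 2 a2]; exact h.pos

theorem readCodes_spec (hE : G.Input E) (hs : G.Sizes s) : Total E readCodes s fun s' =>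
    (∀ i < G.n, s'.a 0 i 0 0 = G.code i) ∧ (∀ j < G.k, s'.a 2 j 0 0 = G.pos j) ∧
    s'.tk ≤ s.tk + G.n := by
  have hX := hE.X_eq
  refine total_for 0 G.n (fun _ => 0) (fun i s' => (∀ x < i, s'.a 0 x 0 0 = G.code x) ∧
    (∀ j < G.k, G.pos j < i → s'.a 2 j 0 0 = G.pos j)) rfl rfl hs.n (by omega) (by omega) rfl rfl
    (by omega) ⟨fun x hx => by omega, fun j _ hj => by omega⟩ ?_ ?_
  · rintro i s1 - hi hr hF ⟨h1, h2⟩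
    have hs1 := hs.of_frame hF rfl rfl rfl
    have hci := G.code_lt i hi
    simp [hr, hs1.σ, hE.inp_code i hi]
    constructor
    · intro h
      refine ⟨fun x hx => ?_, fun j hj hji => ?_⟩
      · split
        · rename_i e; rw [e]
        · exact h1 x (by omega)
      · refine h2 j hj ?_
        rcases Nat.lt_or_eq_of_le hji with h3 | h3
        · exact h3
        · have := G.code_pos j hj
          rw [h3] at this
          omega
    · intro h
      refine ⟨fun x hx => ?_, fun j hj hji => ?_⟩
      · split
        · rename_i e; rw [e]
        · exact h1 x (by omega)
      · have hc := G.code_pos j hj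
        split
        · rename_i e
          rw [e, G.pos_code i hi h]
        · rename_i e
          refine h2 j hj ?_
          rcases Nat.lt_or_eq_of_le hji with h3 | h3
          · exact h3
          · rw [h3] at hc
            omega
  · intro s1 _ _ h1 h2
    simp at h2
    exact ⟨h1.1, fun j hj => h1.2 j hj (G.pos_lt j hj), h2⟩

theorem readBits_spec (hE : G.Input E) (hs : G.Sizes s) (h0 : ∀ u c, s.a 1 u c 0 = 0) :
    Total E readBits s fun s' =>
    (∀ u < G.σ + G.k, ∀ c < G.σ, s'.a 1 u c 0 = if c ∈ G.sets u then 1 else 0) ∧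
    s'.tk ≤ s.tk + (G.σ + G.k * (G.σ + 1)) := by
  have hX := hE.X_eq
  have hσ := G.σ_le
  have hk := G.k_le
  rw [readBits, total_seq]
  refine total_for 0 G.σ (fun _ => 0) (fun i s' => ∀ u c, s'.a 1 u c 0 =
    if u < i ∧ u = c then 1 else 0) rfl rfl hs.σ (by omega) (by omega) rfl rfl
    (by omega) (by simpa using h0) ?_ ?_
  · rintro i s1 - hi hr hF h1
    simp [hr, h1]
    intro u c
    split_ifs <;> first | rfl | omega
  intro s1 hF1 _ h1 ht1
  have hs1 := hs.of_frame hF1 rfl rfl rfl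
  refine total_for 0 G.k (fun _ => G.σ) (fun j s' => ∀ u c, s'.a 1 u c 0 =
    if c < G.σ ∧ u < G.σ + j ∧ c ∈ G.sets u then 1 else 0) rfl rfl hs1.k (by omega) (by omega) rfl rfl
    (by omega) ?_ ?_ ?_
  · intro u c
    simp only [AState.setReg_a, h1]
    congr 1
    refine propext ⟨fun h => ⟨by omega, by omega, ?_⟩, fun h => ?_⟩
    · rw [G.sets_solid u h.1, Finset.mem_singleton, h.2]
    · refine ⟨by omega, ?_⟩
      have := h.2.2
      rw [G.sets_solid u (by omega), Finset.mem_singleton] at this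
      exact this.symm
  · rintro j s2 - hj hr hF2 h2
    have hs2 := hs1.of_frame hF2 rfl rfl rfl
    simp only [total_seq, total_assign, AExpr.val_add, AExpr.val_reg, hr, hs2.σ]
    refine ⟨.inr (by omega), ?_⟩
    refine total_for 0 G.σ (fun _ => 0) (fun c0 s' => ∀ u c, s'.a 1 u c 0 =
      if c < G.σ ∧ (u < G.σ + j ∨ u = G.σ + j ∧ c < c0) ∧ c ∈ G.sets u then 1 else 0) rfl rfl
      (by simp [hs2.σ]) (by omega) (by omega) rfl rfl (by omega) ?_ ?_ ?_
    · simpa using h2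
    · rintro c0 s3 - hc0 hr3 hF3 h3
      have e2 := hF3.reg 2 rfl
      have e4 := hF3.reg 4 rfl
      have e6 := hF3.reg 6 rfl
      have e7 := hF3.reg 7 rfl
      simp [hs2.n, hs2.σ, hr] at e2 e4 e6 e7
      simp [e2, e4, e6, e7, hr3, hE.inp_bits j hj c0 hc0, h3]
      constructor
      · intro hm u c
        by_cases h : u = G.σ + j ∧ c = c0
        · rw [if_pos h, if_pos ⟨by omega, by omega, by rw [h.1, h.2]; exact hm⟩]
        · rw [if_neg h]
          congr 1
          refine propext (and_congr_right fun _ => and_congr_left fun _ => ?_)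
          omega
      · intro hm u c
        congr 1
        refine propext (and_congr_right fun _ => and_congr_left fun hc => ?_)
        have : ¬ (u = G.σ + j ∧ c = c0) := fun h => hm (by rw [← h.1, ← h.2]; exact hc)
        omega
    · intro s3 hF3 _ h3 ht3
      simp at ht3
      refine ⟨fun u c => ?_, by simpa using ht3⟩
      simp only [AState.tick_a, AState.setReg_a, h3]
      congr 1
      refine propext (and_congr_right fun _ => and_congr_left fun _ => ?_)
      omega
  · intro s2 hF2 _ h2 ht2
    simp at ht1 ht2
    refine ⟨fun u hu c hc => ?_, by omega⟩
    rw [h2]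
    congr 1
    exact propext ⟨fun h => h.2.2, fun h => ⟨hc, hu, h⟩⟩

theorem readInput_spec (hE : G.Input E) (h0 : ∀ u c, s.a 1 u c 0 = 0) :
    Total E readInput s fun s' => G.Base s' ∧
      s'.tk ≤ s.tk + (G.n + (G.σ + G.k * (G.σ + 1))) := by
  simp only [readInput, total_seq, total_assign, AExpr.val_inp, AExpr.val_zero, AExpr.val_one,
    AExpr.val_two, hE.inp_n, hE.inp_k, hE.inp_σ, simple_inp, true_or, true_and]
  have hs1 : G.Sizes (((s.setReg 2 G.n).setReg 3 G.k).setReg 4 G.σ) := ⟨by simp, by simp, by simp⟩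
  refine (readCodes_spec hE hs1).use fun s1 hF1 ⟨h1, h2, h3⟩ => ?_
  have hs2 := hs1.of_frame hF1 rfl rfl rfl
  have e1 := hF1.arr 1 rfl
  refine (readBits_spec hE hs2 (by simpa [e1] using h0)).use fun s2 hF2 ⟨h4, h5⟩ => ?_
  refine ⟨⟨hs2.of_frame hF2 rfl rfl rfl, ?_, h4, ?_⟩, ?_⟩
  · rw [hF2.arr 0 rfl]; exact h1
  · rw [hF2.arr 2 rfl]; exact h2
  · simp at h3
    omega

/-! ### Intersections with non-solid symbols

`W[j][u]` is the size of the intersection of the `j`-th non-solid symbol with the set of code `u`,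
and `Sym[j][u]` is an element of it; these are the arrays `3` and `4`. -/

def addCommon : AProg :=
  store 3 (reg 6) (reg 8) 0 1 ;;
  store 4 (reg 6) (reg 8) 0 (reg 8) ;;
  forUp 9 0 3
    (assign 10 (reg 4 + reg 9) ;;
     branch (get 1 (reg 10) (reg 8) 0)
      (assign 11 (get 3 (reg 6) (reg 10) 0 + 1) ;;
       store 3 (reg 6) (reg 10) 0 (reg 11) ;;
       store 4 (reg 6) (reg 10) 0 (reg 8))
      skip)

def intersections : AProg :=
  forUp 6 0 3
    (assign 7 (reg 4 + reg 6) ;;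
     forUp 8 0 4 (branch (get 1 (reg 7) (reg 8) 0) addCommon skip))

namespace Coded

/-- The symbols below `c` in the intersection of the sets of the codes `u` and `v`. -/
def common (G : Coded) (u v c : ℕ) : Finset ℕ := (G.sets u ∩ G.sets v).filter (· < c)

variable {G : Coded}

theorem common_succ (u v c : ℕ) : G.common u v (c + 1) =
    if c ∈ G.sets u ∧ c ∈ G.sets v then insert c (G.common u v c) else G.common u v c := by
  ext x
  simp only [common]
  split_ifs with h
  · simp only [Finset.mem_filter, Finset.mem_inter, Finset.mem_insert]
    constructor
    · rintro ⟨h1, h2⟩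
      by_cases hx : x = c
      · exact .inl hx
      · exact .inr ⟨h1, by omega⟩
    · rintro (rfl | ⟨h1, h2⟩)
      · exact ⟨h, by omega⟩
      · exact ⟨h1, by omega⟩
  · simp only [Finset.mem_filter, Finset.mem_inter]
    refine and_congr_right fun h1 => ⟨fun h2 => ?_, fun h2 => by omega⟩
    have : x ≠ c := fun e => h (e ▸ h1)
    omega

theorem card_common_succ {u v c : ℕ} (hu : c ∈ G.sets u) (hv : c ∈ G.sets v) :
    (G.common u v (c + 1)).card = (G.common u v c).card + 1 := by
  rw [common_succ, if_pos ⟨hu, hv⟩, Finset.card_insert_of_notMem (by simp [common])]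

theorem common_succ_of_not {u v c : ℕ} (h : ¬ (c ∈ G.sets u ∧ c ∈ G.sets v)) :
    G.common u v (c + 1) = G.common u v c := by
  rw [common_succ, if_neg h]

theorem common_solid {u v : ℕ} (hv : v < G.σ) (c : ℕ) :
    G.common u v c = if v ∈ G.sets u ∧ v < c then {v} else ∅ := by
  ext x
  simp only [common, G.sets_solid v hv, Finset.mem_filter, Finset.mem_inter, Finset.mem_singleton]
  split_ifs with h
  · simp only [Finset.mem_singleton]
    exact ⟨fun h => h.1.2, fun e => by subst e; exact ⟨⟨h.1, rfl⟩, h.2⟩⟩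
  · simp only [Finset.notMem_empty, iff_false]
    rintro ⟨⟨h1, rfl⟩, h2⟩
    exact h ⟨h1, h2⟩

theorem common_top {u : ℕ} (hu : u < G.σ + G.k) (v : ℕ) :
    G.common u v G.σ = G.sets u ∩ G.sets v := by
  refine Finset.filter_true_of_mem fun x hx => ?_
  simpa using G.sets_sub u hu (Finset.mem_inter.1 hx).1

theorem card_common_le {u : ℕ} (v c : ℕ) : (G.common u v c).card ≤ c := by
  have : G.common u v c ⊆ Finset.range c := fun x hx => by
    simpa using (Finset.mem_filter.1 hx).2
  simpa using Finset.card_le_card this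

/-- The entries of the row `j` of the arrays `W` and `Sym` for the symbols below `c`. -/
def Row (G : Coded) (s : AState) (j c : ℕ) : Prop := ∀ u < G.σ + G.k,
  s.a 3 j u 0 = (G.common (G.σ + j) u c).card ∧
    (G.common (G.σ + j) u c ≠ ∅ → s.a 4 j u 0 ∈ G.common (G.σ + j) u c)

end Coded

variable {E : Env} {G : Coded} {s : AState}

/-- Among the solid columns the symbol `c` concerns column `c` only, so besides it just the `k`
non-solid columns are inspected. During that loop the columns below `σ + l` are up to date for `c +
1`, the others still for `c`. -/
theorem addCommon_spec (hE : G.Input E) (hs : G.Base s) {j c : ℕ} (hj : s.r 6 = j) (hjk : j < G.k)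
    (hc : s.r 8 = c) (hcσ : c < G.σ) (hm : c ∈ G.sets (G.σ + j)) (hR : G.Row s j c) :
    Total E addCommon s fun s' => G.Row s' j (c + 1) ∧ (∀ i ≠ j, ∀ u, s'.a 3 i u 0 = s.a 3 i u 0 ∧
      s'.a 4 i u 0 = s.a 4 i u 0) ∧ s'.tk ≤ s.tk + G.k := by
  have hX := hE.X_eq
  have hσ := G.σ_le
  have hk := G.k_le
  simp only [addCommon, total_seq, total_store, AExpr.val_reg, AExpr.val_zero, AExpr.val_one,
    simple_one, simple_reg, true_or, true_and, hj, AState.put_r, hc]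
  refine total_for 0 G.k (fun _ => 0) (fun l s' =>
    (∀ u < G.σ + l, s'.a 3 j u 0 = (G.common (G.σ + j) u (c + 1)).card ∧
      (G.common (G.σ + j) u (c + 1) ≠ ∅ → s'.a 4 j u 0 ∈ G.common (G.σ + j) u (c + 1))) ∧
    (∀ u < G.σ + G.k, G.σ + l ≤ u → s'.a 3 j u 0 = (G.common (G.σ + j) u c).card ∧
      (G.common (G.σ + j) u c ≠ ∅ → s'.a 4 j u 0 ∈ G.common (G.σ + j) u c)) ∧
    ∀ i ≠ j, ∀ u, s'.a 3 i u 0 = s.a 3 i u 0 ∧ s'.a 4 i u 0 = s.a 4 i u 0)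
    rfl rfl hs.k (by omega) (by omega) rfl rfl (by omega) ⟨?_, ?_, ?_⟩ ?_ ?_
  · intro u hu
    have hR := hR u (by omega)
    by_cases huc : u = c
    · subst huc
      rw [Coded.common_solid (by omega), if_pos ⟨hm, by omega⟩]
      simp
    · rw [Coded.common_succ_of_not]
      · simpa [huc] using hR
      · rw [G.sets_solid u (by omega), Finset.mem_singleton]
        omega
  · intro u hu hu'
    have huc : u ≠ c := by omega
    simpa [huc] using hR u hu
  · intro i hi u
    simp [hi]
  · rintro l s1 - hl hr hF ⟨h1, h2, h3⟩
    have f4 := hF.reg 4 rfl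
    have f6 := hF.reg 6 rfl
    have f8 := hF.reg 8 rfl
    have fa := hF.arr 1 rfl
    have fm := hs.mem (G.σ + l) (by omega) c hcσ
    simp [hs.σ, hj, hc] at f4 f6 f8
    have fm' : s1.a 1 (G.σ + l) c 0 = if c ∈ G.sets (G.σ + l) then 1 else 0 := by
      rw [fa, ← fm]; simp
    have hcard := Coded.card_common_le (G := G) (u := G.σ + j) (G.σ + l) c
    have h2l := h2 (G.σ + l) (by omega) le_rfl
    simp [f4, f6, f8, hr, fm']
    refine ⟨by omega, fun hm' => ⟨?_, ?_⟩, fun hm' => ?_⟩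
    · rw [h2l.1]
      omega
    · refine ⟨fun u hu => ?_, fun u hu hu' => ?_, fun i hi u => ?_⟩
      · by_cases hul : u = G.σ + l
        · subst hul
          rw [h2l.1, Coded.card_common_succ hm hm']
          simp [Coded.common, hm, hm']
        · simpa [hul] using h1 u (by omega)
      · have hul : u ≠ G.σ + l := by omega
        simpa [hul] using h2 u hu (by omega)
      · simpa [hi] using h3 i hi u
    · refine ⟨fun u hu => ?_, fun u hu hu' => ?_, fun i hi u => ?_⟩
      · by_cases hul : u = G.σ + l
        · subst hul
          rw [Coded.common_succ_of_not (by simp [hm'])]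
          simpa using h2l
        · simpa using h1 u (by omega)
      · simpa using h2 u hu (by omega)
      · simpa using h3 i hi u
  · rintro s1 - - ⟨h1, -, h3⟩ ht
    simp at ht
    exact ⟨h1, h3, by omega⟩

structure Coded.Inters (G : Coded) (s : AState) : Prop where
  card : ∀ j < G.k, ∀ u < G.σ + G.k, s.a 3 j u 0 = (G.sets (G.σ + j) ∩ G.sets u).card
  elem : ∀ j < G.k, ∀ u < G.σ + G.k, G.sets (G.σ + j) ∩ G.sets u ≠ ∅ →
    s.a 4 j u 0 ∈ G.sets (G.σ + j) ∩ G.sets u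

theorem intersections_spec (hE : G.Input E) (hs : G.Base s) (h0 : ∀ j u, s.a 3 j u 0 = 0) :
    Total E intersections s fun s' => G.Inters s' ∧
      s'.tk ≤ s.tk + G.k * (G.σ * (G.k + 1) + 1) := by
  have hX := hE.X_eq
  have hσ := G.σ_le
  have hk := G.k_le
  have row_zero : ∀ s' : AState, ∀ j, (∀ u, s'.a 3 j u 0 = 0) → G.Row s' j 0 := by
    intro s' j h u _
    simp [Coded.common, h]
  refine total_for 0 G.k (fun _ => G.σ * (G.k + 1)) (fun j s' => (∀ i < j, G.Row s' i G.σ) ∧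
    ∀ i, j ≤ i → ∀ u, s'.a 3 i u 0 = 0) rfl rfl hs.k (by omega) (by omega) rfl rfl
    (by omega) ⟨fun i hi => by omega, fun i _ => h0 i⟩ ?_ ?_
  · rintro j s1 - hj hr hF ⟨h1, h2⟩
    have hs1 := hs.of_frame hF rfl rfl rfl rfl rfl rfl
    simp only [total_seq, total_assign, AExpr.val_add, AExpr.val_reg, hr, hs1.σ]
    refine ⟨.inr (by omega), ?_⟩
    refine total_for 0 G.σ (fun _ => G.k) (fun c s' => G.Row s' j c ∧ ∀ i ≠ j, ∀ u,
      s'.a 3 i u 0 = s1.a 3 i u 0 ∧ s'.a 4 i u 0 = s1.a 4 i u 0) rfl rfl (by simp [hs1.σ])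
      (by omega) (by omega) rfl rfl (by omega) ⟨row_zero _ _ (h2 j le_rfl), by simp⟩ ?_ ?_
    · rintro c s2 - hc hr2 hF2 ⟨h3, h4⟩
      have hs2 : G.Base s2 := by
        refine Coded.Base.of_frame (s := s1.setReg 7 (G.σ + j)) ?_ hF2 rfl rfl rfl rfl rfl rfl
        exact ⟨⟨by simp [hs1.n], by simp [hs1.k], by simp [hs1.σ]⟩, hs1.code, hs1.mem, hs1.pos⟩
      have f6 := hF2.reg 6 rfl
      have f7 := hF2.reg 7 rfl
      simp [hr] at f6 f7
      have fm := hs2.mem (G.σ + j) (by omega) c hc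
      simp only [total_branch, AExpr.val_get, AExpr.val_reg, AExpr.val_zero, f7, hr2, fm]
      constructor
      · intro hm
        have hm : c ∈ G.sets (G.σ + j) := by
          by_contra h
          simp [h] at hm
        refine (addCommon_spec hE hs2 f6 hj hr2 hc hm h3).mono fun s3 ⟨h5, h6, h7⟩ => ?_
        refine ⟨⟨h5, fun i hi u => ?_⟩, h7⟩
        simp only [AState.tick_a, AState.setReg_a]
        rw [(h6 i hi u).1, (h6 i hi u).2]
        exact h4 i hi u
      · intro hm
        have hm : ¬ c ∈ G.sets (G.σ + j) := by
          intro h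
          simp [h] at hm
        refine total_skip.2 ⟨⟨fun u hu => ?_, h4⟩, by omega⟩
        simp only [AState.tick_a, AState.setReg_a]
        rw [Coded.common_succ_of_not (by simp [hm])]
        exact h3 u hu
    · rintro s2 - - ⟨h3, h4⟩ ht
      simp at ht
      refine ⟨⟨fun i hi => ?_, fun i hi u => ?_⟩, ht⟩
      · rcases Nat.lt_succ_iff_lt_or_eq.1 hi with h5 | rfl
        · intro u hu
          simp only [AState.tick_a, AState.setReg_a]
          rw [(h4 i (by omega) u).1, (h4 i (by omega) u).2]
          exact h1 i h5 u hu
        · exact h3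
      · simp only [AState.tick_a, AState.setReg_a]
        rw [(h4 i (by omega) u).1]
        exact h2 i (by omega) u
  · rintro s1 - - ⟨h1, -⟩ ht
    simp at ht
    refine ⟨⟨fun j hj u hu => ?_, fun j hj u hu hne => ?_⟩, ht⟩
    · rw [(h1 j hj u hu).1, Coded.common_top (by omega)]
    · have := (h1 j hj u hu).2
      rw [Coded.common_top (by omega)] at this
      exact this hne

/-! ### Longest common extensions of the code string

Row `0` of array `5` holds the longest common extensions of position `0` with all other positions,
row `j + 1` those of position `pos j + 1`. -/

namespace Coded

variable (G : Coded)

def Agree (a b t : ℕ) : Prop := a + t < G.n ∧ b + t < G.n ∧ G.code (a + t) = G.code (b + t)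

instance (a b : ℕ) : DecidablePred (G.Agree a b) := fun t => by unfold Agree; infer_instance

theorem exists_not_agree (a b : ℕ) : ∃ t, ¬ G.Agree a b t := ⟨G.n, fun h => by have := h.1; omega⟩

/-- The length of the longest common extension of the positions `a` and `b`. -/
def lce (a b : ℕ) : ℕ := Nat.find (G.exists_not_agree a b)

variable {G}

theorem le_lce {a b v : ℕ} : v ≤ G.lce a b ↔ ∀ t < v, G.Agree a b t := by
  simp [lce, Nat.le_find_iff]

theorem not_agree_lce (a b : ℕ) : ¬ G.Agree a b (G.lce a b) := Nat.find_spec (G.exists_not_agree a b)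

theorem add_lce_le_left {a : ℕ} (b : ℕ) (ha : a ≤ G.n) : a + G.lce a b ≤ G.n := by
  by_contra hc
  have := (le_lce.1 (le_refl (G.lce a b)) (G.n - a) (by omega)).1
  omega

theorem add_lce_le_right (a : ℕ) {b : ℕ} (hb : b ≤ G.n) : b + G.lce a b ≤ G.n := by
  by_contra hc
  have := (le_lce.1 (le_refl (G.lce a b)) (G.n - b) (by omega)).2.1
  omega

theorem lce_symm (a b : ℕ) : G.lce a b = G.lce b a := by
  refine eq_of_forall_le_iff fun v => ?_
  rw [le_lce, le_lce]
  refine forall₂_congr fun t _ => ?_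
  unfold Agree
  tauto

theorem lce_top (a : ℕ) : G.lce a G.n = 0 := by
  by_contra hc
  have := (le_lce.1 (le_refl (G.lce a G.n)) 0 (by omega)).2.1
  omega

/-- Transfer through a window `[l, r)` that matches at `a`. -/
theorem agree_shift {a l r b : ℕ} (hl : l ≤ b) (hw : r - l ≤ G.lce a l) {d : ℕ} (hd : b + d < r) :
    G.Agree a b d ↔ G.Agree a (a + (b - l)) d := by
  obtain ⟨h1, h2, h3⟩ := le_lce.1 hw (b - l + d) (by omega)
  rw [show l + (b - l + d) = b + d by omega] at h2 h3
  rw [show a + (b - l + d) = a + (b - l) + d by omega] at h1 h3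
  unfold Agree
  rw [h3]
  exact ⟨fun h => ⟨h.1, h1, h.2.2⟩, fun h => ⟨h.1, h2, h.2.2⟩⟩

/-- The text in the window repeats the text from `a` on, so `b` behaves like `a + (b - l)` as long
as the comparison stays inside the window. If the known value ends inside, it is exact; otherwise,
by the next lemma, it yields a lower bound from which comparison can resume at `r`. -/
theorem lce_eq_of_window {a l r b : ℕ} (hl : l ≤ b) (hw : r - l ≤ G.lce a l)
    (h : G.lce a (a + (b - l)) < r - b) : G.lce a b = G.lce a (a + (b - l)) := by
  refine le_antisymm ?_ ?_
  · by_contra hc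
    exact not_agree_lce _ _ ((agree_shift hl hw (by omega)).1 (le_lce.1 le_rfl _ (not_le.1 hc)))
  · exact le_lce.2 fun t ht => (agree_shift hl hw (by omega)).2 (le_lce.1 le_rfl t ht)

theorem le_lce_of_window {a l r b : ℕ} (hl : l ≤ b) (hw : r - l ≤ G.lce a l)
    (h : r - b ≤ G.lce a (a + (b - l))) : r - b ≤ G.lce a b :=
  le_lce.2 fun t ht => (agree_shift hl hw (by omega)).2 (le_lce.1 h t ht)

end Coded

def extendMatch : AProg :=
  assign 15 1 ;;
  loop (reg 15)
    (assign 13 (reg 7 + reg 12) ;;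
     assign 16 (reg 8 + reg 12) ;;
     branch (.bin .lt (reg 13) (reg 2) * .bin .lt (reg 16) (reg 2) *
        .bin .eq (get 0 (reg 13) 0 0) (get 0 (reg 16) 0 0))
      (assign 12 (reg 12 + 1)) (assign 15 0))

def lceGuess : AProg :=
  branch (.bin .lt (reg 8) (reg 11))
    (assign 12 (reg 11 - reg 8) ;;
     assign 13 (reg 7 + (reg 8 - reg 10)) ;;
     assign 14 (get 5 (reg 18) (reg 13) 0) ;;
     branch (.bin .lt (reg 14) (reg 12)) (assign 12 (reg 14)) skip)
    (assign 12 0)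

def lcePhase : AProg :=
  loop (.bin .lt (reg 8) (reg 9))
    (lceGuess ;;
     extendMatch ;;
     store 5 (reg 18) (reg 8) 0 (reg 12) ;;
     assign 16 (reg 8 + reg 12) ;;
     branch (.bin .lt (reg 11) (reg 16)) (assign 10 (reg 8) ;; assign 11 (reg 16)) skip ;;
     assign 8 (reg 8 + 1))

/-- The positions after `a` are treated before those in front of `a`. In the first phase the copy `a
+ (b - l)` lies strictly between `a` and `b`; in the second it lies to the right of `a`. Either way
its value is already known. -/
def lceRow : AProg :=
  assign 8 (reg 7 + 1) ;; assign 9 (reg 2) ;; assign 10 0 ;; assign 11 0 ;; lcePhase ;;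
  assign 8 0 ;; assign 9 (reg 7) ;; assign 10 0 ;; assign 11 0 ;; lcePhase

/-- These rows are enough for the computation of `Z`: a comparison starts with the whole prefix, at
position `0`, or is resumed right after a non-solid position on one of the two sides. -/
def lceTables : AProg :=
  assign 18 0 ;; assign 7 0 ;; lceRow ;;
  forUp 6 0 3 (assign 18 (reg 6 + 1) ;; assign 7 (get 2 (reg 6) 0 0 + 1) ;; lceRow)

variable {E : Env} {G : Coded} {s : AState}

theorem extendMatch_spec (hE : G.Input E) (hs : G.Base s) {a b v : ℕ} (ha : s.r 7 = a) (hb : s.r 8 = b)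
    (hv : s.r 12 = v) (han : a ≤ G.n) (hbn : b ≤ G.n) (hle : v ≤ G.lce a b) :
    Total E extendMatch s fun s' => s'.r 12 = G.lce a b ∧ s'.tk ≤ s.tk + (G.lce a b - v + 1) := by
  have hX := hE.X_eq
  have ba := Coded.add_lce_le_left b han
  have bb := Coded.add_lce_le_right a hbn
  simp only [extendMatch, total_seq, total_assign, simple_one, true_or, true_and, AExpr.val_one]
  -- The factor `2` and the flag in the measure account for the last round, which only clears the
  -- flag.
  refine total_loop (fun s' => s'.r 12 ≤ G.lce a b ∧ v ≤ s'.r 12 ∧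
    (s'.r 15 ≠ 0 ∧ s'.tk = s.tk + (s'.r 12 - v) ∨
      s'.r 15 = 0 ∧ s'.r 12 = G.lce a b ∧ s'.tk = s.tk + (s'.r 12 - v + 1)))
    (fun s' => 2 * (G.lce a b - s'.r 12) + (if s'.r 15 = 0 then 0 else 1)) ?_ ?_ ?_
  · simp [hv, hle]
  · rintro s1 hF ⟨h1, h2, h3⟩ he
    simp only [AExpr.val_reg] at he
    have f2 := hF.reg 2 rfl
    have f7 := hF.reg 7 rfl
    have f8 := hF.reg 8 rfl
    have fa := hF.arr 0 rfl
    simp [hs.n, ha, hb] at f2 f7 f8 fa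
    have h3 : s1.tk = s.tk + (s1.r 12 - v) := by
      rcases h3 with h3 | h3
      exacts [h3.2, absurd h3.1 he]
    simp [f2, f7, f8, fa]
    refine ⟨by omega, by omega, ?_, ?_⟩
    · intro h4 h5 h6
      have hag : G.Agree a b (s1.r 12) := by
        refine ⟨h4, h5, ?_⟩
        rw [← hs.code _ h4, ← hs.code _ h5, h6]
      have hlt : s1.r 12 < G.lce a b := by
        rcases h1.lt_or_eq with h | h
        · exact h
        · rw [h] at hag
          exact absurd hag (Coded.not_agree_lce _ _)
      refine ⟨by omega, ⟨by omega, by omega, .inl ⟨he, by omega⟩⟩, by omega⟩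
    · intro h4
      have hnag : ¬ G.Agree a b (s1.r 12) := by
        rintro ⟨h5, h6, h7⟩
        rw [hs.code _ h5, hs.code _ h6, h7] at h4
        simp at h4
        omega
      have heq : s1.r 12 = G.lce a b := by
        by_contra h
        exact hnag (Coded.le_lce.1 le_rfl _ (lt_of_le_of_ne h1 h))
      refine ⟨⟨h1, h2, heq, by omega⟩, by simp [he]⟩
  · rintro s1 hF ⟨h1, h2, h3⟩ he
    simp only [AExpr.val_reg] at he
    rcases h3 with h3 | h3
    · exact absurd he h3.1
    · exact ⟨h3.2.1, by rw [h3.2.2, h3.2.1]⟩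

theorem lceGuess_spec (hE : G.Input E) {j a b l r v₀ : ℕ} (ha : s.r 7 = a)
    (hb : s.r 8 = b) (hl : s.r 10 = l) (hr : s.r 11 = r) (hj : s.r 18 = j) (han : a ≤ G.n)
    (hbn : b ≤ G.n) (hwin : r ≤ b ∨ l < b ∧ r - l ≤ G.lce a l ∧ (b < r →
      s.a 5 j (a + (b - l)) 0 = G.lce a (a + (b - l)))) (hv₀ : v₀ = G.lce a b) :
    Total E lceGuess s fun s' => s'.r 12 ≤ v₀ ∧ (s'.r 12 = v₀ ∨ r ≤ b + s'.r 12) ∧ s'.tk = s.tk := by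
  have hX := hE.X_eq
  simp [lceGuess, ha, hb, hl, hr, hj]
  refine ⟨fun hbr => ?_, fun h => .inr h⟩
  obtain ⟨w1, w2, w3⟩ : l < b ∧ r - l ≤ G.lce a l ∧ (b < r →
      s.a 5 j (a + (b - l)) 0 = G.lce a (a + (b - l))) := by
    rcases hwin with h | h
    · omega
    · exact h
  rw [w3 hbr]
  refine ⟨by omega, fun h => ?_, fun h => ?_⟩
  · have e := Coded.lce_eq_of_window w1.le w2 (r := r) (by omega)
    exact ⟨by omega, .inl (by omega)⟩
  · have e := Coded.le_lce_of_window w1.le w2 (r := r) (b := b) (by omega)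
    exact ⟨by omega, by omega⟩

/-- Linear time by amortisation: a round costs two iterations plus the number of successful
comparisons, and each of the latter advances the right end of the window, which never exceeds `n`.
-/
theorem lcePhase_spec (hE : G.Input E) (hs : G.Base s) {j a b₀ b₁ : ℕ} (hj : s.r 18 = j)
    (ha : s.r 7 = a) (hb : s.r 8 = b₀) (hb' : s.r 9 = b₁) (hr : s.r 11 = 0)
    (han : a ≤ G.n) (hbn : b₁ ≤ G.n)
    (hph : b₀ = a + 1 ∨ b₀ = 0 ∧ ∀ x, a < x → x < G.n → s.a 5 j x 0 = G.lce a x)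
    (hdis : b₀ = 0 → b₁ ≤ a) :
    Total E lcePhase s fun s' => (∀ x, b₀ ≤ x → x < b₁ → s'.a 5 j x 0 = G.lce a x) ∧
      (∀ i x, i ≠ j ∨ x < b₀ ∨ b₁ ≤ x → s'.a 5 i x 0 = s.a 5 i x 0) ∧
      s'.tk ≤ s.tk + 3 * G.n := by
  have hX := hE.X_eq
  by_cases hb01 : b₁ ≤ b₀
  · exact ⟨s, .loop_done (by simp [hb, hb', hb01]), fun x h1 h2 => by omega, fun _ _ _ => rfl, by omega⟩
  -- The last clause is the amortised bound; `r = 0` stands for the absence of a window.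
  refine total_loop (fun s' => ∃ b l r, s'.r 8 = b ∧ s'.r 10 = l ∧ s'.r 11 = r ∧ b₀ ≤ b ∧ b ≤ b₁ ∧
    (r = 0 ∨ b₀ ≤ l ∧ l < b ∧ l ≤ r ∧ r - l ≤ G.lce a l) ∧
    (∀ x, b₀ ≤ x → x < b → s'.a 5 j x 0 = G.lce a x) ∧
    (∀ i x, i ≠ j ∨ x < b₀ ∨ b ≤ x → s'.a 5 i x 0 = s.a 5 i x 0) ∧
    s'.tk + 2 * b₀ ≤ s.tk + 2 * b + max r b) (fun s' => b₁ - s'.r 8) ?_ ?_ ?_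
  · exact ⟨b₀, _, 0, hb, rfl, hr, le_rfl, by omega, .inl rfl, fun x h1 h2 => by omega,
      fun _ _ _ => rfl, by omega⟩
  · rintro s1 hF ⟨b, l, r, hrb, hrl, hrr, hb0, hb1, hwin, hL, hfr, htk⟩ he
    have hs1 := hs.of_frame hF rfl rfl rfl rfl rfl rfl
    have f7 := (hF.reg 7 rfl).trans ha
    have f9 := (hF.reg 9 rfl).trans hb'
    have f18 := (hF.reg 18 rfl).trans hj
    have hbb : b < b₁ := by
      by_contra hc
      simp [hrb, f9, hc] at he
    have hba : b ≠ a := by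
      rcases hph with h | h
      · omega
      · have := hdis h.1
        omega
    rw [total_seq]
    refine (lceGuess_spec (v₀ := G.lce a b) hE f7 hrb hrl hrr f18 han (by omega) ?_ rfl).use
      fun s2 hF2 ⟨hv, hv', gt⟩ => ?_
    · rcases hwin with h | ⟨h1, h2, h3, h4⟩
      · exact .inl (by omega)
      · refine .inr ⟨h2, h4, fun hbr => ?_⟩
        have b1 := Coded.add_lce_le_left l han
        rcases hph with h | h
        · exact hL _ (by omega) (by omega)
        · by_cases hx : a + (b - l) < b
          · exact hL _ (by omega) hx
          · rw [hfr _ _ (by omega)]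
            exact h.2 _ (by omega) (by omega)
    obtain ⟨v, g12⟩ : ∃ v, s2.r 12 = v := ⟨_, rfl⟩
    rw [g12] at hv hv'
    have hs2 := hs1.of_frame hF2 rfl rfl rfl rfl rfl rfl
    have g7 := (hF2.reg 7 rfl).trans f7
    have g8 := (hF2.reg 8 rfl).trans hrb
    have g9 := (hF2.reg 9 rfl).trans f9
    have g10 := (hF2.reg 10 rfl).trans hrl
    have g11 := (hF2.reg 11 rfl).trans hrr
    have g18 := (hF2.reg 18 rfl).trans f18
    have ga := hF2.arr 5 rfl
    rw [total_seq]
    refine (extendMatch_spec hE hs2 g7 g8 g12 han (by omega) hv).use fun s3 hF3 ⟨h1, h2⟩ => ?_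
    have k7 := (hF3.reg 7 rfl).trans g7
    have k8 := (hF3.reg 8 rfl).trans g8
    have k9 := (hF3.reg 9 rfl).trans g9
    have k10 := (hF3.reg 10 rfl).trans g10
    have k11 := (hF3.reg 11 rfl).trans g11
    have k18 := (hF3.reg 18 rfl).trans g18
    have ka := (hF3.arr 5 rfl).trans (ga)
    have bb := Coded.add_lce_le_right a (show b ≤ G.n by omega)
    simp [k8, k10, k11, k18, h1, hrb]
    refine ⟨by omega, fun h3 => ⟨by omega, ⟨by omega, by omega, ?_, ?_, ?_, ?_⟩, by omega⟩,
      fun h3 => ⟨by omega, ⟨by omega, by omega, ?_, ?_, ?_, ?_⟩, by omega⟩⟩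
    · exact .inr ⟨hb0, by omega⟩
    · intro x hx hxb
      split
      · rename_i e; rw [e]
      · rw [ka]; exact hL x hx (by omega)
    · intro i x hx
      rw [if_neg (by omega), ka]
      exact hfr i x (by omega)
    · omega
    · rcases hwin with h | h
      · exact .inl h
      · exact .inr ⟨h.1, by omega, h.2.2.1, by omega⟩
    · intro x hx hxb
      split
      · rename_i e; rw [e]
      · rw [ka]; exact hL x hx (by omega)
    · intro i x hx
      rw [if_neg (by omega), ka]
      exact hfr i x (by omega)
    · omega
  · rintro s1 hF ⟨b, l, r, hrb, hrl, hrr, hb0, hb1, hwin, hL, hfr, htk⟩ he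
    have f9 := (hF.reg 9 rfl).trans hb'
    obtain rfl : b = b₁ := by
      by_contra hc
      have : b < b₁ := by omega
      simp [hrb, f9, this] at he
    refine ⟨hL, hfr, ?_⟩
    have : r ≤ G.n := by
      rcases hwin with h | h
      · omega
      · have b2 := Coded.add_lce_le_right a (show l ≤ G.n by omega)
        omega
    omega

theorem lceRow_spec (hE : G.Input E) (hs : G.Base s) {j a : ℕ} (hj : s.r 18 = j)
    (ha : s.r 7 = a) (han : a ≤ G.n) (h0 : s.a 5 j G.n 0 = 0) :
    Total E lceRow s fun s' => (∀ x ≤ G.n, x ≠ a → s'.a 5 j x 0 = G.lce a x) ∧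
      (∀ i ≠ j, ∀ x, s'.a 5 i x 0 = s.a 5 i x 0) ∧ s'.tk ≤ s.tk + 6 * G.n := by
  have hX := hE.X_eq
  simp only [lceRow, total_seq, total_assign, AExpr.val_add, AExpr.val_reg, AExpr.val_one,
    AExpr.val_zero, simple_reg, simple_zero, true_or, true_and, AState.setReg_r]
  simp only [Nat.reduceEqDiff, if_false, ha, hs.n]
  refine ⟨.inr (by omega), ?_⟩
  refine (lcePhase_spec hE (j := j) (a := a) (b₀ := a + 1) (b₁ := G.n) ?_ (by simp [hj]) (by simp [ha])
    (by simp) (by simp) (by simp) han le_rfl (.inl rfl) (by omega)).use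
    fun s1 hF ⟨h1, h2, h3⟩ => ?_
  · exact ⟨⟨by simp [hs.n], by simp [hs.k], by simp [hs.σ]⟩, hs.code, hs.mem, hs.pos⟩
  have f2 := hF.reg 2 rfl
  have f3 := hF.reg 3 rfl
  have f4 := hF.reg 4 rfl
  have f7 := hF.reg 7 rfl
  have f18 := hF.reg 18 rfl
  simp [hs.n, hs.k, hs.σ, ha, hj] at f2 f3 f4 f7 f18
  have a0 := hF.arr 0 rfl
  have a1 := hF.arr 1 rfl
  have a2 := hF.arr 2 rfl
  simp at a0 a1 a2 h2 h3
  refine (lcePhase_spec hE (j := j) (a := a) (b₀ := 0) (b₁ := a) ?_ (by simp [f18]) (by simp [f7])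
    (by simp) (by simp [f7]) (by simp) han han (.inr ⟨rfl, fun x h4 h5 => ?_⟩) (by omega)).mono
    fun s2 ⟨h4, h5, h6⟩ => ?_
  · refine ⟨⟨by simp [f2], by simp [f3], by simp [f4]⟩, ?_, ?_, ?_⟩
    · simp only [AState.setReg_a, a0]; exact hs.code
    · simp only [AState.setReg_a, a1]; exact hs.mem
    · simp only [AState.setReg_a, a2]; exact hs.pos
  · simpa using h1 x (by omega) h5
  simp at h4 h5 h6
  refine ⟨fun x hx hxa => ?_, fun i hi x => ?_, by omega⟩
  · by_cases hxa' : x < a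
    · exact h4 x hxa'
    · rw [h5 j x (by omega)]
      by_cases hxn : x = G.n
      · rw [hxn, h2 _ _ (by omega), h0, Coded.lce_top]
      · exact h1 x (by omega) (by omega)
  · rw [h5 i x (by omega), h2 i x (by omega)]

structure Coded.Lces (G : Coded) (s : AState) : Prop where
  zero : ∀ x ≤ G.n, x ≠ 0 → s.a 5 0 x 0 = G.lce 0 x
  succ : ∀ j < G.k, ∀ x ≤ G.n, x ≠ G.pos j + 1 → s.a 5 (j + 1) x 0 = G.lce (G.pos j + 1) x

theorem lceTables_spec (hE : G.Input E) (hs : G.Base s) (h0 : ∀ j x, s.a 5 j x 0 = 0) :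
    Total E lceTables s fun s' => G.Lces s' ∧ s'.tk ≤ s.tk + (6 * G.n + G.k * (6 * G.n + 1)) := by
  have hX := hE.X_eq
  have hk := G.k_le
  simp only [lceTables, total_seq, total_assign, AExpr.val_zero, simple_zero, true_or, true_and]
  have hs0 : G.Base ((s.setReg 18 0).setReg 7 0) :=
    ⟨⟨by simp [hs.n], by simp [hs.k], by simp [hs.σ]⟩, hs.code, hs.mem, hs.pos⟩
  refine (lceRow_spec hE hs0 (j := 0) (a := 0) (by simp) (by simp) (by omega) (h0 _ _)).use
    fun s1 hF ⟨h1, h2, h3⟩ => ?_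
  have hs1 := hs0.of_frame hF rfl rfl rfl rfl rfl rfl
  simp at h3
  refine total_for 0 G.k (fun _ => 6 * G.n) (fun j s' =>
    (∀ x ≤ G.n, x ≠ 0 → s'.a 5 0 x 0 = G.lce 0 x) ∧
    (∀ i < j, ∀ x ≤ G.n, x ≠ G.pos i + 1 → s'.a 5 (i + 1) x 0 = G.lce (G.pos i + 1) x) ∧
    ∀ i > j, ∀ x, s'.a 5 i x 0 = 0) rfl rfl hs1.k (by omega) (by omega) rfl rfl (by omega)
    ⟨h1, fun i hi => by omega, fun i hi x => (h2 i (by omega) x).trans (h0 i x)⟩ ?_ ?_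
  · rintro j s2 - hj hr hF2 ⟨h4, h5, h6⟩
    have hs2 := hs1.of_frame hF2 rfl rfl rfl rfl rfl rfl
    have hp := G.pos_lt j hj
    simp only [total_seq, total_assign, AExpr.val_add, AExpr.val_reg, AExpr.val_one, AExpr.val_zero,
      AExpr.val_get, AState.setReg_r, AState.setReg_a, hr, Nat.reduceEqDiff, if_false, hs2.pos j hj]
    refine ⟨.inr (by omega), .inr (by omega), ?_⟩
    refine (lceRow_spec hE (j := j + 1) (a := G.pos j + 1) ?_ ?_ ?_ (by omega)
      ?_).mono fun s3 h789 => ?_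
    any_goals (simp; done)
    rotate_left
    · exact h6 _ (by omega) _
    rotate_left
    · exact ⟨⟨by simp [hs2.n], by simp [hs2.k], by simp [hs2.σ]⟩, hs2.code, hs2.mem, hs2.pos⟩
    obtain ⟨h7, h8, h9⟩ := h789
    refine ⟨⟨?_, ?_, ?_⟩, by simpa using h9⟩
    · exact fun x hx hx0 => (h8 0 (by omega) x).trans (h4 x hx hx0)
    · intro i hi x hx hxp
      rcases Nat.lt_succ_iff_lt_or_eq.1 hi with h | rfl
      · exact (h8 _ (by omega) x).trans (h5 i h x hx hxp)
      · exact h7 x hx hxp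
    · exact fun i hi x => (h8 i (by omega) x).trans (h6 i (by omega) x)
  · rintro s2 - - ⟨h4, h5, -⟩ ht
    simp at ht
    exact ⟨⟨h4, h5⟩, by omega⟩

/-! ### Longest matches of the prefix, wide positions, buckets

Array `6` holds `Z`, array `7` the indicator of `Wide`. Array `9` lists, for each `z`, the positions
with `Z = z`; array `8` holds the lengths of these lists. -/

namespace Coded

variable {G : Coded}

open Classical in
/-- The number of non-solid positions below `x`. -/
noncomputable def nsBelow (G : Coded) (x : ℕ) : ℕ := ((Finset.range x).filter G.NS).card

theorem nsBelow_mono {x y : ℕ} (h : x ≤ y) : G.nsBelow x ≤ G.nsBelow y := by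
  classical
  exact Finset.card_le_card (Finset.filter_subset_filter _ (Finset.range_mono h))

theorem nsBelow_succ {x : ℕ} (h : G.NS x) : G.nsBelow (x + 1) = G.nsBelow x + 1 := by
  classical
  rw [nsBelow, Finset.range_add_one, Finset.filter_insert, if_pos h, Finset.card_insert_of_notMem (by simp)]
  rfl

theorem NS.idx {x : ℕ} (h : G.NS x) : G.code x - G.σ < G.k ∧ G.pos (G.code x - G.σ) = x ∧
    G.σ + (G.code x - G.σ) = G.code x :=
  ⟨by have := G.code_lt x h.1; have := h.2; omega, G.pos_code x h.1 h.2, by have := h.2; omega⟩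

theorem NS.mem_image {x : ℕ} (h : G.NS x) : x ∈ (Finset.range G.k).image G.pos :=
  Finset.mem_image.2 ⟨_, Finset.mem_range.2 h.idx.1, h.idx.2.1⟩

theorem ns_pos {j : ℕ} (h : j < G.k) : G.NS (G.pos j) :=
  ⟨G.pos_lt j h, by rw [G.code_pos j h]; omega⟩

theorem nsBelow_le (x : ℕ) : G.nsBelow x ≤ G.k := by
  classical
  refine (Finset.card_le_card (fun y hy => (Finset.mem_filter.1 hy).2.mem_image)).trans
    (Finset.card_image_le.trans (by simp))

-- A wide position is the difference of two non-solid ones, and there are `k ^ 2` pairs.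
open Classical in
theorem card_wide_le : ((Finset.range G.n).filter G.Wide).card ≤ G.k ^ 2 := by
  have : (Finset.range G.n).filter G.Wide ⊆
      (Finset.range G.k ×ˢ Finset.range G.k).image fun x => G.pos x.2 - G.pos x.1 := by
    intro j hj
    obtain ⟨t, h1, h2⟩ := (Finset.mem_filter.1 hj).2
    refine Finset.mem_image.2 ⟨(G.code t - G.σ, G.code (j + t) - G.σ), ?_, ?_⟩
    · simp [h1.idx.1, h2.idx.1]
    · simp only [h1.idx.2.1, h2.idx.2.1]
      omega
  refine (Finset.card_le_card this).trans (Finset.card_image_le.trans ?_)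
  simp [sq]

theorem S_eq_of_agree {a b t : ℕ} (h : G.Agree a b t) : G.S (a + t) = G.S (b + t) := by
  rw [G.S_of_lt h.1, G.S_of_lt h.2.1, h.2.2]

theorem disjoint_of_solid {x y : ℕ} (hx : x < G.n) (hy : y < G.n) (h1 : G.code x < G.σ)
    (h2 : G.code y < G.σ) (h : G.code x ≠ G.code y) : ¬ (G.S x ∩ G.S y).Nonempty := by
  rw [G.S_of_lt hx, G.S_of_lt hy, G.sets_solid _ h1, G.sets_solid _ h2]
  simp [h]

theorem Inters.card_S {s : AState} (hI : G.Inters s) {p y : ℕ} (hp : G.NS p) (hy : y < G.n) :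
    s.a 3 (G.code p - G.σ) (G.code y) 0 = (G.S p ∩ G.S y).card := by
  rw [hI.card _ hp.idx.1 _ (G.code_lt y hy), hp.idx.2.2, G.S_of_lt hp.1, G.S_of_lt hy]

theorem Inters.elem_S {s : AState} (hI : G.Inters s) {p y : ℕ} (hp : G.NS p) (hy : y < G.n)
    (h : (G.S p ∩ G.S y).Nonempty) : s.a 4 (G.code p - G.σ) (G.code y) 0 ∈ G.S p ∩ G.S y := by
  have := hI.elem _ hp.idx.1 _ (G.code_lt y hy)
  rw [hp.idx.2.2, ← G.S_of_lt hp.1, ← G.S_of_lt hy] at this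
  exact this h.ne_empty

theorem Inters.of_frame {s s' : AState} {p : AProg} (h : G.Inters s) (hF : Frame p s s')
    (a3 : p.writesArr 3 = false) (a4 : p.writesArr 4 = false) : G.Inters s' where
  card := by rw [hF.arr 3 a3]; exact h.card
  elem := by rw [hF.arr 4 a4]; exact h.elem

theorem Lces.of_frame {s s' : AState} {p : AProg} (h : G.Lces s) (hF : Frame p s s')
    (a5 : p.writesArr 5 = false) : G.Lces s' where
  zero := by rw [hF.arr 5 a5]; exact h.zero
  succ := by rw [hF.arr 5 a5]; exact h.succ

theorem Base.congr {s s' : AState} (h : G.Base s) (h2 : s'.r 2 = s.r 2) (h3 : s'.r 3 = s.r 3)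
    (h4 : s'.r 4 = s.r 4) (ha : s'.a = s.a) : G.Base s' where
  n := h2.trans h.n
  k := h3.trans h.k
  σ := h4.trans h.σ
  code := by rw [ha]; exact h.code
  mem := by rw [ha]; exact h.mem
  pos := by rw [ha]; exact h.pos

end Coded

/-- Extend the match by one common extension, and, if possible, by a non-solid position. -/
def matchStep : AProg :=
  assign 7 (reg 7 + get 5 (reg 8) (reg 9) 0) ;;
  assign 11 (reg 6 + reg 7) ;;
  branch (.bin .lt (reg 11) (reg 2))
    (assign 12 (get 0 (reg 7) 0 0) ;;
     assign 13 (get 0 (reg 11) 0 0) ;;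
     branch (.bin .lt (reg 12) (reg 4))
      (branch (.bin .lt (reg 13) (reg 4)) (assign 10 0)
        (assign 14 (reg 13 - reg 4) ;;
         branch (get 3 (reg 14) (reg 12) 0)
          (assign 7 (reg 7 + 1) ;; assign 8 (reg 14 + 1) ;; assign 9 (reg 7)) (assign 10 0)))
      (assign 14 (reg 12 - reg 4) ;;
       branch (get 3 (reg 14) (reg 13) 0)
        (assign 7 (reg 7 + 1) ;; assign 8 (reg 14 + 1) ;; assign 9 (reg 6 + reg 7)) (assign 10 0)))
    (assign 10 0)

def longestMatch : AProg :=
  assign 7 0 ;; assign 8 0 ;; assign 9 (reg 6) ;; assign 10 1 ;; loop (reg 10) matchStep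

def matchTable : AProg :=
  store 6 0 0 0 (reg 2) ;;
  assign 15 1 ;;
  forUp 6 (reg 15) 2 (longestMatch ;; store 6 (reg 6) 0 0 (reg 7))

def widePositions : AProg :=
  forUp 6 0 3 (forUp 7 0 3
    (assign 8 (get 2 (reg 6) 0 0) ;; assign 9 (get 2 (reg 7) 0 0) ;;
     branch (.bin .lt (reg 9) (reg 8)) skip (store 7 (reg 9 - reg 8) 0 0 1)))

def buckets : AProg :=
  forUp 6 0 2
    (assign 7 (get 6 (reg 6) 0 0) ;;
     assign 8 (get 8 (reg 7) 0 0) ;;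
     store 9 (reg 7) (reg 8) 0 (reg 6) ;;
     assign 8 (reg 8 + 1) ;;
     store 8 (reg 7) 0 0 (reg 8))

variable {E : Env} {G : Coded} {s : AState}

/-- After the common extension the codes differ or the end is reached. Two different solid codes
have disjoint sets; otherwise one side is non-solid and the table of intersections decides. If the
match goes on, the row for the position after this non-solid one serves the next jump, by symmetry
of `lce` on whichever side it is. -/
theorem matchStep_spec (hE : G.Input E) (hs : G.Base s) (hI : G.Inters s) (hL : G.Lces s) {i v : ℕ}
    (hi : s.r 6 = i) (hi0 : 0 < i) (hv : s.r 7 = v) (hvn : i + v ≤ G.n) (h10 : s.r 10 ≠ 0)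
    (hlook : s.a 5 (s.r 8) (s.r 9) 0 = G.lce v (i + v)) (hZ : v ≤ G.Z i) :
    Total E matchStep s fun s' => s'.tk = s.tk ∧ v ≤ s'.r 7 ∧ (s'.r 10 = 0 ∧ s'.r 7 = G.Z i ∨
      s'.r 10 ≠ 0 ∧ i + s'.r 7 ≤ G.n ∧ v < s'.r 7 ∧
      s'.a 5 (s'.r 8) (s'.r 9) 0 = G.lce (s'.r 7) (i + s'.r 7) ∧ s'.r 7 ≤ G.Z i ∧
      G.nsBelow v + G.nsBelow (i + v) + 1 ≤ G.nsBelow (s'.r 7) + G.nsBelow (i + s'.r 7)) := by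
  have hX := hE.X_eq
  have hb := Coded.add_lce_le_right v hvn
  obtain ⟨x, hx⟩ : ∃ x, x = v + G.lce v (i + v) := ⟨_, rfl⟩
  have hxi : i + v + G.lce v (i + v) = i + x := by omega
  have hZx : x ≤ G.Z i := by
    refine G.le_Z.2 fun t ht => ?_
    by_cases htv : t < v
    · exact G.le_Z.1 hZ t htv
    · have hag := Coded.le_lce.1 (le_refl (G.lce v (i + v))) (t - v) (by omega)
      have e := Coded.S_eq_of_agree hag
      rw [show v + (t - v) = t by omega, show i + v + (t - v) = i + t by omega] at e
      rw [← e, Finset.inter_self]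
      exact G.S_nonempty (by omega)
  have hnag := Coded.not_agree_lce (G := G) v (i + v)
  simp only [Coded.Agree, hxi, ← hx] at hnag
  have hmono1 := Coded.nsBelow_mono (G := G) (show v ≤ x by omega)
  have hmono2 := Coded.nsBelow_mono (G := G) (show i + v ≤ i + x by omega)
  simp [matchStep, hi, hv, hlook, hs.n, hs.σ, ← hx]
  refine ⟨by omega, by omega, fun hlt => ?_, fun hge => ?_⟩
  · have hcx := hs.code x (by omega)
    have hcy := hs.code (i + x) hlt
    have hne : G.code x ≠ G.code (i + x) := fun e => hnag ⟨by omega, hlt, e⟩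
    have hfail : ¬ (G.S x ∩ G.S (i + x)).Nonempty → v ≤ x ∧ x = G.Z i := fun h =>
      ⟨by omega, (G.Z_eq (G.le_Z.1 hZx) h).symm⟩
    have hsucc : (G.S x ∩ G.S (i + x)).Nonempty → x + 1 ≤ G.Z i := fun h => G.le_Z.2 fun t ht => by
      rcases Nat.lt_succ_iff_lt_or_eq.1 ht with h1 | rfl
      exacts [G.le_Z.1 hZx t h1, h]
    simp only [hcx, hcy]
    refine ⟨fun hsx => ⟨fun hsy => hfail (Coded.disjoint_of_solid (by omega) hlt hsx hsy hne),
      fun hsy => ?_⟩, fun hsx => ?_⟩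
    · have hns : G.NS (i + x) := ⟨hlt, hsy⟩
      rw [hI.card_S hns (show x < G.n by omega), Finset.inter_comm]
      refine ⟨fun hc => ⟨by omega, ?_, by omega, ?_⟩, fun hc => hfail ?_⟩
      · have := hns.idx.1; have := G.k_le; omega
      · refine .inr ⟨h10, by omega, by omega, ?_, hsucc ?_, ?_⟩
        · have h1 := hL.succ _ hns.idx.1 (x + 1) (by omega) (by rw [hns.idx.2.1]; omega)
          rw [hns.idx.2.1] at h1
          rw [h1, Coded.lce_symm]
          rfl
        · exact Finset.card_pos.1 (Nat.pos_of_ne_zero hc)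
        · have h1 := Coded.nsBelow_succ hns
          have h2 := Coded.nsBelow_mono (G := G) (show x ≤ x + 1 by omega)
          rw [show i + (x + 1) = i + x + 1 by omega]
          omega
      · rw [Finset.card_eq_zero.1 hc]; simp
    · have hns : G.NS x := ⟨by omega, hsx⟩
      rw [hI.card_S hns hlt]
      refine ⟨fun hc => ⟨by omega, ?_, by omega, by omega, ?_⟩, fun hc => hfail ?_⟩
      · have := hns.idx.1; have := G.k_le; omega
      · refine .inr ⟨h10, by omega, by omega, ?_, hsucc ?_, ?_⟩
        · have h1 := hL.succ _ hns.idx.1 (i + (x + 1)) (by omega) (by rw [hns.idx.2.1]; omega)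
          rw [hns.idx.2.1] at h1
          exact h1
        · exact Finset.card_pos.1 (Nat.pos_of_ne_zero hc)
        · have h1 := Coded.nsBelow_succ hns
          have h2 := Coded.nsBelow_mono (G := G) (show i + x ≤ i + (x + 1) by omega)
          omega
      · rw [Finset.card_eq_zero.1 hc]; simp
  · refine ⟨by omega, (G.Z_eq (G.le_Z.1 hZx) ?_).symm⟩
    rw [G.S_of_le hge]
    simp

/-- Each jump but the last passes a non-solid position in the prefix or in the matched factor, and
each side has at most `k` of these. The diagonal entries missing from the tables are not consulted,
because `0 < i`. -/
theorem longestMatch_spec (hE : G.Input E) (hs : G.Base s) (hI : G.Inters s) (hL : G.Lces s) {i : ℕ}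
    (hi : s.r 6 = i) (hi0 : 0 < i) (hin : i < G.n) :
    Total E longestMatch s fun s' => s'.r 7 = G.Z i ∧ s'.tk ≤ s.tk + (2 * G.k + 1) := by
  have hX := hE.X_eq
  simp only [longestMatch, total_seq, total_assign, AExpr.val_zero, AExpr.val_one, AExpr.val_reg,
    simple_zero, simple_one, simple_reg, true_or, true_and]
  refine total_loop (fun s' => s'.r 10 = 0 ∧ s'.r 7 = G.Z i ∧ s'.tk ≤ s.tk + (2 * G.k + 1) ∨
      s'.r 10 ≠ 0 ∧ i + s'.r 7 ≤ G.n ∧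
      s'.a 5 (s'.r 8) (s'.r 9) 0 = G.lce (s'.r 7) (i + s'.r 7) ∧ s'.r 7 ≤ G.Z i ∧
      s'.tk ≤ s.tk + (G.nsBelow (s'.r 7) + G.nsBelow (i + s'.r 7)))
    (fun s' => 2 * (G.n - s'.r 7) + (if s'.r 10 = 0 then 0 else 1)) ?_ ?_ ?_
  · right
    simp [hi]
    exact ⟨by omega, hL.zero i hin.le (by omega)⟩
  · rintro s1 hF h he
    rcases h with h | ⟨h1, h2, h3, h4, h5⟩
    · exact absurd h.1 he
    have hs0 : G.Base ((((s.setReg 7 0).setReg 8 0).setReg 9 (s.r 6)).setReg 10 1) :=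
      hs.congr (by simp) (by simp) (by simp) rfl
    have hs1 := hs0.of_frame hF rfl rfl rfl rfl rfl rfl
    have hI1 : G.Inters s1 := by
      refine Coded.Inters.of_frame ?_ hF rfl rfl
      exact ⟨hI.card, hI.elem⟩
    have hL1 : G.Lces s1 := by
      refine Coded.Lces.of_frame ?_ hF rfl
      exact ⟨hL.zero, hL.succ⟩
    have f6 := hF.reg 6 rfl
    simp [hi] at f6
    refine (matchStep_spec hE hs1 hI1 hL1 f6 hi0 rfl h2 h1 h3 h4).mono fun s2 ⟨g1, g2, g3⟩ => ?_
    simp only [AState.tick_r, AState.tick_tk, AState.tick_a]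
    have b1 := Coded.nsBelow_le (G := G) (s1.r 7)
    have b2 := Coded.nsBelow_le (G := G) (i + s1.r 7)
    rcases g3 with g3 | ⟨g3, g4, g5, g6, g7, g8⟩
    · exact ⟨.inl ⟨g3.1, g3.2, by omega⟩, by simp [g3.1, h1]; omega⟩
    · exact ⟨.inr ⟨g3, g4, g6, g7, by omega⟩, by simp [g3, h1]; omega⟩
  · rintro s1 hF h he
    rcases h with h | h
    · exact h.2
    · exact absurd he h.1

structure Coded.Tables (G : Coded) (s : AState) : Prop extends G.Base s, G.Inters s where
  Z : ∀ i < G.n, s.a 6 i 0 0 = G.Z i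
  wide : ∀ j, s.a 7 j 0 0 ≠ 0 ↔ G.Wide j
  bucket : ∀ z, s.a 8 z 0 0 = ((List.range G.n).filter (G.Z · = z)).length ∧
    ∀ c (h : c < ((List.range G.n).filter (G.Z · = z)).length),
      s.a 9 z c 0 = ((List.range G.n).filter (G.Z · = z))[c]

theorem matchTable_spec (hE : G.Input E) (hs : G.Base s) (hI : G.Inters s) (hL : G.Lces s) :
    Total E matchTable s fun s' => (∀ i < G.n, s'.a 6 i 0 0 = G.Z i) ∧
      s'.tk ≤ s.tk + G.n * (2 * G.k + 2) := by
  have hX := hE.X_eq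
  have hn := Coded.n_pos (G := G)
  simp only [matchTable, total_seq, total_assign, total_store, AExpr.val_zero, AExpr.val_one,
    AExpr.val_reg, simple_one, simple_reg, true_or, true_and, hs.n]
  have hs0 : G.Base ((s.put 6 0 0 0 G.n).setReg 15 1) :=
    ⟨⟨by simp [hs.n], by simp [hs.k], by simp [hs.σ]⟩, by simpa using hs.code, by simpa using hs.mem,
      by simpa using hs.pos⟩
  refine total_for 1 G.n (fun _ => 2 * G.k + 1) (fun i s' => ∀ x < i, s'.a 6 x 0 0 = G.Z x) rfl (by simp)
    (by simp [hs.n]) (by omega) (by omega) rfl rfl (by omega) ?_ ?_ ?_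
  · intro x hx
    obtain rfl : x = 0 := by omega
    simp [G.Z_zero]
  · rintro i s1 hi0 hi hr hF h1
    have hs1 := hs0.of_frame hF rfl rfl rfl rfl rfl rfl
    have hI1 : G.Inters s1 := by
      refine Coded.Inters.of_frame ?_ hF rfl rfl
      exact ⟨by simpa using hI.card, by simpa using hI.elem⟩
    have hL1 : G.Lces s1 := by
      refine Coded.Lces.of_frame ?_ hF rfl
      exact ⟨by simpa using hL.zero, by simpa using hL.succ⟩
    rw [total_seq]
    refine (longestMatch_spec hE hs1 hI1 hL1 hr hi0 hi).use fun s2 hF2 ⟨h2, h3⟩ => ?_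
    have f6 := (hF2.reg 6 rfl).trans hr
    have fa := hF2.arr 6 rfl
    simp [f6, fa, h2]
    refine ⟨fun x hx => ?_, h3⟩
    split
    · rename_i e; rw [e]
    · exact h1 x (by omega)
  · rintro s1 hF - h1 h2
    refine ⟨h1, ?_⟩
    simp at h2
    have : (G.n - 1) * (2 * G.k + 1 + 1) ≤ G.n * (2 * G.k + 2) := Nat.mul_le_mul_right _ (by omega)
    omega

theorem widePositions_spec (hE : G.Input E) (hs : G.Base s) (h0 : ∀ j, s.a 7 j 0 0 = 0) :
    Total E widePositions s fun s' => (∀ j, s'.a 7 j 0 0 ≠ 0 ↔ G.Wide j) ∧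
      s'.tk ≤ s.tk + G.k * (G.k + 1) := by
  have hX := hE.X_eq
  have hk := G.k_le
  refine total_for 0 G.k (fun _ => G.k) (fun a s' => ∀ j, s'.a 7 j 0 0 ≠ 0 ↔
    ∃ x < a, ∃ y < G.k, G.pos x ≤ G.pos y ∧ j = G.pos y - G.pos x) rfl rfl hs.k (by omega) (by omega)
    rfl rfl (by omega) (by simp [h0]) ?_ ?_
  · rintro a s1 - ha hr hF h1
    have hs1 := hs.of_frame hF rfl rfl rfl rfl rfl rfl
    refine total_for 0 G.k (fun _ => 0) (fun b s' => ∀ j, s'.a 7 j 0 0 ≠ 0 ↔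
      (∃ x < a, ∃ y < G.k, G.pos x ≤ G.pos y ∧ j = G.pos y - G.pos x) ∨
      ∃ y < b, G.pos a ≤ G.pos y ∧ j = G.pos y - G.pos a) rfl rfl hs1.k (by omega) (by omega)
      rfl rfl (by omega) (by simpa using h1) ?_ ?_
    · rintro b s2 - hb hr2 hF2 h2
      have hs2 := hs1.of_frame hF2 rfl rfl rfl rfl rfl rfl
      have f6 := (hF2.reg 6 rfl).trans hr
      simp [f6, hr2, hs2.pos a ha, hs2.pos b hb, -ne_eq]
      refine ⟨fun h j => ?_, fun h j => ?_⟩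
      · have h : G.pos b < G.pos a := by
          by_contra hc
          simp [hc] at h
        rw [h2]
        refine or_congr_right ⟨fun ⟨y, h3, h4⟩ => ⟨y, by omega, h4⟩, fun ⟨y, h3, h4⟩ => ⟨y, ?_, h4⟩⟩
        rcases Nat.lt_succ_iff_lt_or_eq.1 (Nat.lt_succ_of_le h3) with h5 | rfl
        · exact h5
        · exact absurd h4.1 (by omega)
      · by_cases hj : j = G.pos b - G.pos a
        · simp only [if_pos hj]
          exact ⟨fun _ => .inr ⟨b, by omega, h, hj⟩, fun _ => by omega⟩
        · rw [if_neg hj, h2]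
          refine or_congr_right ⟨fun ⟨y, h3, h4⟩ => ⟨y, by omega, h4⟩, fun ⟨y, h3, h4⟩ => ⟨y, ?_, h4⟩⟩
          rcases Nat.lt_succ_iff_lt_or_eq.1 (Nat.lt_succ_of_le h3) with h5 | rfl
          · exact h5
          · exact absurd h4.2 hj
    · rintro s2 - - h2 ht
      simp at ht
      refine ⟨fun j => ?_, ht⟩
      simp only [AState.tick_a, AState.setReg_a, h2]
      constructor
      · rintro (⟨x, h3, h4⟩ | h3)
        exacts [⟨x, by omega, h4⟩, ⟨a, by omega, h3⟩]
      · rintro ⟨x, h3, h4⟩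
        rcases Nat.lt_succ_iff_lt_or_eq.1 h3 with h5 | rfl
        exacts [.inl ⟨x, h5, h4⟩, .inr h4]
  · rintro s1 - - h1 ht
    simp at ht
    refine ⟨fun j => ?_, ht⟩
    rw [h1]
    constructor
    · rintro ⟨x, hx, y, hy, h2, rfl⟩
      exact ⟨G.pos x, Coded.ns_pos hx, by rw [Nat.sub_add_cancel h2]; exact Coded.ns_pos hy⟩
    · rintro ⟨t, h2, h3⟩
      refine ⟨_, h2.idx.1, _, h3.idx.1, ?_⟩
      rw [h2.idx.2.1, h3.idx.2.1]
      omega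

theorem buckets_spec (hE : G.Input E) (hs : G.Base s) (hZ : ∀ i < G.n, s.a 6 i 0 0 = G.Z i)
    (h0 : ∀ z, s.a 8 z 0 0 = 0) :
    Total E buckets s fun s' => (∀ z, s'.a 8 z 0 0 = ((List.range G.n).filter (G.Z · = z)).length ∧
      ∀ c (h : c < ((List.range G.n).filter (G.Z · = z)).length),
        s'.a 9 z c 0 = ((List.range G.n).filter (G.Z · = z))[c]) ∧ s'.tk ≤ s.tk + G.n := by
  have hX := hE.X_eq
  refine total_for 0 G.n (fun _ => 0) (fun i s' =>
    ∀ z, s'.a 8 z 0 0 = ((List.range i).filter (G.Z · = z)).length ∧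
      ∀ c (h : c < ((List.range i).filter (G.Z · = z)).length),
        s'.a 9 z c 0 = ((List.range i).filter (G.Z · = z))[c]) rfl rfl hs.n (by omega) (by omega)
    rfl rfl (by omega) (by simp [h0]) ?_ ?_
  · rintro i s1 - hi hr hF h1
    have fa : s1.a 6 i 0 0 = G.Z i := by rw [hF.arr 6 rfl]; exact hZ i hi
    have hle : ((List.range i).filter (G.Z · = G.Z i)).length ≤ i :=
      (List.length_filter_le _ _).trans (by simp)
    simp [hr, fa, (h1 (G.Z i)).1]
    refine ⟨by omega, fun z => ?_⟩
    by_cases hz : z = G.Z i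
    · subst hz
      have e : (List.range (i + 1)).filter (G.Z · = G.Z i) =
          (List.range i).filter (G.Z · = G.Z i) ++ [i] := by
        rw [List.range_succ, List.filter_append]
        simp
      simp only [e, List.length_append, List.length_singleton, true_and, if_true]
      intro c hc
      split
      · rename_i h
        simp [h]
      · rw [List.getElem_append_left (by omega)]
        exact (h1 _).2 c (by omega)
    · have e : (List.range (i + 1)).filter (G.Z · = z) = (List.range i).filter (G.Z · = z) := by
        rw [List.range_succ, List.filter_append]
        simp [Ne.symm hz]
      simp only [e, hz, if_false, false_and]
      exact h1 z
  · rintro s1 - - h1 ht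
    exact ⟨h1, by simpa using ht⟩

def prepare : AProg :=
  readInput ;; intersections ;; lceTables ;; matchTable ;; widePositions ;; buckets

theorem prepare_spec (hE : G.Input E) (h0 : ∀ α x y z, s.a α x y z = 0) :
    Total E prepare s fun s' => G.Tables s' ∧
      s'.tk ≤ s.tk + 30 * (G.n * (G.k + 1) ^ 2) := by
  have hX := hE.X_eq
  have hσ := G.σ_le
  have hk := G.k_le
  simp only [prepare, total_seq]
  refine (readInput_spec hE fun _ _ => h0 _ _ _ _).use fun s1 F1 ⟨b1, t1⟩ => ?_
  refine (intersections_spec hE b1 fun _ _ => by rw [F1.arr 3 rfl]; exact h0 _ _ _ _).use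
    fun s2 F2 ⟨i2, t2⟩ => ?_
  have b2 := b1.of_frame F2 rfl rfl rfl rfl rfl rfl
  refine (lceTables_spec hE b2 fun _ _ => by
    rw [F2.arr 5 rfl, F1.arr 5 rfl]; exact h0 _ _ _ _).use fun s3 F3 ⟨l3, t3⟩ => ?_
  have b3 := b2.of_frame F3 rfl rfl rfl rfl rfl rfl
  have i3 := i2.of_frame F3 rfl rfl
  refine (matchTable_spec hE b3 i3 l3).use fun s4 F4 ⟨z4, t4⟩ => ?_
  have b4 := b3.of_frame F4 rfl rfl rfl rfl rfl rfl
  have i4 := i3.of_frame F4 rfl rfl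
  refine (widePositions_spec hE b4 fun _ => by
    rw [F4.arr 7 rfl, F3.arr 7 rfl, F2.arr 7 rfl, F1.arr 7 rfl]; exact h0 _ _ _ _).use
    fun s5 F5 ⟨w5, t5⟩ => ?_
  have b5 := b4.of_frame F5 rfl rfl rfl rfl rfl rfl
  have i5 := i4.of_frame F5 rfl rfl
  have z5 : ∀ i < G.n, s5.a 6 i 0 0 = G.Z i := by rw [F5.arr 6 rfl]; exact z4
  refine (buckets_spec hE b5 z5 fun _ => by
    rw [F5.arr 8 rfl, F4.arr 8 rfl, F3.arr 8 rfl, F2.arr 8 rfl, F1.arr 8 rfl]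
    exact h0 _ _ _ _).use fun s6 F6 ⟨w6, t6⟩ => ?_
  refine ⟨⟨b5.of_frame F6 rfl rfl rfl rfl rfl rfl, i5.of_frame F6 rfl rfl, ?_, ?_, w6⟩, ?_⟩
  · rw [F6.arr 6 rfl]; exact z5
  · rw [F6.arr 7 rfl]; exact w5
  · have e1 : G.k * (G.σ + 1) ≤ 2 * (G.n * G.k) := by
      have hn := Coded.n_pos (G := G)
      have := Nat.mul_le_mul_left G.k (show G.σ + 1 ≤ 2 * G.n by omega)
      nlinarith
    have hkn : G.k ≤ G.n * G.k := Nat.le_mul_of_pos_left _ (Coded.n_pos (G := G))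
    have hkk : G.k * G.k ≤ G.n * G.k := Nat.mul_le_mul_right _ hk
    have e2 : G.k * (G.σ * (G.k + 1) + 1) ≤ G.n * G.k * G.k + 2 * (G.n * G.k) := by
      have : G.σ * G.k * G.k ≤ G.n * G.k * G.k := by gcongr
      have : G.σ * G.k ≤ G.n * G.k := by gcongr
      nlinarith
    have e3 : G.k * (6 * G.n + 1) ≤ 7 * (G.n * G.k) := by nlinarith
    have e4 : G.k * (G.k + 1) ≤ 2 * (G.n * G.k) := by nlinarith
    have e5 : G.n * (G.k + 1) ^ 2 = G.n * G.k * G.k + 2 * (G.n * G.k) + G.n := by ring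
    have e6 : G.n * (2 * G.k + 2) = 2 * (G.n * G.k) + 2 * G.n := by ring
    omega

variable {E : Env} {G : Coded} {s s' : AState} {p : AProg}

theorem Coded.Tables.of_frame (h : G.Tables s) (hF : Frame p s s') (h2 : p.writesReg 2 = false)
    (h3 : p.writesReg 3 = false) (h4 : p.writesReg 4 = false)
    (ha : ∀ α < 10, p.writesArr α = false) : G.Tables s' where
  toBase := h.toBase.of_frame hF h2 h3 h4 (ha 0 (by omega)) (ha 1 (by omega)) (ha 2 (by omega))
  toInters := h.toInters.of_frame hF (ha 3 (by omega)) (ha 4 (by omega))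
  Z := by rw [hF.arr 6 (ha 6 (by omega))]; exact h.Z
  wide := by rw [hF.arr 7 (ha 7 (by omega))]; exact h.wide
  bucket := by rw [hF.arr 8 (ha 8 (by omega)), hF.arr 9 (ha 9 (by omega))]; exact h.bucket

theorem Coded.Tables.setReg (h : G.Tables s) {r v : ℕ} (h2 : r ≠ 2) (h3 : r ≠ 3) (h4 : r ≠ 4) :
    G.Tables (s.setReg r v) where
  n := by simp [h2.symm, h.n]
  k := by simp [h3.symm, h.k]
  σ := by simp [h4.symm, h.σ]
  code := h.code
  mem := h.mem
  pos := h.pos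
  card := h.card
  elem := h.elem
  Z := h.Z
  wide := h.wide
  bucket := h.bucket

/-! ### Visiting the classes that may contain a position -/

namespace Coded

open Classical in
/-- The number of classes that may contain `j`. -/
noncomputable def width (G : Coded) (j : ℕ) : ℕ := if G.Wide j then G.n else 1

/-- At most `k ^ 2` wide positions contribute `n`, all others `1`. This sum governs the cost of
rebuilding, of deletions and of tests. -/
theorem width_sum_le : ∑ j ∈ Finset.range G.n, G.width j ≤ G.n * (G.k ^ 2 + 1) := by
  classical
  have h : ∀ j ∈ Finset.range G.n, G.width j ≤ (if G.Wide j then G.n else 0) + 1 := by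
    intro j _
    unfold width
    split <;> omega
  refine (Finset.sum_le_sum h).trans ?_
  rw [Finset.sum_add_distrib, ← Finset.sum_filter, Finset.sum_const, Finset.sum_const,
    Finset.card_range, smul_eq_mul, smul_eq_mul, Nat.mul_one, Nat.mul_add, Nat.mul_one,
    Nat.mul_comm]
  exact Nat.add_le_add_right (Nat.mul_le_mul_left _ card_wide_le) _

end Coded

/-- Do `p` for all classes `κ`, in register `33`, that may contain the position in register `30`.
Array `11` holds the class of each position. -/
def eachClass (p : AProg) : AProg :=
  assign 31 (get 11 (reg 30) 0 0) ;;
  assign 32 (reg 31 + 1) ;;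
  branch (get 7 (reg 30) 0 0) (assign 31 0 ;; assign 32 (reg 2)) skip ;;
  forUp 33 (reg 31) 32 p

/-- In `J d a` the predicate `d` collects the classes already treated; it grows from the empty
predicate to `G.InRange cls j`. The body must be free of loop iterations, so the cost is just the
number of classes visited. -/
theorem eachClass_spec (hE : G.Input E) {Q : AState → Prop} (hs : G.Tables s) {j : ℕ} {cls : ℕ → ℕ}
    (hj : s.r 30 = j) (hcls : s.a 11 j 0 0 = cls j) (hlt : cls j < G.n)
    (h32 : p.writesReg 32 = false) (h33 : p.writesReg 33 = false)
    (J : (ℕ → Prop) → (ℕ → ℕ → ℕ → ℕ → ℕ) → Prop) (h0 : J (fun _ => False) s.a)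
    (hstep : ∀ κ d s', Frame (eachClass p) s s' → s'.r 33 = κ → κ < G.n → G.InRange cls j κ → ¬ d κ →
      J d s'.a → Total E p s' fun s'' => J (fun x => d x ∨ x = κ) s''.a ∧ s''.tk ≤ s'.tk)
    (hQ : ∀ s', Frame (eachClass p) s s' → J (G.InRange cls j) s'.a → s'.tk ≤ s.tk + G.width j →
      Q s') : Total E (eachClass p) s Q := by
  have hX := hE.X_eq
  have key : ∀ (s1 : AState) (L N : ℕ), (∀ r, r ≠ 31 → r ≠ 32 → s1.r r = s.r r) → s1.a = s.a →
      s1.tk = s.tk → s1.r 31 = L → s1.r 32 = N → L ≤ N → N ≤ G.n →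
      (∀ κ, G.InRange cls j κ ↔ L ≤ κ ∧ κ < N) → N - L ≤ G.width j →
      Total E (forUp 33 (reg 31) 32 p) s1 Q := by
    intro s1 L N hr ha ht h31 hh32 hLN hNn hin hw
    have hwr : ∀ r, (eachClass p).writesReg r = false → r ≠ 31 ∧ r ≠ 32 ∧
        (forUp 33 (reg 31) 32 p).writesReg r = false := by
      intro r h
      have h' : (¬r = 31 ∧ ¬r = 32 ∧ ¬r = 31 ∧ ¬r = 32 ∧
          (forUp 33 (reg 31) 32 p).writesReg r = false) := by
        simpa [eachClass, AProg.writesReg, and_assoc] using h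
      exact ⟨h'.1, h'.2.1, h'.2.2.2.2⟩
    have hwa : ∀ α, (eachClass p).writesArr α = false →
        (forUp 33 (reg 31) 32 p).writesArr α = false := by
      intro r h
      simpa [eachClass, AProg.writesArr] using h
    have hFr : ∀ s2, Frame (forUp 33 (reg 31) 32 p) s1 s2 → Frame (eachClass p) s s2 := by
      intro s2 hF
      refine ⟨fun r h => ?_, fun α h => ?_⟩
      · obtain ⟨h1, h2, h3⟩ := hwr r h
        rw [hF.reg r h3, hr r h1 h2]
      · rw [hF.arr α (hwa α h), ha]
    refine total_for L N (fun _ => 0) (fun κ s' => J (fun x => L ≤ x ∧ x < κ) s'.a) rfl h31 hh32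
      (by omega) hLN h33 h32 (by omega) ?_ ?_ ?_
    · simp only [AState.setReg_a, ha]
      convert h0 using 2
      exact ⟨fun h => by omega, False.elim⟩
    · rintro κ s2 hκ hκN hr2 hF hJ
      refine (hstep κ _ s2 (hFr s2 hF) hr2 (by omega) ((hin κ).2 ⟨hκ, hκN⟩) (by simp) hJ).mono ?_
      rintro s3 ⟨h3, h4⟩
      refine ⟨?_, h4⟩
      simp only [AState.tick_a, AState.setReg_a]
      convert h3 using 2
      omega
    · rintro s2 hF - hJ ht2
      refine hQ s2 (hFr s2 hF) ?_ ?_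
      · convert hJ using 2
        exact hin _
      · simp at ht2
        omega
  rw [eachClass]
  simp only [total_seq, total_assign, total_branch, total_skip, AExpr.val_get, AExpr.val_reg,
    AExpr.val_zero, AExpr.val_one, AExpr.val_add, simple_get, simple_reg, simple_zero, simple_add,
    AState.setReg_r, AState.setReg_a, if_true, hj, hcls, true_or, true_and, Bool.false_eq_true,
    false_or, if_neg (show (30 : ℕ) ≠ 31 by omega), if_neg (show (30 : ℕ) ≠ 32 by omega),
    if_neg (show (2 : ℕ) ≠ 31 by omega), if_neg (show (2 : ℕ) ≠ 32 by omega)]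
  refine ⟨by omega, fun hw => ?_, fun hw => ?_⟩
  · have hw' := (hs.wide j).1 hw
    refine key _ 0 G.n (fun r h1 h2 => by simp [h1, h2]) rfl rfl (by simp) (by simp [hs.n])
      (by omega) le_rfl (fun κ => ?_) (by simp [Coded.width, hw'])
    simp [Coded.InRange, hw']
  · have hw' : ¬ G.Wide j := fun h => (hs.wide j).2 h hw
    refine key _ (cls j) (cls j + 1) (fun r h1 h2 => by simp [h1, h2]) rfl rfl (by simp) (by simp)
      (by omega) hlt (fun κ => ?_) (by simp [Coded.width, hw'])
    simp only [Coded.InRange, hw']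
    constructor
    · rintro ⟨-, h⟩
      have := h not_false
      omega
    · exact fun h => ⟨fun h => h.elim, fun _ => by omega⟩

/-! ### Refining the classes at a non-solid position

Register `20` holds the new length, register `22` the position, register `23` its index among
the non-solid positions. Array `10` is nonzero for the positions without a candidate, array `11`
holds the classes, array `12` the new classes by old class and symbol, array `13` marks the
positions at which a class does not occur, and array `14` the new symbols. -/

/-- A new class is named after the first position found with the given old class and symbol. The
table stores this position plus one, so that `0` means "not yet met". It is also indexed by the new
length, which provides a fresh zero table for each refinement without any clearing. -/
def refineClass : AProg :=
  assign 26 (get 4 (reg 23) (reg 25) 0) ;;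
  store 14 (reg 24) 0 0 (reg 26) ;;
  assign 27 (get 11 (reg 24) 0 0) ;;
  branch (get 12 (reg 20) (reg 27) (reg 26)) skip
    (assign 28 (reg 24 + 1) ;; store 12 (reg 20) (reg 27) (reg 26) (reg 28)) ;;
  store 11 (reg 24) 0 0 (get 12 (reg 20) (reg 27) (reg 26) - 1)

def refineClasses : AProg :=
  forUp 24 0 2
    (branch (.bin .lt (get 6 (reg 24) 0 0) (reg 20)) skip
      (branch (get 10 (reg 24) 0 0) skip
        (assign 25 (reg 24 + reg 22) ;;
         assign 25 (get 0 (reg 25) 0 0) ;;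
         branch (.bin .eq (get 3 (reg 23) (reg 25) 0) 1) refineClass (store 10 (reg 24) 0 0 1))))

/-- Only wide positions need entries, which keeps the cost within the sum of the widths plus `n`.
The rows are filled for all positions with a candidate, whether or not they name a class. -/
def refineBad : AProg :=
  forUp 30 0 2
    (branch (get 7 (reg 30) 0 0)
      (branch (.bin .lt (get 6 (reg 30) 0 0) (reg 20)) skip
        (assign 25 (reg 30 + reg 22) ;;
         assign 25 (get 0 (reg 25) 0 0) ;;
         forUp 33 0 2
          (branch (.bin .lt (get 6 (reg 33) 0 0) (reg 20)) skip
            (branch (get 10 (reg 33) 0 0) skip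
              (branch (get 1 (reg 25) (get 14 (reg 33) 0 0) 0) skip
                (store 13 (reg 33) (reg 30) 0 1)))))) skip)

/-! ### Invariants of the reclassification by one symbol. -/

namespace Coded

/-- Position `i` has a candidate of length `q + 1`, given those of length `q`. -/
def Live (G : Coded) (ng : ℕ → ℕ) (q i : ℕ) : Prop :=
  q + 1 ≤ G.Z i ∧ ng i = 0 ∧ (G.S q ∩ G.S (i + q)).card = 1

/-- The positions below `b` are reclassified by the symbols at offset `q`; `sym` are these symbols
and `tab` is the table of the new classes. -/
structure Refining (G : Coded) (ng cls sym : ℕ → ℕ) (q b : ℕ) (ng' cls' sy : ℕ → ℕ)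
    (tab : ℕ → ℕ → ℕ) : Prop where
  ng_lt : ∀ x < b, q + 1 ≤ G.Z x → (ng' x = 0 ↔ ng x = 0 ∧ (G.S q ∩ G.S (x + q)).card = 1)
  ng_ge : ∀ x, b ≤ x → ng' x = ng x
  cls_ge : ∀ x, b ≤ x → cls' x = cls x
  cls_lt : ∀ x < G.n, cls' x < G.n
  sy_eq : ∀ x < b, G.Live ng q x → sy x = sym x
  tab_spec : ∀ κ c, tab κ c ≠ 0 → ∃ y < b, tab κ c = y + 1 ∧ G.Live ng q y ∧ cls y = κ ∧ sym y = c
  cls_spec : ∀ x < b, G.Live ng q x → cls' x + 1 = tab (cls x) (sym x)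

theorem Refining.skip {ng cls sym : ℕ → ℕ} {q b : ℕ} {ng' cls' sy : ℕ → ℕ} {tab : ℕ → ℕ → ℕ}
    (h : G.Refining ng cls sym q b ng' cls' sy tab) (hb : ¬ (q + 1 ≤ G.Z b ∧ ng b = 0)) :
    G.Refining ng cls sym q (b + 1) ng' cls' sy tab where
  ng_lt x hx hz := by
    rcases Nat.lt_succ_iff_lt_or_eq.1 hx with h1 | rfl
    · exact h.ng_lt x h1 hz
    · rw [h.ng_ge x le_rfl]
      exact ⟨fun h1 => absurd ⟨hz, h1⟩ hb, fun h1 => h1.1⟩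
  ng_ge x hx := h.ng_ge x (by omega)
  cls_ge x hx := h.cls_ge x (by omega)
  cls_lt := h.cls_lt
  sy_eq x hx hL := by
    rcases Nat.lt_succ_iff_lt_or_eq.1 hx with h1 | rfl
    exacts [h.sy_eq x h1 hL, absurd ⟨hL.1, hL.2.1⟩ hb]
  tab_spec κ c h1 := by
    obtain ⟨y, h2, h3⟩ := h.tab_spec κ c h1
    exact ⟨y, by omega, h3⟩
  cls_spec x hx hL := by
    rcases Nat.lt_succ_iff_lt_or_eq.1 hx with h1 | rfl
    exacts [h.cls_spec x h1 hL, absurd ⟨hL.1, hL.2.1⟩ hb]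

theorem Refining.drop {ng cls sym : ℕ → ℕ} {q b : ℕ} {ng' cls' sy : ℕ → ℕ} {tab : ℕ → ℕ → ℕ}
    (h : G.Refining ng cls sym q b ng' cls' sy tab) (hb : (G.S q ∩ G.S (b + q)).card ≠ 1) :
    G.Refining ng cls sym q (b + 1) (fun x => if x = b then 1 else ng' x) cls' sy tab where
  ng_lt x hx hz := by
    rcases Nat.lt_succ_iff_lt_or_eq.1 hx with h1 | rfl
    · rw [if_neg (by omega)]
      exact h.ng_lt x h1 hz
    · simp [hb]
  ng_ge x hx := by rw [if_neg (by omega)]; exact h.ng_ge x (by omega)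
  cls_ge x hx := h.cls_ge x (by omega)
  cls_lt := h.cls_lt
  sy_eq x hx hL := by
    rcases Nat.lt_succ_iff_lt_or_eq.1 hx with h1 | rfl
    exacts [h.sy_eq x h1 hL, absurd hL.2.2 hb]
  tab_spec κ c h1 := by
    obtain ⟨y, h2, h3⟩ := h.tab_spec κ c h1
    exact ⟨y, by omega, h3⟩
  cls_spec x hx hL := by
    rcases Nat.lt_succ_iff_lt_or_eq.1 hx with h1 | rfl
    exacts [h.cls_spec x h1 hL, absurd hL.2.2 hb]

/-- A table entry, once set, is never changed, so the names given to earlier positions persist. The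
update in place is safe because the positions from `b` on still carry their old classes. -/
theorem Refining.step {ng cls sym : ℕ → ℕ} {q b : ℕ} {ng' cls' sy : ℕ → ℕ} {tab tab' : ℕ → ℕ → ℕ}
    (h : G.Refining ng cls sym q b ng' cls' sy tab) (hbn : b < G.n) (hb : G.Live ng q b)
    (htab : ∀ κ c, tab' κ c = if κ = cls b ∧ c = sym b ∧ tab κ c = 0 then b + 1 else tab κ c) :
    G.Refining ng cls sym q (b + 1) ng'
      (fun x => if x = b then tab' (cls b) (sym b) - 1 else cls' x)
      (fun x => if x = b then sym b else sy x) tab' := by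
  have h1 : ∀ κ c, tab' κ c ≠ 0 → ∃ y < b + 1, tab' κ c = y + 1 ∧ G.Live ng q y ∧ cls y = κ ∧
      sym y = c := by
    intro κ c
    rw [htab]
    split
    · rename_i hc
      exact fun _ => ⟨b, by omega, rfl, hb, hc.1.symm, hc.2.1.symm⟩
    · intro h2
      obtain ⟨y, h3, h4⟩ := h.tab_spec κ c h2
      exact ⟨y, by omega, h4⟩
  have hne : tab' (cls b) (sym b) ≠ 0 := by
    rw [htab]
    split
    · omega
    · rename_i hc
      simpa using hc
  obtain ⟨y0, y1, y2, -⟩ := h1 _ _ hne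
  refine ⟨fun x hx hz => ?_, fun x hx => h.ng_ge x (by omega), fun x hx => ?_, fun x hx => ?_,
    fun x hx hL => ?_, h1, fun x hx hL => ?_⟩
  · rcases Nat.lt_succ_iff_lt_or_eq.1 hx with h2 | rfl
    · exact h.ng_lt x h2 hz
    · rw [h.ng_ge x le_rfl]
      exact ⟨fun h3 => ⟨h3, hb.2.2⟩, fun h3 => h3.1⟩
  · rw [if_neg (by omega)]; exact h.cls_ge x (by omega)
  · split
    · omega
    · exact h.cls_lt x hx
  · split
    · rename_i e; rw [e]
    · exact h.sy_eq x (by omega) hL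
  · split
    · rename_i e
      rw [e]
      omega
    · have h2 := h.cls_spec x (by omega) hL
      rw [h2, htab, if_neg]
      rintro ⟨-, -, h3⟩
      omega

/-- The flags for length `m` also describe length `q`, since the offsets between are solid; what
remains is the condition at offset `q`. -/
theorem Live.active {ng cls : ℕ → ℕ} {bad : ℕ → ℕ → ℕ} {m q i : ℕ} (h : G.Classes m ng cls bad)
    (hmq : m ≤ q) (hns : ∀ t, m ≤ t → t < q → ¬ G.NS t) (hi : i < G.n) :
    G.Live ng q i ↔ G.Active (q + 1) i := by
  constructor
  · rintro ⟨h1, h2, h3⟩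
    refine ⟨h1, fun t ht => ?_⟩
    rcases Nat.lt_succ_iff_lt_or_eq.1 ht with h4 | rfl
    · exact (((h.ng_iff i hi (by omega)).1 h2).extend hns (by omega)).2 t h4
    · exact h3
  · exact fun h1 => ⟨h1.1, (h.ng_iff i hi (by have := h1.1; omega)).2 (h1.mono (by omega)),
      h1.2 q (by omega)⟩

-- Two live positions get the same new name exactly if they share the old class and the symbol at
-- `q`, because the table is a function of this pair and each entry records a position having
-- exactly this pair.
open Classical in
theorem Refining.classes {ng cls sym : ℕ → ℕ} {m q : ℕ} {ng' cls' sy : ℕ → ℕ} {tab : ℕ → ℕ → ℕ}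
    {bad bad' : ℕ → ℕ → ℕ} (h : G.Refining ng cls sym q G.n ng' cls' sy tab)
    (hC : G.Classes m ng cls bad) (hmq : m ≤ q) (hns : ∀ t, m ≤ t → t < q → ¬ G.NS t)
    (hsym : ∀ i, G.Live ng q i → G.S q ∩ G.S (i + q) = {sym i})
    (hbad : ∀ κ j, bad' κ j = if G.Wide j ∧ q + 1 ≤ G.Z j ∧ j < G.n ∧ κ < G.n ∧ q + 1 ≤ G.Z κ ∧
      ng' κ = 0 ∧ sy κ ∉ G.S (j + q) then 1 else bad κ j) :
    G.Classes (q + 1) ng' cls' bad' := by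
  have hact {i : ℕ} (hi : i < G.n) := Live.active hC hmq hns hi
  refine hC.refine hmq hns (fun i hi hz => h.ng_lt i hi hz) h.cls_lt (fun i hi ha => ?_)
    (fun i hi i' hi' ha ha' e1 e2 => ?_) (fun κ hκ ha j hj hw hz => ?_) fun κ j hw => ?_
  · have hL := (hact hi).2 ha
    have h1 := h.cls_spec i hi hL
    obtain ⟨y, h2, h3, h4, h5, h6⟩ := h.tab_spec (cls i) (sym i) (by omega)
    obtain rfl : y = cls' i := by omega
    exact ⟨(hact h2).1 h4, h5, by rw [hsym _ h4, hsym _ hL, h6]⟩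
  · have hL := (hact hi).2 ha
    have hL' := (hact hi').2 ha'
    rw [hsym _ hL, hsym _ hL', Finset.singleton_inj] at e2
    have h1 := h.cls_spec i hi hL
    have h2 := h.cls_spec i' hi' hL'
    rw [e1, e2] at h1
    omega
  · have hL := (hact hκ).2 ha
    have hng := (h.ng_lt κ hκ hL.1).2 ⟨hL.2.1, hL.2.2⟩
    have hiff : (G.S q ∩ G.S (κ + q) ∩ G.S (j + q)).Nonempty ↔ sy κ ∈ G.S (j + q) := by
      rw [hsym _ hL, h.sy_eq κ hκ hL]
      constructor
      · rintro ⟨x, hx⟩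
        rw [Finset.mem_inter, Finset.mem_singleton] at hx
        exact hx.1 ▸ hx.2
      · exact fun hx => ⟨_, Finset.mem_inter.2 ⟨Finset.mem_singleton_self _, hx⟩⟩
    rw [hiff, hbad]
    split
    · rename_i hc
      simp [hc.2.2.2.2.2.2]
    · rename_i hc
      have : sy κ ∈ G.S (j + q) := by
        by_contra h2
        exact hc ⟨hw, hz, hj, hκ, hL.1, hng, h2⟩
      simp [this]
  · rw [hbad, if_neg (fun hc => hw hc.1)]
    exact hC.bad_zero _ _ hw

end Coded

theorem refineClasses_spec (hE : G.Input E) (hs : G.Tables s) {q : ℕ} (hq : G.NS q)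
    (h20 : s.r 20 = q + 1) (h22 : s.r 22 = q) (h23 : s.r 23 = G.code q - G.σ)
    (hlt : ∀ x < G.n, s.a 11 x 0 0 < G.n) (h0 : ∀ κ c, s.a 12 (q + 1) κ c = 0) :
    Total E refineClasses s fun s' => (∃ sym, (∀ i, G.Live (s.a 10 · 0 0) q i →
        G.S q ∩ G.S (i + q) = {sym i}) ∧
      G.Refining (s.a 10 · 0 0) (s.a 11 · 0 0) sym q G.n (s'.a 10 · 0 0) (s'.a 11 · 0 0)
        (s'.a 14 · 0 0) (s'.a 12 (q + 1))) ∧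
      (∀ m, m ≠ q + 1 → s'.a 12 m = s.a 12 m) ∧ s'.tk ≤ s.tk + G.n := by
  have hX := hE.X_eq
  obtain ⟨sym, hsym⟩ : ∃ sym : ℕ → ℕ, sym = fun i => s.a 4 (G.code q - G.σ) (G.code (i + q)) 0 :=
    ⟨_, rfl⟩
  have hsp : ∀ i, G.Live (s.a 10 · 0 0) q i → G.S q ∩ G.S (i + q) = {sym i} := by
    rintro i ⟨-, -, h1⟩
    obtain ⟨c, hc⟩ := Finset.card_eq_one.1 h1
    have hne : (G.S q ∩ G.S (i + q)).Nonempty := by simp [hc]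
    obtain ⟨x, hx⟩ := hne
    have h2 := hs.elem_S hq (G.lt_of_mem_S (Finset.mem_inter.1 hx).2) ⟨x, hx⟩
    rw [hc, Finset.mem_singleton] at h2
    rw [hc, hsym, ← h2]
  refine total_for 0 G.n (fun _ => 0) (fun b s' => G.Refining (s.a 10 · 0 0) (s.a 11 · 0 0) sym q b
    (s'.a 10 · 0 0) (s'.a 11 · 0 0) (s'.a 14 · 0 0) (s'.a 12 (q + 1)) ∧
    ∀ m, m ≠ q + 1 → s'.a 12 m = s.a 12 m) rfl rfl hs.n (by omega) (by omega) rfl rfl (by omega)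
    ?_ ?_ ?_
  · refine ⟨⟨fun _ _ => by omega, fun _ _ => rfl, fun _ _ => rfl, hlt, fun _ _ => by omega,
      fun κ c h => absurd (h0 κ c) h, fun _ _ => by omega⟩, fun _ _ => rfl⟩
  · rintro b s1 - hb hr hF ⟨h1, h2⟩
    have hs1 := hs.of_frame hF rfl rfl rfl (by decide)
    have f20 := (hF.reg 20 rfl).trans h20
    have f22 := (hF.reg 22 rfl).trans h22
    have f23 := (hF.reg 23 rfl).trans h23
    have e10 : s1.a 10 b 0 0 = s.a 10 b 0 0 := h1.ng_ge b le_rfl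
    have e11 : s1.a 11 b 0 0 = s.a 11 b 0 0 := h1.cls_ge b le_rfl
    simp only [total_branch, total_skip, AExpr.val_lt, AExpr.val_get, AExpr.val_reg,
      AExpr.val_zero, hr, f20, hs1.Z b hb, e10]
    refine ⟨fun h => ⟨⟨h1.skip fun hc => h ?_, h2⟩, le_rfl⟩, fun hz => ⟨fun h =>
      ⟨⟨h1.skip fun hc => h hc.2, h2⟩, le_rfl⟩, fun hng => ?_⟩⟩
    · rw [if_neg (by omega)]
    have hz : q + 1 ≤ G.Z b := by
      by_contra hc
      rw [if_pos (by omega)] at hz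
      omega
    have hbq : b + q < G.n := by have := G.add_Z_le hb.le; omega
    have ecard := hs1.card_S hq hbq
    have hsb : s1.a 4 (G.code q - G.σ) (G.code (b + q)) 0 = sym b := by rw [hsym, hF.arr 4 rfl]
    simp [hr, f22, f23, hs1.code _ hbq, ecard]
    refine ⟨by omega, fun hcard => ?_, fun hcard => ?_⟩
    · simp [refineClass, hr, f20, f23, hsb, e11]
      have hL : G.Live (s.a 10 · 0 0) q b := ⟨hz, hng, hcard⟩
      refine ⟨fun ht => ⟨?_, ?_⟩, fun ht => ⟨by omega, ?_, ?_⟩⟩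
      · have := h1.step (tab' := s1.a 12 (q + 1)) hb hL fun κ c => by
          rw [if_neg]
          rintro ⟨rfl, rfl, h⟩
          exact ht h
        exact this
      · exact h2
      · have := h1.step (tab' := fun x y => if x = s.a 11 b 0 0 ∧ y = sym b then b + 1 else
          s1.a 12 (q + 1) x y) hb hL fun κ c => by
          by_cases hc : κ = s.a 11 b 0 0 ∧ c = sym b
          · rw [if_pos hc, if_pos ⟨hc.1, hc.2, by rw [hc.1, hc.2]; exact ht⟩]
          · rw [if_neg hc, if_neg fun h => hc ⟨h.1, h.2.1⟩]
        simp only [Nat.add_sub_cancel, true_and, if_true] at this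
        convert this using 1
        funext x y
        simp
      · intro m hm
        funext x y
        simp [hm, h2 m hm]
    · exact ⟨h1.drop hcard, h2⟩
  · rintro s1 hF - ⟨h1, h2⟩ ht
    simp at ht
    exact ⟨⟨sym, hsp, h1⟩, h2, ht⟩

open Classical in
theorem refineBad_spec (hE : G.Input E) (hs : G.Tables s) {q : ℕ}
    (h20 : s.r 20 = q + 1) (h22 : s.r 22 = q)
    (hsy : ∀ κ < G.n, q + 1 ≤ G.Z κ → s.a 10 κ 0 0 = 0 → s.a 14 κ 0 0 < G.σ) :
    Total E refineBad s fun s' => (∀ κ j, s'.a 13 κ j 0 =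
      if G.Wide j ∧ q + 1 ≤ G.Z j ∧ j < G.n ∧ κ < G.n ∧ q + 1 ≤ G.Z κ ∧
        s.a 10 κ 0 0 = 0 ∧ s.a 14 κ 0 0 ∉ G.S (j + q) then 1 else s.a 13 κ j 0) ∧
      s'.tk ≤ s.tk + (∑ j ∈ Finset.range G.n, G.width j + G.n) := by
  have hX := hE.X_eq
  refine total_for 0 G.n (fun j => G.width j) (fun b s' => ∀ κ j, s'.a 13 κ j 0 =
      if G.Wide j ∧ q + 1 ≤ G.Z j ∧ j < b ∧ κ < G.n ∧ q + 1 ≤ G.Z κ ∧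
        s.a 10 κ 0 0 = 0 ∧ s.a 14 κ 0 0 ∉ G.S (j + q) then 1 else s.a 13 κ j 0)
    rfl rfl hs.n (by omega) (by omega) rfl rfl (by omega) ?_ ?_ ?_
  · simp
  · rintro b s1 - hb hr hF h1
    have hs1 := hs.of_frame hF rfl rfl rfl (by decide)
    have f20 := (hF.reg 20 rfl).trans h20
    have f22 := (hF.reg 22 rfl).trans h22
    have g10 := hF.arr 10 rfl
    have g14 := hF.arr 14 rfl
    have hno : ¬ (G.Wide b ∧ q + 1 ≤ G.Z b) → ∀ κ j, s1.a 13 κ j 0 =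
        if G.Wide j ∧ q + 1 ≤ G.Z j ∧ j < b + 1 ∧ κ < G.n ∧ q + 1 ≤ G.Z κ ∧
        s.a 10 κ 0 0 = 0 ∧ s.a 14 κ 0 0 ∉ G.S (j + q) then 1 else s.a 13 κ j 0 := by
      intro h κ j
      rw [h1]
      congr 1
      refine propext (and_congr_right fun hw => and_congr_right fun hz => and_congr_left fun _ => ?_)
      have : j ≠ b := fun e => h ⟨e ▸ hw, e ▸ hz⟩
      omega
    simp only [total_branch, total_skip, AExpr.val_lt, AExpr.val_get, AExpr.val_reg,
      AExpr.val_zero, hr, f20, hs1.Z b hb]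
    refine ⟨fun hw => ⟨fun h => ⟨hno fun hc => h ?_, by omega⟩, fun hz => ?_⟩, fun hw =>
      ⟨hno fun hc => (hs1.wide b).2 hc.1 hw, by omega⟩⟩
    · rw [if_neg (by omega)]
    replace hw := (hs1.wide b).1 hw
    replace hz : q + 1 ≤ G.Z b := by
      by_contra hc
      rw [if_pos (by omega)] at hz
      omega
    have hbq : b + q < G.n := by have := G.add_Z_le hb.le; omega
    simp only [total_seq, total_assign, AExpr.val_add, AExpr.val_reg, AExpr.val_get, AExpr.val_zero,
      hr, f22, AState.setReg_r, AState.setReg_a, if_true, hs1.code _ hbq, simple_get, true_or,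
      true_and]
    refine ⟨.inr (by omega), ?_⟩
    refine total_for 0 G.n (fun _ => 0) (fun c s' => ∀ κ j, s'.a 13 κ j 0 =
      if G.Wide j ∧ q + 1 ≤ G.Z j ∧ (j < b ∨ j = b ∧ κ < c) ∧ κ < G.n ∧ q + 1 ≤ G.Z κ ∧
        s.a 10 κ 0 0 = 0 ∧ s.a 14 κ 0 0 ∉ G.S (j + q) then 1 else s.a 13 κ j 0)
      rfl rfl (by simp [hs1.n]) (by omega) (by omega) rfl rfl (by omega) ?_ ?_ ?_
    · simpa using h1
    · rintro c s2 - hc hr2 hF2 h2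
      have hs2 := ((hs1.setReg (r := 25) (v := b + q) (by omega) (by omega) (by omega)).setReg (r := 25)
        (v := G.code (b + q)) (by omega) (by omega) (by omega)).of_frame hF2 rfl rfl rfl (by decide)
      have k20 := hF2.reg 20 rfl
      have k25 := hF2.reg 25 rfl
      have k30 := hF2.reg 30 rfl
      have k10 := (hF2.arr 10 rfl).trans g10
      have k14 := (hF2.arr 14 rfl).trans g14
      simp [f20, hr] at k20 k25 k30
      have hcode := G.code_lt _ hbq
      have hS := G.S_of_lt hbq
      have hno : ¬ (q + 1 ≤ G.Z c ∧ s.a 10 c 0 0 = 0 ∧ s.a 14 c 0 0 ∉ G.S (b + q)) → ∀ κ j,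
          s2.a 13 κ j 0 =
          if G.Wide j ∧ q + 1 ≤ G.Z j ∧ (j < b ∨ j = b ∧ κ < c + 1) ∧ κ < G.n ∧ q + 1 ≤ G.Z κ ∧
          s.a 10 κ 0 0 = 0 ∧ s.a 14 κ 0 0 ∉ G.S (j + q) then 1 else s.a 13 κ j 0 := by
        intro h κ j
        rw [h2]
        congr 1
        refine propext (and_congr_right fun hw => and_congr_right fun hz => and_congr_left fun hR => ?_)
        have : ¬ (j = b ∧ κ = c) := by
          rintro ⟨rfl, rfl⟩
          exact h hR.2
        omega
      simp only [total_branch, total_skip, AExpr.val_lt, AExpr.val_get, AExpr.val_reg,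
        AExpr.val_zero, hr2, k20, k25, hs2.Z c hc, k10, k14]
      refine ⟨fun h => ⟨hno fun h3 => h ?_, by omega⟩, fun hz2 => ⟨fun hng =>
        ⟨hno fun h3 => hng h3.2.1, by omega⟩, fun hng => ?_⟩⟩
      · rw [if_neg (by omega)]
      replace hz2 : q + 1 ≤ G.Z c := by
        by_contra h3
        rw [if_pos (by omega)] at hz2
        omega
      rw [hs2.mem _ hcode _ (hsy c hc hz2 hng), ← hS]
      refine ⟨fun h => ⟨hno fun h3 => h (if_neg h3.2.2), by omega⟩, fun h => ?_⟩
      have hmem : s.a 14 c 0 0 ∉ G.S (b + q) := fun h3 => by rw [if_pos h3] at h; omega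
      simp [hr2, k30]
      intro κ j
      by_cases hkj : κ = c ∧ j = b
      · obtain ⟨rfl, rfl⟩ := hkj
        rw [if_pos ⟨rfl, rfl⟩, if_pos ⟨hw, hz, by omega, hc, hz2, hng, hmem⟩]
      · rw [if_neg hkj, h2]
        congr 1
        refine propext (and_congr_right fun hw => and_congr_right fun hz => and_congr_left fun hR => ?_)
        omega
    · rintro s2 - - h2 ht
      simp at ht
      refine ⟨fun κ j => ?_, by simp [Coded.width, hw]; omega⟩
      simp only [AState.tick_a, AState.setReg_a]
      rw [h2]
      congr 1
      refine propext (and_congr_right fun hw => and_congr_right fun hz => ?_)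
      constructor
      · rintro ⟨h3, h4⟩
        exact ⟨by omega, h4⟩
      · rintro ⟨h3, h4⟩
        exact ⟨by omega, h4⟩
  · rintro s1 - - h1 ht
    simp [Finset.sum_add_distrib] at ht
    exact ⟨h1, by simpa using ht⟩

variable {E : Env} {G : Coded} {s s' : AState} {p : AProg}

namespace Coded

/-- The classification that is stored in the arrays `10`, `11` and `13`. -/
abbrev Classified (G : Coded) (m : ℕ) (a : ℕ → ℕ → ℕ → ℕ → ℕ) : Prop :=
  G.Classes m (a 10 · 0 0) (a 11 · 0 0) (fun κ j => a 13 κ j 0)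

/-- Membership in the list of a class, with respect to the arrays. -/
abbrev In (G : Coded) (a : ℕ → ℕ → ℕ → ℕ → ℕ) (m κ : ℕ) : ℕ → Prop :=
  G.Member (a 11 · 0 0) (fun κ j => a 13 κ j 0) m κ

/-- The list under construction of the class `κ`, in the arrays `17` to `20`. -/
def Links (G : Coded) (a : ℕ → ℕ → ℕ → ℕ → ℕ) (A : ℕ → Prop) (κ b : ℕ) : Prop :=
  Linking G.n A (a 17 κ · 0) (a 18 κ · 0) (a 19 κ 0 0) (a 20 κ 0 0) b

/-- The list of the class `κ`, in the arrays `17` to `19`. -/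
def ClassLinked (G : Coded) (a : ℕ → ℕ → ℕ → ℕ → ℕ) (A : ℕ → Prop) (κ : ℕ) : Prop :=
  Linked G.n A (a 17 κ · 0) (a 18 κ · 0) (a 19 κ 0 0)

/-- The longest matches of the classes, in the arrays `15` and `16`. -/
abbrev Bests (G : Coded) (m : ℕ) (a : ℕ → ℕ → ℕ → ℕ → ℕ) : Prop :=
  G.Best m (a 11 · 0 0) (a 15 · 0 0) (a 16 · 0 0)

variable {a a' : ℕ → ℕ → ℕ → ℕ → ℕ} {A A' : ℕ → Prop} {κ b : ℕ}

theorem Links.congr (h : G.Links a A κ b) (ha : ∀ α, a' α κ = a α κ) : G.Links a' A κ b := by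
  unfold Links
  rw [ha 17, ha 18, ha 19, ha 20]
  exact h

theorem ClassLinked.congr (h : G.ClassLinked a A κ) (ha : ∀ α, a' α κ = a α κ) : G.ClassLinked a' A κ := by
  unfold ClassLinked
  rw [ha 17, ha 18, ha 19]
  exact h

end Coded

def refinement : AProg := refineClasses ;; refineBad

theorem refinement_spec (hE : G.Input E) (hs : G.Tables s) {m q : ℕ} (hq : G.NS q)
    (h20 : s.r 20 = q + 1) (h22 : s.r 22 = q) (h23 : s.r 23 = G.code q - G.σ)
    (hC : G.Classified m s.a) (hmq : m ≤ q) (hns : ∀ t, m ≤ t → t < q → ¬ G.NS t)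
    (h0 : ∀ κ c, s.a 12 (q + 1) κ c = 0) :
    Total E refinement s fun s' => G.Classified (q + 1) s'.a ∧
      (∀ m, m ≠ q + 1 → s'.a 12 m = s.a 12 m) ∧
      s'.tk ≤ s.tk + (∑ j ∈ Finset.range G.n, G.width j + 2 * G.n) := by
  rw [refinement, total_seq]
  refine (refineClasses_spec hE hs hq h20 h22 h23 hC.cls_lt h0).use fun s1 hF1
    ⟨⟨sym, h1, h2⟩, h3, t1⟩ => ?_
  have hs1 := hs.of_frame hF1 rfl rfl rfl (by decide)
  have e20 := (hF1.reg 20 rfl).trans h20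
  have e22 := (hF1.reg 22 rfl).trans h22
  have e13 := hF1.arr 13 rfl
  refine (refineBad_spec hE hs1 e20 e22 fun κ hκ hz hng => ?_).use fun s2 hF2 ⟨h4, t2⟩ => ?_
  · have hL : G.Live (s.a 10 · 0 0) q κ := ⟨hz, (h2.ng_lt κ hκ hz).1 hng⟩
    have h5 : sym κ ∈ G.S q ∩ G.S (κ + q) := by rw [h1 κ hL]; simp
    have h6 := h2.sy_eq κ hκ hL
    have h7 := (Finset.mem_inter.1 h5).1
    rw [G.S_of_lt hq.1] at h7
    have h8 := G.sets_sub _ (G.code_lt q hq.1) h7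
    rw [h6]
    simpa using h8
  · have h5 := h2.classes hC hmq hns h1 (bad' := fun κ j => s2.a 13 κ j 0) fun κ j => by
      rw [h4, e13]
    refine ⟨?_, fun m hm => by rw [hF2.arr 12 rfl, h3 m hm], by omega⟩
    unfold Coded.Classified
    rw [hF2.arr 10 rfl, hF2.arr 11 rfl]
    exact h5

/-! ### The lists of the classes -/

/-- Append the position in register `30` to the list of the class in register `33`. -/
def appendLink : AProg :=
  assign 34 (get 20 (reg 33) 0 0) ;;
  store 18 (reg 33) (reg 34) 0 (reg 30) ;;
  store 17 (reg 33) (reg 30) 0 (reg 34) ;;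
  assign 35 (reg 30 - reg 34) ;;
  branch (.bin .lt (get 19 (reg 33) 0 0) (reg 35)) (store 19 (reg 33) 0 0 (reg 35)) skip ;;
  store 20 (reg 33) 0 0 (reg 30)

/-- Delete the position in register `30` from the list of the class in register `33`. -/
def deleteLink : AProg :=
  assign 34 (get 17 (reg 33) (reg 30) 0) ;;
  assign 35 (get 18 (reg 33) (reg 30) 0) ;;
  store 18 (reg 33) (reg 34) 0 (reg 35) ;;
  store 17 (reg 33) (reg 35) 0 (reg 34) ;;
  assign 36 (reg 35 - reg 34) ;;
  branch (.bin .lt (get 19 (reg 33) 0 0) (reg 36)) (store 19 (reg 33) 0 0 (reg 36)) skip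

theorem appendLink_spec {A : ℕ → Prop} {κ b : ℕ} (hκ : s.r 33 = κ) (hb : s.r 30 = b)
    (h : G.Links s.a A κ b) (hA : A b) (hbn : b ≤ G.n) : Total E appendLink s fun s' =>
      G.Links s'.a A κ (b + 1) ∧ (∀ α κ', κ' ≠ κ → s'.a α κ' = s.a α κ') ∧ s'.tk = s.tk := by
  simp [appendLink, hκ, hb]
  have key : ∀ a' : ℕ → ℕ → ℕ → ℕ → ℕ, (∀ j, a' 18 κ j 0 = if j = s.a 20 κ 0 0 then b else s.a 18 κ j 0) →
      (∀ j, a' 17 κ j 0 = if j = b then s.a 20 κ 0 0 else s.a 17 κ j 0) →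
      a' 19 κ 0 0 = max (s.a 19 κ 0 0) (b - s.a 20 κ 0 0) → a' 20 κ 0 0 = b →
      G.Links a' A κ (b + 1) := by
    intro a' h18 h17 h19 h20
    unfold Coded.Links
    rw [h20]
    exact Linking.append h hA hbn (fun j hj => by rw [h18, if_neg hj]) (by rw [h18, if_pos rfl])
      (fun j hj => by rw [h17, if_neg hj]) (by rw [h17, if_pos rfl]) h19
  refine ⟨fun hlt => ⟨key _ ?_ ?_ ?_ ?_, ?_⟩, fun hlt => ⟨key _ ?_ ?_ ?_ ?_, ?_⟩⟩
  · simp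
  · simp
  · simp; omega
  · simp
  · intro α κ' hne
    funext y z
    simp [hne]
  · simp
  · simp
  · simp; omega
  · simp
  · intro α κ' hne
    funext y z
    simp [hne]

theorem deleteLink_spec {A A' : ℕ → Prop} {κ d : ℕ} (hκ : s.r 33 = κ) (hb : s.r 30 = d)
    (h : G.ClassLinked s.a A κ) (h0 : 0 < d) (hdn : d < G.n) (hd : A d)
    (hA : ∀ j, A' j ↔ A j ∧ j ≠ d) : Total E deleteLink s fun s' =>
      G.ClassLinked s'.a A' κ ∧ (∀ α κ', κ' ≠ κ → s'.a α κ' = s.a α κ') ∧ s'.tk = s.tk := by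
  simp [deleteLink, hκ, hb]
  have key : ∀ a' : ℕ → ℕ → ℕ → ℕ → ℕ, (∀ j, a' 18 κ j 0 = if j = s.a 17 κ d 0 then s.a 18 κ d 0 else s.a 18 κ j 0) →
      (∀ j, a' 17 κ j 0 = if j = s.a 18 κ d 0 then s.a 17 κ d 0 else s.a 17 κ j 0) →
      a' 19 κ 0 0 = max (s.a 19 κ 0 0) (s.a 18 κ d 0 - s.a 17 κ d 0) → G.ClassLinked a' A' κ := by
    intro a' h18 h17 h19
    exact Linked.delete h h0 hdn hd hA (fun j hj => by rw [h18, if_neg hj]) (by rw [h18, if_pos rfl])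
      (fun j hj => by rw [h17, if_neg hj]) (by rw [h17, if_pos rfl]) h19
  refine ⟨fun hlt => ⟨key _ ?_ ?_ ?_, ?_⟩, fun hlt => ⟨key _ ?_ ?_ ?_, ?_⟩⟩
  · simp
  · simp
  · simp; omega
  · intro α κ' hne
    funext y z
    simp [hne]
  · simp
  · simp
  · simp; omega
  · intro α κ' hne
    funext y z
    simp [hne]

/-- Stale links and stale representatives may remain: a list under construction constrains only the
links of elements already appended, and a representative is consulted only when the recorded length
is positive. -/
def clearClasses : AProg :=
  forUp 24 0 2 (store 15 (reg 24) 0 0 0 ;; store 19 (reg 24) 0 0 0 ;; store 20 (reg 24) 0 0 0)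

def longestOfClasses : AProg :=
  forUp 24 0 2
    (branch (get 10 (reg 24) 0 0) skip
      (branch (.bin .lt (get 6 (reg 24) 0 0) (reg 20)) skip
        (assign 25 (get 11 (reg 24) 0 0) ;;
         branch (.bin .lt (get 15 (reg 25) 0 0) (get 6 (reg 24) 0 0))
          (store 15 (reg 25) 0 0 (get 6 (reg 24) 0 0) ;; store 16 (reg 25) 0 0 (reg 24)) skip)))

/-- Position `0` is the initial last element of every list, hence the start at `1`; the sentinel `n`
is appended to all lists at the end. Scanning positions in increasing order keeps the lists sorted.
-/
def linkClasses : AProg :=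
  assign 29 1 ;;
  forUp 30 (reg 29) 2
    (branch (.bin .lt (get 6 (reg 30) 0 0) (reg 20)) skip
      (eachClass (branch (get 13 (reg 33) (reg 30) 0) skip appendLink))) ;;
  assign 30 (reg 2) ;;
  forUp 33 0 2 appendLink

/-- Compute the lists of all classes, for the length in register `20`. -/
def buildLists : AProg := clearClasses ;; longestOfClasses ;; linkClasses

/-! ### Correctness and cost of rebuilding the lists. -/

theorem clearClasses_spec (hE : G.Input E) (hs : G.Tables s) : Total E clearClasses s fun s' =>
    (∀ κ < G.n, s'.a 15 κ 0 0 = 0 ∧ s'.a 19 κ 0 0 = 0 ∧ s'.a 20 κ 0 0 = 0) ∧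
      s'.tk ≤ s.tk + G.n := by
  have hX := hE.X_eq
  refine total_for 0 G.n (fun _ => 0) (fun b s' => ∀ κ < b,
    s'.a 15 κ 0 0 = 0 ∧ s'.a 19 κ 0 0 = 0 ∧ s'.a 20 κ 0 0 = 0) rfl rfl hs.n (by omega) (by omega)
    rfl rfl (by omega) (by omega) ?_ ?_
  · rintro b s1 - hb hr hF h1
    simp [hr]
    intro κ hκ
    by_cases e : κ = b
    · simp [e]
    · simpa [e] using h1 κ (by omega)
  · rintro s1 - - h1 ht
    exact ⟨h1, by simpa using ht⟩

theorem longestOfClasses_spec (hE : G.Input E) (hs : G.Tables s) {m : ℕ} (h20 : s.r 20 = m)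
    (hC : G.Classified m s.a) (h0 : ∀ κ < G.n, s.a 15 κ 0 0 = 0) :
    Total E longestOfClasses s fun s' => G.Bests m s'.a ∧ s'.tk ≤ s.tk + G.n := by
  have hX := hE.X_eq
  refine total_for 0 G.n (fun _ => 0) (fun b s' =>
    (∀ i < b, G.Active m i → G.Z i ≤ s'.a 15 (s.a 11 i 0 0) 0 0) ∧
    ∀ κ < G.n, 0 < s'.a 15 κ 0 0 → s'.a 16 κ 0 0 < G.n ∧ G.Z (s'.a 16 κ 0 0) = s'.a 15 κ 0 0 ∧
      G.Active m (s'.a 16 κ 0 0) ∧ s.a 11 (s'.a 16 κ 0 0) 0 0 = κ) rfl rfl hs.n (by omega) (by omega)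
    rfl rfl (by omega) ⟨by omega, fun κ hκ h => ?_⟩ ?_ ?_
  · simp [h0 κ hκ] at h
  · rintro b s1 - hb hr hF ⟨h1, h2⟩
    have hs1 := hs.of_frame hF rfl rfl rfl (by decide)
    have f20 := (hF.reg 20 rfl).trans h20
    have f10 := hF.arr 10 rfl
    have f11 := hF.arr 11 rfl
    have hc := hC.cls_lt b hb
    have hno : (G.Active m b → G.Z b ≤ s1.a 15 (s.a 11 b 0 0) 0 0) →
        ∀ i < b + 1, G.Active m i → G.Z i ≤ s1.a 15 (s.a 11 i 0 0) 0 0 := by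
      intro h i hi ha
      rcases Nat.lt_succ_iff_lt_or_eq.1 hi with h3 | rfl
      exacts [h1 i h3 ha, h ha]
    simp only [total_branch, total_skip, AExpr.val_lt, AExpr.val_get, AExpr.val_reg,
      AExpr.val_zero, hr, f20, hs1.Z b hb, f10]
    refine ⟨fun hng => ⟨⟨hno fun ha => ?_, h2⟩, le_rfl⟩, fun hng => ⟨fun hz =>
      ⟨⟨hno fun ha => ?_, h2⟩, le_rfl⟩, fun hz => ?_⟩⟩
    · exact absurd ((hC.ng_iff b hb ha.1).2 ha) hng
    · have := ha.1
      rw [if_neg (by omega)] at hz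
      omega
    · replace hz : m ≤ G.Z b := by
        by_contra h
        rw [if_pos (by omega)] at hz
        omega
      have ha := (hC.ng_iff b hb hz).1 hng
      simp [hr, f11, hs1.Z b hb]
      refine ⟨fun hlt => ⟨fun i hi hai => ?_, fun κ hκ => ?_⟩, fun hlt => ⟨fun i hi => hno (fun _ => hlt) i (by omega), h2⟩⟩
      · rcases Nat.lt_succ_iff_lt_or_eq.1 (Nat.lt_succ_of_le hi) with h3 | rfl
        · have := h1 i h3 hai
          split
          · rename_i e
            rw [e] at this
            omega
          · exact this
        · simp
      · by_cases e : κ = s.a 11 b 0 0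
        · simp [e, hb, ha]
        · simpa [e] using h2 κ hκ
  · rintro s1 hF - ⟨h1, h2⟩ ht
    refine ⟨?_, by simpa using ht⟩
    unfold Coded.Bests
    rw [hF.arr 11 rfl]
    exact ⟨h1, h2⟩

theorem linkClasses_spec (hE : G.Input E) (hs : G.Tables s) {m : ℕ} (h20 : s.r 20 = m)
    (hC : G.Classified m s.a) (h19 : ∀ κ < G.n, s.a 19 κ 0 0 = 0)
    (hh20 : ∀ κ < G.n, s.a 20 κ 0 0 = 0) : Total E linkClasses s fun s' =>
      (∀ κ < G.n, G.ClassLinked s'.a (G.In s.a m κ) κ) ∧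
      s'.tk ≤ s.tk + (∑ j ∈ Finset.range G.n, G.width j + 2 * G.n) := by
  have hX := hE.X_eq
  have hn := Coded.n_pos (G := G)
  have hs0 : G.Tables (s.setReg 29 1) := hs.setReg (by omega) (by omega) (by omega)
  simp only [linkClasses, total_seq, total_assign, AExpr.val_one, simple_one, true_or, true_and]
  refine total_for 1 G.n (fun j => G.width j) (fun b s' => ∀ κ < G.n,
    G.Links s'.a (G.In s.a m κ) κ b) rfl (by simp) hs0.n (by omega) (by omega)
    rfl rfl (by omega) ?_ ?_ ?_
  · intro κ hκ
    unfold Coded.Links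
    simp only [AState.setReg_a, h19 κ hκ, hh20 κ hκ]
    exact Linking.start (.inl rfl)
  · rintro b s1 hb0 hb hr hF h1
    have hs1 := hs0.of_frame hF rfl rfl rfl (by decide)
    have f20 := (hF.reg 20 rfl).trans h20
    have f11 := hF.arr 11 rfl
    have f13 := hF.arr 13 rfl
    simp only [total_branch, total_skip, AExpr.val_lt, AExpr.val_get, AExpr.val_reg,
      AExpr.val_zero, hr, f20, hs1.Z b hb]
    refine ⟨fun hz => ⟨fun κ hκ => ?_, by omega⟩, fun hz => ?_⟩
    · refine Linking.pass (h1 κ hκ) ?_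
      rintro (h | h | h)
      · omega
      · omega
      · rw [if_neg (by omega)] at hz
        omega
    replace hz : m ≤ G.Z b := by
      by_contra h
      rw [if_pos (by omega)] at hz
      omega
    have hmem : ∀ κ, G.In s.a m κ b ↔ G.InRange (s.a 11 · 0 0) b κ ∧ s.a 13 κ b 0 = 0 := by
      intro κ
      constructor
      · rintro (h | h | h)
        · omega
        · omega
        · exact ⟨h.2.2.1, h.2.2.2.1⟩
      · exact fun h => .inr (.inr ⟨hb0, hb, h.1, h.2, hz⟩)
    refine eachClass_spec (cls := (s.a 11 · 0 0)) hE hs1 hr (by rw [f11]; rfl) (hC.cls_lt b hb) rfl rfl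
      (fun d a => a 13 = s.a 13 ∧ ∀ κ < G.n, (d κ → G.Links a (G.In s.a m κ) κ (b + 1)) ∧
        (¬ d κ → G.Links a (G.In s.a m κ) κ b))
      ⟨f13, fun κ hκ => ⟨False.elim, fun _ => h1 κ hκ⟩⟩ ?_ ?_
    · rintro κ d s2 hF2 hr2 hκ hin hd ⟨g13, h2⟩
      have k30 := (hF2.reg 30 rfl).trans hr
      rw [total_branch]
      simp only [AExpr.val_get, AExpr.val_reg, AExpr.val_zero, hr2, k30, g13]
      refine ⟨fun hbad => ?_, fun hbad => ?_⟩
      · rw [total_skip]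
        refine ⟨⟨g13, fun κ' hκ' => ⟨fun h => ?_, fun h => (h2 κ' hκ').2 fun h3 => h (.inl h3)⟩⟩, le_rfl⟩
        rcases h with h | rfl
        · exact (h2 κ' hκ').1 h
        · exact Linking.pass ((h2 _ hκ).2 hd) fun h => hbad ((hmem _).1 h).2
      · refine (appendLink_spec hr2 k30 ((h2 κ hκ).2 hd) ((hmem κ).2 ⟨hin, hbad⟩) hb.le).use
          fun s3 hF3 ⟨h3, h4, h5⟩ => ?_
        refine ⟨⟨(hF3.arr 13 rfl).trans g13, fun κ' hκ' => ?_⟩, h5.le⟩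
        by_cases e : κ' = κ
        · subst e
          exact ⟨fun _ => h3, fun h => absurd (.inr rfl) h⟩
        · refine ⟨fun h => ?_, fun h => ?_⟩
          · exact ((h2 κ' hκ').1 (h.resolve_right e)).congr fun α => h4 α κ' e
          · exact ((h2 κ' hκ').2 fun h3 => h (.inl h3)).congr fun α => h4 α κ' e
    · rintro s2 hF2 ⟨-, h2⟩ ht2
      refine ⟨fun κ hκ => ?_, by simpa using ht2⟩
      by_cases hin : G.InRange (s.a 11 · 0 0) b κ
      · exact (h2 κ hκ).1 hin
      · exact Linking.pass ((h2 κ hκ).2 hin) fun h => hin ((hmem κ).1 h).1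
  · rintro s1 hF - h1 ht1
    have hs1 := hs0.of_frame hF rfl rfl rfl (by decide)
    simp only [AExpr.val_reg, simple_reg, true_or, true_and, hs1.n]
    refine total_for 0 G.n (fun _ => 0) (fun c s' => ∀ κ < G.n,
      (κ < c → G.Links s'.a (G.In s.a m κ) κ (G.n + 1)) ∧
      (c ≤ κ → G.Links s'.a (G.In s.a m κ) κ G.n)) rfl rfl (by simp [hs1.n]) (by omega) (by omega)
      rfl rfl (by omega) ?_ ?_ ?_
    · exact fun κ hκ => ⟨by omega, fun _ => h1 κ hκ⟩
    · rintro c s2 - hc hr2 hF2 h2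
      have k30 := hF2.reg 30 rfl
      simp at k30
      refine (appendLink_spec hr2 k30 ((h2 c hc).2 le_rfl) (.inr (.inl rfl)) le_rfl).mono
        fun s3 ⟨h3, h4, h5⟩ => ?_
      refine ⟨fun κ' hκ' => ?_, h5.le⟩
      by_cases e : κ' = c
      · subst e
        exact ⟨fun _ => h3, by omega⟩
      · refine ⟨fun h => ?_, fun h => ?_⟩
        · exact ((h2 κ' hκ').1 (by omega)).congr fun α => h4 α κ' e
        · exact ((h2 κ' hκ').2 (by omega)).congr fun α => h4 α κ' e
    · rintro s2 hF2 - h2 ht2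
      have hsum := Finset.sum_le_sum_of_subset (f := fun j => G.width j + 1)
        (show Finset.Ico 1 G.n ⊆ Finset.range G.n by intro x; simp)
      simp [Finset.sum_add_distrib] at hsum ht1 ht2
      refine ⟨fun κ hκ => ?_, by omega⟩
      have h3 := (h2 κ hκ).1 hκ
      -- The sentinel `n` belongs to every list, so the last element below `n + 1` is `n` itself.
      have h4 : s2.a 20 κ 0 0 = G.n := by
        have h5 := Linking.last_lt h3
        by_contra h6
        exact Linking.last_max h3 G.n (by omega) (by omega) (.inr (.inl rfl))
      unfold Coded.Links at h3
      rw [h4] at h3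
      exact h3.linked

theorem buildLists_spec (hE : G.Input E) (hs : G.Tables s) {m : ℕ} (h20 : s.r 20 = m)
    (hC : G.Classified m s.a) : Total E buildLists s fun s' => G.Bests m s'.a ∧
      (∀ κ < G.n, G.ClassLinked s'.a (G.In s'.a m κ) κ) ∧
      s'.tk ≤ s.tk + (∑ j ∈ Finset.range G.n, G.width j + 4 * G.n) := by
  simp only [buildLists, total_seq]
  refine (clearClasses_spec hE hs).use fun s1 F1 ⟨h1, t1⟩ => ?_
  have hs1 := hs.of_frame F1 rfl rfl rfl (by decide)
  have hC1 : G.Classified m s1.a := by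
    unfold Coded.Classified
    rw [F1.arr 10 rfl, F1.arr 11 rfl, F1.arr 13 rfl]
    exact hC
  have e1 := (F1.reg 20 rfl).trans h20
  refine (longestOfClasses_spec hE hs1 e1 hC1 fun κ hκ => (h1 κ hκ).1).use fun s2 F2 ⟨h2, t2⟩ => ?_
  have hs2 := hs1.of_frame F2 rfl rfl rfl (by decide)
  have hC2 : G.Classified m s2.a := by
    unfold Coded.Classified
    rw [F2.arr 10 rfl, F2.arr 11 rfl, F2.arr 13 rfl]
    exact hC1
  have e2 := (F2.reg 20 rfl).trans e1
  refine (linkClasses_spec hE hs2 e2 hC2 (fun κ hκ => by rw [F2.arr 19 rfl]; exact (h1 κ hκ).2.1)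
    fun κ hκ => by rw [F2.arr 20 rfl]; exact (h1 κ hκ).2.2).use fun s3 F3 ⟨h3, t3⟩ => ?_
  refine ⟨?_, ?_, by omega⟩
  · unfold Coded.Bests
    rw [F3.arr 11 rfl, F3.arr 15 rfl, F3.arr 16 rfl]
    exact h2
  · unfold Coded.In
    rw [F3.arr 11 rfl, F3.arr 13 rfl]
    exact h3

variable {E : Env} {G : Coded} {s s' : AState} {p : AProg}

/-! ### The search -/

/-- Delete the positions at which the longest match has the length in register `22`. -/
def deleteMatches : AProg :=
  assign 29 (get 8 (reg 22) 0 0) ;;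
  forUp 24 0 29
    (assign 30 (get 9 (reg 22) (reg 24) 0) ;;
     eachClass (branch (get 13 (reg 33) (reg 30) 0) skip deleteLink))

/-- Look for a cover whose length is in register `20`; array `21` receives the result. -/
def testLength : AProg :=
  assign 30 (reg 2 - reg 20) ;;
  eachClass
    (branch (.bin .lt (reg 20) (get 19 (reg 33) 0 0)) skip
      (branch (.bin .lt (get 15 (reg 33) 0 0) (reg 20)) skip
        (store 21 0 0 0 (reg 20) ;; store 21 1 0 0 (get 16 (reg 33) 0 0))))

/-- Pass to the length in register `20` from the preceding one. -/
def advance : AProg :=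
  assign 22 (reg 20 - 1) ;;
  assign 23 (get 0 (reg 22) 0 0) ;;
  branch (.bin .lt (reg 23) (reg 4)) deleteMatches
    (assign 23 (reg 23 - reg 4) ;; refinement ;; buildLists)

def search : AProg :=
  assign 20 0 ;;
  buildLists ;;
  assign 21 1 ;;
  assign 19 (reg 2 + 1) ;;
  forUp 20 (reg 21) 19 (branch (get 21 0 0 0) skip (advance ;; testLength)) ;;
  assign 0 (get 21 0 0 0) ;;
  assign 1 (get 21 1 0 0)

theorem sum_getD (l : List ℕ) (f : ℕ → ℕ) :
    ∑ c ∈ Finset.range l.length, f (l.getD c 0) = (l.map f).sum := by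
  induction l with
  | nil => simp
  | cons x l ih =>
    rw [List.length_cons, Finset.sum_range_succ', List.map_cons, List.sum_cons, ← ih]
    simp [add_comm]

theorem sum_filter_range (n : ℕ) (P : ℕ → Bool) (f : ℕ → ℕ) :
    (((List.range n).filter P).map f).sum = ∑ i ∈ Finset.range n, if P i then f i else 0 := by
  induction n with
  | zero => simp
  | succ n ih =>
    rw [List.range_succ, List.filter_append, List.map_append, List.sum_append, ih,
      Finset.sum_range_succ]
    by_cases h : P n <;> simp [h]

/-- The lists for `q` and `q + 1` differ exactly by the positions with `Z = q`, which the bucket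
enumerates without repetition. After `c` rounds the first `c` elements of the bucket have been
removed from all lists containing them. -/
theorem deleteMatches_spec (hE : G.Input E) (hs : G.Tables s) {q : ℕ} (h22 : s.r 22 = q)
    (hq : q < G.n) (hlt : ∀ j < G.n, s.a 11 j 0 0 < G.n)
    (hL : ∀ κ < G.n, G.ClassLinked s.a (G.In s.a q κ) κ) : Total E deleteMatches s fun s' =>
      (∀ κ < G.n, G.ClassLinked s'.a (G.In s'.a (q + 1) κ) κ) ∧
      s'.tk ≤ s.tk + ∑ i ∈ Finset.range G.n, if G.Z i = q then G.width i + 1 else 0 := by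
  have hX := hE.X_eq
  obtain ⟨l, hl⟩ : ∃ l, l = (List.range G.n).filter (G.Z · = q) := ⟨_, rfl⟩
  have hbk := hs.bucket q
  rw [← hl] at hbk
  have hnd : l.Nodup := hl ▸ List.nodup_range.filter _
  have hmem : ∀ j, j ∈ l ↔ j < G.n ∧ G.Z j = q := by simp [hl]
  have hlen : l.length ≤ G.n := by rw [hl]; exact (List.length_filter_le _ _).trans (by simp)
  have hs0 : G.Tables (s.setReg 29 l.length) := hs.setReg (by omega) (by omega) (by omega)
  simp only [deleteMatches, total_seq, total_assign, AExpr.val_get, AExpr.val_reg, AExpr.val_zero,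
    simple_get, true_or, true_and, h22, hbk.1]
  refine total_for 0 l.length (fun c => G.width (l.getD c 0)) (fun c s' => ∀ κ < G.n,
    G.ClassLinked s'.a (fun j => G.In s.a q κ j ∧ j ∉ l.take c) κ) rfl rfl (by simp) (by omega)
    (by omega) rfl rfl (by omega) ?_ ?_ ?_
  · intro κ hκ
    simpa using hL κ hκ
  · rintro c s1 - hc hr hF h1
    have hs1 := hs0.of_frame hF rfl rfl rfl (by decide)
    have f22 := hF.reg 22 rfl
    have f9 := hF.arr 9 rfl
    have f11 := hF.arr 11 rfl
    have f13 := hF.arr 13 rfl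
    simp [h22] at f22
    have hd := (hmem l[c]).1 (List.getElem_mem hc)
    have hgd : l.getD c 0 = l[c] := by simp [hc]
    have htake : l.take (c + 1) = l.take c ++ [l[c]] := by simp
    have hnt : l[c] ∉ l.take c := by
      have h2 := (List.take_sublist (c + 1) l).nodup hnd
      rw [htake, List.nodup_append] at h2
      exact fun h3 => h2.2.2 _ h3 _ (by simp) rfl
    have hbc := hbk.2 c hc
    rw [hgd]
    generalize l[c] = d at *
    -- The sentinel `0` is never deleted, since `Z 0 = n > q`.
    have hd0 : 0 < d := by
      rcases Nat.eq_zero_or_pos d with rfl | h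
      · have := hd.2
        rw [G.Z_zero] at this
        omega
      · exact h
    have hin : ∀ κ, G.In s.a q κ d ↔ G.InRange (s.a 11 · 0 0) d κ ∧ s.a 13 κ d 0 = 0 := by
      intro κ
      constructor
      · rintro (h | h | h)
        · omega
        · omega
        · exact ⟨h.2.2.1, h.2.2.2.1⟩
      · exact fun h => .inr (.inr ⟨hd0, hd.1, h.1, h.2, hd.2.ge⟩)
    simp only [total_seq, total_assign, AExpr.val_get, AExpr.val_reg, AExpr.val_zero, simple_get,
      true_or, true_and, f22, hr, f9, AState.setReg_a, hbc]
    have hs1' := hs1.setReg (r := 30) (v := d) (by omega) (by omega) (by omega)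
    refine eachClass_spec (j := d) (cls := (s.a 11 · 0 0)) hE hs1' (by simp)
      (by simp only [AState.setReg_a, f11]) (hlt d hd.1) rfl rfl
      (fun D a => a 13 = s.a 13 ∧ ∀ κ < G.n,
        G.ClassLinked a (fun j => (G.In s.a q κ j ∧ j ∉ l.take c) ∧ ¬ (D κ ∧ j = d)) κ)
      ⟨f13, fun κ hκ => by simpa using h1 κ hκ⟩ ?_ ?_
    · rintro κ D s2 hF2 hr2 hκ hinr hD ⟨g13, h2⟩
      have k30 := hF2.reg 30 rfl
      simp only [AState.setReg_r, if_true] at k30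
      have hother : ∀ κ', κ' ≠ κ → ∀ j, ((G.In s.a q κ' j ∧ j ∉ l.take c) ∧ ¬ (D κ' ∧ j = d) ↔
          (G.In s.a q κ' j ∧ j ∉ l.take c) ∧ ¬ ((D κ' ∨ κ' = κ) ∧ j = d)) := by
        intro κ' hne j
        simp [hne]
      rw [total_branch]
      simp only [AExpr.val_get, AExpr.val_reg, AExpr.val_zero, hr2, k30, g13]
      refine ⟨fun hbad => ?_, fun hbad => ?_⟩
      · rw [total_skip]
        refine ⟨⟨g13, fun κ' hκ' => ?_⟩, le_rfl⟩
        by_cases e : κ' = κ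
        · subst e
          refine Linked.congr (h2 _ hκ) fun j => and_congr_right fun hj => ?_
          have : j ≠ d := by
            rintro rfl
            exact hbad ((hin _).1 hj.1).2
          simp [this]
        · exact Linked.congr (h2 κ' hκ') (hother κ' e)
      · refine (deleteLink_spec (A' := fun j => (G.In s.a q κ j ∧ j ∉ l.take c) ∧
          ¬ ((D κ ∨ κ = κ) ∧ j = d)) hr2 k30 (h2 κ hκ) hd0 hd.1
          ⟨⟨(hin κ).2 ⟨hinr, hbad⟩, hnt⟩, fun h => hD h.1⟩ fun j => by simp [hD]).use
          fun s3 hF3 ⟨h3, h4, h5⟩ => ?_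
        refine ⟨⟨(hF3.arr 13 rfl).trans g13, fun κ' hκ' => ?_⟩, h5.le⟩
        by_cases e : κ' = κ
        · subst e
          exact h3
        · exact Linked.congr ((h2 κ' hκ').congr fun α => h4 α κ' e) (hother κ' e)
    · rintro s2 hF2 ⟨-, h2⟩ ht2
      refine ⟨fun κ hκ => ?_, by simpa using ht2⟩
      refine Linked.congr (h2 κ hκ) fun j => ?_
      rw [htake, List.mem_append, List.mem_singleton]
      constructor
      · rintro ⟨⟨h3, h4⟩, h5⟩
        refine ⟨h3, ?_⟩
        rintro (h6 | rfl)
        exacts [h4 h6, h5 ⟨((hin κ).1 h3).1, rfl⟩]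
      · rintro ⟨h3, h4⟩
        exact ⟨⟨h3, fun h5 => h4 (.inl h5)⟩, fun h5 => h4 (.inr h5.2)⟩
  · rintro s1 hF - h1 ht
    refine ⟨fun κ hκ => ?_, ?_⟩
    · unfold Coded.In
      rw [hF.arr 11 rfl, hF.arr 13 rfl]
      refine Linked.congr (h1 κ hκ) fun j => ?_
      rw [List.take_length, hmem]
      constructor
      · rintro ⟨h2 | h2 | h2, h3⟩
        · exact .inl h2
        · exact .inr (.inl h2)
        · exact .inr (.inr ⟨h2.1, h2.2.1, h2.2.2.1, h2.2.2.2.1, by omega⟩)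
      · rintro (rfl | rfl | h2)
        · exact ⟨.inl rfl, by rw [G.Z_zero]; omega⟩
        · exact ⟨.inr (.inl rfl), by omega⟩
        · exact ⟨.inr (.inr ⟨h2.1, h2.2.1, h2.2.2.1, h2.2.2.2.1, by omega⟩), by omega⟩
    · rw [← Finset.range_eq_Ico, sum_getD l fun j => G.width j + 1, hl, sum_filter_range] at ht
      simpa using ht

-- A class is tested by two numbers: its largest gap must be at most `m`, and its longest match at
-- least `m`. In that case the representative with the longest match still has a candidate of length
-- `m`, because only solid offsets lie between `m0` and `m`. Restricting to the classes that may
-- contain `n - m` loses no cover.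
open Classical in
theorem testLength_spec (hE : G.Input E) (hs : G.Tables s) {m m0 : ℕ} (h20 : s.r 20 = m)
    (hm : 0 < m) (hmn : m ≤ G.n) (hm0 : m0 ≤ m) (hns : ∀ t, m0 ≤ t → t < m → ¬ G.NS t)
    (hC : G.Classified m0 s.a) (hB : G.Bests m0 s.a)
    (hL : ∀ κ < G.n, G.ClassLinked s.a (G.In s.a m κ) κ) (h0 : s.a 21 0 0 0 = 0) :
    Total E testLength s fun s' => (s'.a 21 0 0 0 = 0 ∧ (∀ i, ¬ G.Good m i) ∨
      s'.a 21 0 0 0 = m ∧ G.Good m (s'.a 21 1 0 0)) ∧ s'.tk ≤ s.tk + G.width (G.n - m) := by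
  have hX := hE.X_eq
  simp only [testLength, total_seq, total_assign, AExpr.val_sub, AExpr.val_reg, simple_sub,
    simple_reg, true_or, true_and, hs.n, h20]
  have hs0 : G.Tables (s.setReg 30 (G.n - m)) := hs.setReg (by omega) (by omega) (by omega)
  refine eachClass_spec (j := G.n - m) (cls := (s.a 11 · 0 0)) hE hs0 (by simp) rfl
    (hC.cls_lt _ (by omega)) rfl rfl
    (fun d a => a 21 0 0 0 = 0 ∧ (∀ κ, d κ → ¬ (s.a 19 κ 0 0 ≤ m ∧ m ≤ s.a 15 κ 0 0)) ∨
      a 21 0 0 0 = m ∧ G.Good m (a 21 1 0 0)) (.inl ⟨h0, fun _ => False.elim⟩) ?_ ?_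
  · rintro κ d s1 hF hr hκ - - h1
    have f20 := hF.reg 20 rfl
    have f15 := hF.arr 15 rfl
    have f16 := hF.arr 16 rfl
    have f19 := hF.arr 19 rfl
    simp [h20] at f20 f15 f16 f19
    have hno : ¬ (s.a 19 κ 0 0 ≤ m ∧ m ≤ s.a 15 κ 0 0) → (s1.a 21 0 0 0 = 0 ∧
        (∀ x, d x ∨ x = κ → ¬ (s.a 19 x 0 0 ≤ m ∧ m ≤ s.a 15 x 0 0)) ∨
        s1.a 21 0 0 0 = m ∧ G.Good m (s1.a 21 1 0 0)) := by
      intro h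
      rcases h1 with h1 | h1
      · refine .inl ⟨h1.1, ?_⟩
        rintro x (hx | rfl)
        exacts [h1.2 x hx, h]
      · exact .inr h1
    simp only [total_branch, total_skip, AExpr.val_lt, AExpr.val_get, AExpr.val_reg,
      AExpr.val_zero, hr, f20, f15, f19]
    refine ⟨fun h => ⟨hno fun h2 => h (if_neg (by omega)), le_rfl⟩, fun h => ⟨fun h' =>
      ⟨hno fun h2 => h' (if_neg (by omega)), le_rfl⟩, fun h' => ?_⟩⟩
    have hM : s.a 19 κ 0 0 ≤ m := by
      by_contra h2
      rw [if_pos (by omega)] at h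
      omega
    have hz : m ≤ s.a 15 κ 0 0 := by
      by_contra h2
      rw [if_pos (by omega)] at h'
      omega
    obtain ⟨b1, b2, b3, b4⟩ := hB.spec κ hκ (by omega)
    have hact : G.Active m (s.a 16 κ 0 0) := b3.extend hns (by omega)
    have hg : G.Good m (s.a 16 κ 0 0) := by
      refine (hC.good_iff hm0 hm hns b1 hact (prv := (s.a 17 κ · 0))
        (nxt := (s.a 18 κ · 0)) ?_).2 hM
      rw [b4]
      exact hL κ hκ
    simp [f20, f16, hr, hg]
  · rintro s1 hF h1 ht
    refine ⟨h1.imp (fun h => ⟨h.1, fun i hg => ?_⟩) id, by simpa using ht⟩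
    have hi : i < G.n := by have := hg.1; have := hg.pos; omega
    have hin := hC.inRange_of_good hm0 hns hg
    have ha := hg.active
    refine h.2 _ hin ⟨(hC.good_iff hm0 hm hns hi ha
      (prv := (s.a 17 (s.a 11 i 0 0) · 0)) (nxt := (s.a 18 (s.a 11 i 0 0) · 0)) ?_).1 hg, ha.1.trans (hB.le i hi (ha.mono hm0))⟩
    exact hL _ (hC.cls_lt i hi)

/-! ### Passing to the next length, and the total cost of the search. -/

namespace Coded

/-- The arrays are up to date for length `m`. -/
def Ready (G : Coded) (m : ℕ) (a : ℕ → ℕ → ℕ → ℕ → ℕ) : Prop :=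
  ∃ m0 ≤ m, (∀ t, m0 ≤ t → t < m → ¬ G.NS t) ∧ G.Classified m0 a ∧ G.Bests m0 a ∧
    ∀ κ < G.n, G.ClassLinked a (G.In a m κ) κ

open Classical in
/-- The number of steps to pass from length `q` to length `q + 1`. -/
noncomputable def advanceCost (G : Coded) (q : ℕ) : ℕ :=
  (if G.NS q then 2 * ∑ j ∈ Finset.range G.n, G.width j + 6 * G.n else 0) +
    ∑ i ∈ Finset.range G.n, if G.Z i = q then G.width i + 1 else 0

end Coded

/-- At a solid `q` the classification and the best matches stay as they are, with the old base
length `m0`, and only lists shrink. At a non-solid `q` everything is recomputed and the base length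
becomes `q + 1`. -/
theorem advance_spec (hE : G.Input E) (hs : G.Tables s) {q : ℕ} (hq : q < G.n)
    (h20 : s.r 20 = q + 1) (hR : G.Ready q s.a) (h0 : ∀ κ c, s.a 12 (q + 1) κ c = 0) :
    Total E advance s fun s' => G.Ready (q + 1) s'.a ∧ (∀ m, m ≠ q + 1 → s'.a 12 m = s.a 12 m) ∧
      s'.tk ≤ s.tk + G.advanceCost q := by
  obtain ⟨m0, hm0, hns, hC, hB, hL⟩ := hR
  have hcode := hs.code q hq
  simp only [advance, total_seq, total_assign, total_branch, AExpr.val_sub, AExpr.val_reg,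
    AExpr.val_one, AExpr.val_get, AExpr.val_zero, AExpr.val_lt, simple_sub, simple_reg, simple_get,
    true_or, true_and, h20, Nat.add_sub_cancel, AState.setReg_r, AState.setReg_a, if_true, hcode,
    if_neg (show (4 : ℕ) ≠ 22 by omega), if_neg (show (4 : ℕ) ≠ 23 by omega), hs.σ]
  have hs1 : G.Tables ((s.setReg 22 q).setReg 23 (G.code q)) :=
    (hs.setReg (by omega) (by omega) (by omega)).setReg (by omega) (by omega) (by omega)
  refine ⟨fun h => ?_, fun h => ?_⟩
  · have hsol : ¬ G.NS q := by
      intro h1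
      have := h1.2
      rw [if_neg (by omega)] at h
      omega
    refine (deleteMatches_spec hE hs1 (by simp) hq hC.cls_lt hL).use fun s2 F2 ⟨h2, t2⟩ => ?_
    refine ⟨⟨m0, by omega, fun t h3 h4 => ?_, ?_, ?_, h2⟩, fun m _ => by rw [F2.arr 12 rfl]; rfl, ?_⟩
    · rcases Nat.lt_succ_iff_lt_or_eq.1 h4 with h5 | rfl
      exacts [hns t h3 h5, hsol]
    · unfold Coded.Classified
      rw [F2.arr 10 rfl, F2.arr 11 rfl, F2.arr 13 rfl]
      exact hC
    · unfold Coded.Bests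
      rw [F2.arr 11 rfl, F2.arr 15 rfl, F2.arr 16 rfl]
      exact hB
    · simpa [Coded.advanceCost, hsol] using t2
  · have hN : G.NS q := by
      refine ⟨hq, ?_⟩
      by_contra h1
      rw [if_pos (by omega)] at h
      omega
    have hs2 : G.Tables (((s.setReg 22 q).setReg 23 (G.code q)).setReg 23 (G.code q - G.σ)) :=
      hs1.setReg (by omega) (by omega) (by omega)
    have := refinement_spec hE hs2 hN (by simp [h20]) (by simp) (by simp) hC hm0 hns h0
    refine this.use fun s3 F3 ⟨h3, h3', t3⟩ => ?_
    have hs3 := hs2.of_frame F3 rfl rfl rfl (by decide)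
    have e3 := F3.reg 20 rfl
    simp [h20] at e3
    refine (buildLists_spec hE hs3 e3 h3).use fun s4 F4 ⟨h4, h5, t4⟩ => ?_
    refine ⟨⟨q + 1, le_rfl, fun t _ _ => by omega, ?_, h4, h5⟩, fun m hm => ?_, ?_⟩
    · unfold Coded.Classified
      rw [F4.arr 10 rfl, F4.arr 11 rfl, F4.arr 13 rfl]
      exact h3
    · rw [F4.arr 12 rfl, h3' m hm]
      rfl
    · simp [Coded.advanceCost, hN] at t3 ⊢
      omega

namespace Coded

/-- At most `k` lengths require rebuilding. Exchanging the sums in the deletion part shows that each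
position is charged for at most one `q`, namely `q = Z i`. -/
theorem sum_advanceCost_le : ∑ q ∈ Finset.range G.n, G.advanceCost q ≤
    G.k * (2 * ∑ j ∈ Finset.range G.n, G.width j + 6 * G.n) +
      (∑ j ∈ Finset.range G.n, G.width j + G.n) := by
  classical
  unfold advanceCost
  rw [Finset.sum_add_distrib]
  refine Nat.add_le_add ?_ ?_
  · rw [← Finset.sum_filter, Finset.sum_const, smul_eq_mul]
    refine Nat.mul_le_mul_right _ ?_
    have := nsBelow_le (G := G) G.n
    unfold nsBelow at this
    convert this
  · rw [Finset.sum_comm]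
    refine (Finset.sum_le_sum (g := fun i => G.width i + 1) fun i _ => ?_).trans ?_
    · rw [Finset.sum_ite_eq]
      split <;> omega
    · simp [Finset.sum_add_distrib]

end Coded

/-- Lengths are tried in increasing order, so the first success is a shortest cover. Until then no
shorter length works and the naming tables for the lengths still to come are untouched; afterwards
the loop runs idle. The value `0` serves as "nothing found" because covers have positive length. -/
theorem search_spec (hE : G.Input E) (hs : G.Tables s) (h0 : ∀ α, 10 ≤ α → s.a α = 0) :
    Total E search s fun s' => G.Answer (s'.r 0) (s'.r 1) ∧
      s'.tk ≤ s.tk + 9 * (G.n * (G.k + 1) ^ 3) := by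
  have hX := hE.X_eq
  simp only [search, total_seq, total_assign, AExpr.val_zero, AExpr.val_one, simple_zero,
    simple_one, true_or, true_and]
  have hs1 : G.Tables (s.setReg 20 0) := hs.setReg (by omega) (by omega) (by omega)
  have hC1 : G.Classified 0 (s.setReg 20 0).a := by
    unfold Coded.Classified
    simp only [AState.setReg_a]
    rw [h0 10 (by omega), h0 11 (by omega), h0 13 (by omega)]
    exact Coded.Classes.zero
  refine (buildLists_spec hE hs1 (by simp) hC1).use fun s2 F2 ⟨h2, h3, t2⟩ => ?_
  have hs2 := hs1.of_frame F2 rfl rfl rfl (by decide)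
  have hC2 : G.Classified 0 s2.a := by
    unfold Coded.Classified
    rw [F2.arr 10 rfl, F2.arr 11 rfl, F2.arr 13 rfl]
    exact hC1
  have g12 := (F2.arr 12 rfl).trans (h0 12 (by omega))
  have g21 := (F2.arr 21 rfl).trans (h0 21 (by omega))
  have hs3 : G.Tables ((s2.setReg 21 1).setReg 19 (G.n + 1)) :=
    (hs2.setReg (by omega) (by omega) (by omega)).setReg (by omega) (by omega) (by omega)
  simp only [AExpr.val_add, AExpr.val_reg, AExpr.val_one, AState.setReg_r,
    if_neg (show (2 : ℕ) ≠ 21 by omega), hs2.n]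
  refine ⟨.inr (by omega), ?_⟩
  refine total_for 1 (G.n + 1) (fun m => G.advanceCost (m - 1) + G.width (G.n - m)) (fun m s' =>
    (∃ m' < m, 0 < m' ∧ s'.a 21 0 0 0 = m' ∧ G.Good m' (s'.a 21 1 0 0) ∧
      ∀ m'' < m', ∀ i, ¬ G.Good m'' i) ∨
    s'.a 21 0 0 0 = 0 ∧ G.Ready (m - 1) s'.a ∧ (∀ m' < m, ∀ i, ¬ G.Good m' i) ∧
      ∀ m', m ≤ m' → s'.a 12 m' = 0) rfl (by simp) (by simp) (by omega) (by omega) rfl rfl (by omega)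
    ?_ ?_ ?_
  · refine .inr ⟨by simp [g21], ⟨0, le_rfl, fun t _ _ => by omega, hC2, h2, h3⟩, fun m' hm' i hg => ?_,
      fun m' _ => by simp [g12]⟩
    have := hg.pos
    omega
  · rintro m s4 hm1 hmn hr hF h4
    have hs4 := hs3.of_frame hF rfl rfl rfl (by decide)
    simp only [total_branch, total_skip, AExpr.val_get, AExpr.val_zero]
    rcases h4 with ⟨m', h5, h6, h7, h8⟩ | ⟨h5, h6, h7, h8⟩
    · refine ⟨fun _ => ⟨.inl ⟨m', by omega, h6, h7, h8⟩, by omega⟩, fun h => by omega⟩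
    refine ⟨fun h => absurd h5 h, fun _ => ?_⟩
    obtain ⟨q, rfl⟩ : ∃ q, m = q + 1 := ⟨m - 1, by omega⟩
    simp only [Nat.add_sub_cancel] at h6 ⊢
    rw [total_seq]
    refine (advance_spec hE hs4 (by omega) hr h6 fun κ c => by rw [h8 _ le_rfl]; rfl).use
      fun s5 F5 ⟨h9, h10, t5⟩ => ?_
    have hs5 := hs4.of_frame F5 rfl rfl rfl (by decide)
    have e20 := (F5.reg 20 rfl).trans hr
    obtain ⟨m0, hm0, hns, hC, hB, hL⟩ := h9
    refine (testLength_spec hE hs5 e20 (by omega) (by omega) hm0 hns hC hB hL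
      (by rw [F5.arr 21 rfl]; exact h5)).use fun s6 F6 ⟨h11, t6⟩ => ?_
    refine ⟨?_, by omega⟩
    simp only [AState.tick_a, AState.setReg_a]
    rcases h11 with ⟨h12, h13⟩ | ⟨h12, h13⟩
    · refine .inr ⟨h12, ⟨m0, hm0, hns, ?_, ?_, ?_⟩, fun m' hm' => ?_, fun m' hm' => ?_⟩
      · unfold Coded.Classified
        rw [F6.arr 10 rfl, F6.arr 11 rfl, F6.arr 13 rfl]
        exact hC
      · unfold Coded.Bests
        rw [F6.arr 11 rfl, F6.arr 15 rfl, F6.arr 16 rfl]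
        exact hB
      · unfold Coded.ClassLinked Coded.In
        rw [F6.arr 11 rfl, F6.arr 13 rfl, F6.arr 17 rfl, F6.arr 18 rfl, F6.arr 19 rfl]
        exact hL
      · rcases Nat.lt_succ_iff_lt_or_eq.1 hm' with h14 | rfl
        exacts [h7 m' h14, h13]
      · rw [F6.arr 12 rfl, h10 m' (by omega), h8 m' (by omega)]
    · exact .inl ⟨q + 1, by omega, by omega, h12, h13, h7⟩
  · rintro s4 hF - h4 t4
    simp only [AExpr.val_get, AExpr.val_zero, AExpr.val_one, simple_get, true_or, true_and,
      AState.setReg_a, AState.setReg_tk, if_true, if_neg (show (0 : ℕ) ≠ 1 by omega)]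
    refine ⟨?_, ?_⟩
    · rcases h4 with ⟨m', h5, h6, h7, h8, h9⟩ | ⟨h5, h6, h7, h8⟩
      · rw [h7]
        refine .inl ⟨h8, fun m'' i hg => ?_⟩
        by_contra h
        exact h9 m'' (by omega) i hg
      · refine .inr ⟨h5, fun m' i hg => h7 m' ?_ i hg⟩
        have := hg.le
        omega
    · have hW := Coded.width_sum_le (G := G)
      have hA := Coded.sum_advanceCost_le (G := G)
      -- As `m` runs from `1` to `n`, the tested position `n - m` runs through all positions once.
      have hrefl := Finset.sum_range_reflect (fun j => G.width j) G.n
      rw [Finset.sum_Ico_eq_sum_range] at t4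
      have hsum : ∑ i ∈ Finset.range (G.n + 1 - 1), (G.advanceCost (1 + i - 1) +
          G.width (G.n - (1 + i)) + 1) = ∑ q ∈ Finset.range G.n, G.advanceCost q +
          ∑ j ∈ Finset.range G.n, G.width j + G.n := by
        rw [Nat.add_sub_cancel, ← hrefl, Finset.sum_add_distrib, Finset.sum_add_distrib]
        simp [Nat.sub_sub]
      rw [hsum] at t4
      simp only [AState.setReg_tk] at t4 t2
      have hp : G.k * (2 * ∑ j ∈ Finset.range G.n, G.width j + 6 * G.n) ≤
          G.k * (2 * (G.n * (G.k ^ 2 + 1)) + 6 * G.n) := Nat.mul_le_mul_left _ (by omega)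
      have hfin : 3 * (G.n * (G.k ^ 2 + 1)) + G.k * (2 * (G.n * (G.k ^ 2 + 1)) + 6 * G.n) + 6 * G.n ≤
          9 * (G.n * (G.k + 1) ^ 3) := by
        have : 9 * (G.n * (G.k + 1) ^ 3) = 3 * (G.n * (G.k ^ 2 + 1)) +
          G.k * (2 * (G.n * (G.k ^ 2 + 1)) + 6 * G.n) + 6 * G.n +
          G.n * (7 * G.k ^ 3 + 24 * G.k ^ 2 + 19 * G.k) := by ring
        omega
      omega

/-! ### The algorithm on the word RAM -/

/-- Set up the registers that determine the memory layout. -/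
def initLayout : Prog :=
  .seq (.assign 63 (.bin .add (.bin .mul (.lit 4) (.load (.lit 0))) (.lit 41)))
    (.assign 62 (.bin .mul (.reg 63) (.bin .mul (.reg 63) (.bin .mul (.reg 63) (.bin .mul (.reg 63)
      (.bin .mul (.reg 63) (.bin .mul (.reg 63) (.reg 63))))))))

/-- This reduces the claim that the preparation leaves all arrays from `10` on zero to a finite
check of the indices below `32`. -/
theorem AProg.writesArr_of_wf {α : ℕ} : ∀ p : AProg, p.wf = true → 32 ≤ α → p.writesArr α = false
  | skip, _, _ => rfl
  | assign _ _, _, _ => rfl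
  | store _ _ _ _ _, h, hα => by
    simp only [wf, Bool.and_eq_true, decide_eq_true_eq] at h
    simp only [writesArr, decide_eq_false_iff_not]
    omega
  | seq p q, h, hα => by
    simp only [wf, Bool.and_eq_true] at h
    simp [writesArr, writesArr_of_wf p h.1 hα, writesArr_of_wf q h.2 hα]
  | branch _ p q, h, hα => by
    simp only [wf, Bool.and_eq_true] at h
    simp [writesArr, writesArr_of_wf p h.1.2 hα, writesArr_of_wf q h.2 hα]
  | loop _ p, h, hα => by
    simp only [wf, Bool.and_eq_true] at h
    exact writesArr_of_wf p h.2 hα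

def shortestCover : AProg := prepare ;; search

theorem shortestCover_wf : shortestCover.wf = true := by decide

variable {σ n : ℕ} (T : IString (Fin σ) n)

/-- The environment for the input `T`. -/
def IString.env : Env where
  inp a := T.input.getD a 0
  X := 4 * n + 40

theorem IString.env_input (h2 : 2 ≤ σ) (hσ : σ ≤ n) : (T.coded h2 hσ).Input T.env where
  X_eq := rfl
  inp_n := T.getD_input_head.1
  inp_k := T.getD_input_head.2.1
  inp_σ := T.getD_input_head.2.2
  inp_code i hi := by
    replace hi : i < n := hi
    simp only [env, coded, dif_pos hi]
    exact T.getD_input_code hi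
  inp_bits j hj c hc := T.getD_input_bits hj hc

theorem IString.layout {w : ℕ} (hn : 2 ≤ n) (hw : n ^ 120 ≤ 2 ^ w) : Layout T.env w where
  hX := by simp only [env]; omega
  hw := by
    -- This is where `120 = 6 * 20` comes from: the side length of the arrays is at most `n ^ 6`,
    -- and the layout needs its 20th power to fit into a word.
    have h : 4 * n + 40 + 1 ≤ n ^ 6 := by
      have : 2 ^ 5 ≤ n ^ 5 := Nat.pow_le_pow_left hn 5
      calc 4 * n + 40 + 1 ≤ 2 ^ 5 * n := by omega
        _ ≤ n ^ 5 * n := Nat.mul_le_mul_right _ this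
        _ = n ^ 6 := (pow_succ n 5).symm
    calc (4 * n + 40 + 1) ^ 20 ≤ (n ^ 6) ^ 20 := Nat.pow_le_pow_left h 20
      _ = n ^ 120 := by rw [← pow_mul]
      _ ≤ 2 ^ w := hw

theorem eval_side {w : ℕ} (hw : 4 * n + 41 < 2 ^ w) :
    (Expr.bin .add (.bin .mul (.lit 4) (.load (.lit 0))) (.lit 41)).eval w T.initState =
      4 * n + 41 := by
  simp only [Expr.eval, Op.apply, Nat.zero_mod, IString.initState, T.getD_input_head.1]
  rw [Nat.mod_eq_of_lt (show 4 < 2 ^ w by omega), Nat.mod_eq_of_lt (show 4 * n < 2 ^ w by omega),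
    Nat.mod_eq_of_lt (show 41 < 2 ^ w by omega), Nat.mod_eq_of_lt hw]

theorem eval_offset {w Y : ℕ} (hw : Y ^ 20 ≤ 2 ^ w) (hY : 1 < Y) {cs : State} (h : cs.reg 63 = Y) :
    (Expr.bin .mul (.reg 63) (.bin .mul (.reg 63) (.bin .mul (.reg 63) (.bin .mul (.reg 63)
      (.bin .mul (.reg 63) (.bin .mul (.reg 63) (.reg 63))))))).eval w cs = Y ^ 7 := by
  simp only [Expr.eval, Op.apply, h]
  have e : ∀ d < 19, Y * Y ^ d % 2 ^ w = Y ^ (d + 1) := fun d hd => by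
    rw [← pow_succ', Nat.mod_eq_of_lt (lt_of_lt_of_le (Nat.pow_lt_pow_right hY (by omega)) hw)]
  have e1 := e 1 (by omega)
  rw [pow_one] at e1
  rw [e1, e 2 (by omega), e 3 (by omega), e 4 (by omega), e 5 (by omega), e 6 (by omega)]

theorem IString.length_input_le (hσ : σ ≤ n) : T.input.length ≤ (T.env.X + 1) ^ 7 := by
  rw [show T.env.X + 1 = 4 * n + 41 from rfl]
  have h1 : T.numNonSolid * σ ≤ n * n := Nat.mul_le_mul T.numNonSolid_le hσ
  have h3 : (4 * n + 41) ^ 2 ≤ (4 * n + 41) ^ 7 := Nat.pow_le_pow_right (by omega) (by omega)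
  rw [T.length_input]
  nlinarith

theorem IString.sim_init {cs : State} (h2 : 2 ≤ σ) (hσ : σ ≤ n) (hr : ∀ r < 62, cs.reg r = 0)
    (h63 : cs.reg 63 = T.env.X + 1) (h62 : cs.reg 62 = (T.env.X + 1) ^ 7)
    (hm : cs.mem = T.initState.mem) : Sim T.env cs ⟨fun _ => 0, fun _ _ _ _ => 0, 0⟩ where
  reg := hr
  regY := h63
  regO := h62
  arr α _ x _ y _ z _ := by
    rw [hm]
    have h := (T.length_input_le hσ).trans (le_cell (Y := T.env.X + 1) (α := α) (x := x) (y := y)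
      (z := z) (by omega))
    generalize cell _ _ α x y z = b at *
    exact List.getD_eq_default _ _ h
  inp a _ := congrFun hm a
  r_le _ := Nat.zero_le _
  a_le _ _ _ _ := Nat.zero_le _
  inp_le a := (T.getD_input_le h2 hσ a).trans (by simp only [env]; omega)

theorem IString.runs_initLayout {w : ℕ} (hl : Layout T.env w) (h2 : 2 ≤ σ) (hσ : σ ≤ n) :
    ∃ t cs, Runs w initLayout T.initState t cs ∧ t ≤ 30 ∧
      Sim T.env cs ⟨fun _ => 0, fun _ _ _ _ => 0, 0⟩ := by
  have hX := hl.hX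
  have hw := hl.hw
  have hlt : T.env.X + 1 < 2 ^ w :=
    lt_of_lt_of_le (lt_self_pow₀ (by omega) (by omega)) hw
  refine ⟨_, _, .seq (.assign _ _ _) (.assign _ _ _), by simp [Expr.cost],
    T.sim_init h2 hσ (fun r hr => ?_) ?_ ?_ rfl⟩
  · simp [initState, show r ≠ 62 by omega, show r ≠ 63 by omega]
  · simp only [Function.update_of_ne (show (63 : ℕ) ≠ 62 by omega), Function.update_self]
    exact eval_side T hlt
  · simp only [Function.update_self]
    refine eval_offset hw (by omega) ?_
    simp only [Function.update_self]
    exact eval_side T hlt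

theorem shortestCover_spec (h2 : 2 ≤ σ) (hσ : σ ≤ n) :
    Total T.env shortestCover ⟨fun _ => 0, fun _ _ _ _ => 0, 0⟩ fun s =>
      (T.coded h2 hσ).Answer (s.r 0) (s.r 1) ∧ s.tk ≤ 39 * (n * (T.numNonSolid + 1) ^ 3) := by
  have hE := T.env_input h2 hσ
  rw [shortestCover, total_seq]
  refine (prepare_spec hE fun _ _ _ _ => rfl).use fun s F ⟨h, t⟩ => ?_
  have hw : ∀ α, 10 ≤ α → prepare.writesArr α = false := by
    intro α hα
    by_cases h : α < 32
    · have : ∀ α < 32, 10 ≤ α → prepare.writesArr α = false := by decide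
      exact this α h hα
    · exact AProg.writesArr_of_wf prepare (by decide) (by omega)
  refine (search_spec hE h fun α hα => F.arr α (hw α hα)).mono fun s' ⟨h', t'⟩ => ⟨h', ?_⟩
  have h3 : n * (T.numNonSolid + 1) ^ 2 ≤ n * (T.numNonSolid + 1) ^ 3 :=
    Nat.mul_le_mul_left _ (Nat.pow_le_pow_right (by omega) (by omega))
  change s.tk ≤ 0 + 30 * (n * (T.numNonSolid + 1) ^ 2) at t
  change s'.tk ≤ s.tk + 9 * (n * (T.numNonSolid + 1) ^ 3) at t'
  omega

end IndetString

theorem mainTheorem6 :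
    ∃ (P : IndetString.Prog) (c C : ℕ),
      ∀ (n σ : ℕ), 2 ≤ σ → σ ≤ n →
      ∀ (T : IndetString.IString (Fin σ) n) (w : ℕ), n ^ c ≤ 2 ^ w →
        ∃ (t : ℕ) (s : IndetString.State),
          IndetString.Runs w P T.initState t s ∧
          t ≤ C * (n * (max 1 T.numNonSolid) ^ 4) ∧
          T.IsAnswer (s.reg 0) (s.reg 1) := by
  -- The layout is set up in at most `30` steps. The main program makes at most `39 * n * (k + 1) ^
  -- 3` loop iterations, and `(k + 1) ^ 3 ≤ 8 * max 1 k ^ 4`, so one plus their number is at most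
  -- `313 = 1 + 39 * 8` times the claimed bound.
  refine ⟨.seq IndetString.initLayout IndetString.shortestCover.compile, 120,
    30 + 313 * IndetString.shortestCover.size, fun n σ h2 hσ T w hw => ?_⟩
  have hl := T.layout (by omega) hw
  obtain ⟨t, cs, h3, h4, h5⟩ := T.runs_initLayout hl h2 hσ
  obtain ⟨s, h6, h7, h8⟩ := IndetString.shortestCover_spec T h2 hσ
  obtain ⟨t', cs', h9, h10, -, h11⟩ := h6.simulate hl IndetString.shortestCover_wf cs h5
  refine ⟨t + t', cs', .seq h3 h9, ?_, ?_⟩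
  · obtain ⟨K, hK⟩ : ∃ K, K = max 1 T.numNonSolid := ⟨_, rfl⟩
    obtain ⟨N, hN⟩ : ∃ N, N = n * K ^ 4 := ⟨_, rfl⟩
    rw [← hK, ← hN]
    have h12 : n * (T.numNonSolid + 1) ^ 3 ≤ 8 * N := by
      calc n * (T.numNonSolid + 1) ^ 3 ≤ n * (2 * K) ^ 3 :=
            Nat.mul_le_mul_left _ (Nat.pow_le_pow_left (by omega) 3)
        _ = 8 * (n * K ^ 3) := by ring
        _ ≤ 8 * (n * K ^ 4) :=
            Nat.mul_le_mul_left _ (Nat.mul_le_mul_left _ (Nat.pow_le_pow_right (by omega) (by omega)))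
        _ = 8 * N := by rw [hN]
    have h13 : 1 ≤ N := hN ▸ Nat.mul_pos (by omega) (Nat.pow_pos (by omega))
    calc t + t' ≤ 30 * N + IndetString.shortestCover.size * (313 * N) :=
          Nat.add_le_add (by omega) (h11.trans (Nat.mul_le_mul_left _ (by simp only; omega)))
      _ = (30 + 313 * IndetString.shortestCover.size) * N := by ring
  · rw [h10.reg 0 (by omega), h10.reg 1 (by omega)]
    exact T.isAnswer_of_answer h7
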